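/- Let $q\ge 1$, $\Omega_q=\{\mathbf{x}\in\mathbb{R}^{q+1}:\|\mathbf{x}\|=1\}$ with surface measure, and let $(\mathbf{X}_1,Y_1),(\mathbf{X}_2,Y_2),\ldots$ be i.i.d. in $\Omega_q\times\mathbb{R}$ from the model $Y=m(\mathbf{X})+\sigma(\mathbf{X})\varepsilon$, where $\mathbf{X}$ has density $f$ with respect to the surface measure, $\mathbb{E}[\varepsilon|\mathbf{X}]=0$, $\mathbb{E}[\varepsilon^2|\mathbf{X}]=1$, and $\mathbb{E}[|\varepsilon|^3|\mathbf{X}]$, $\mathbb{E}[\varepsilon^4|\mathbf{X}]$ are bounded random variables. Assume: - **A1.** Extended to $\mathbb{R}^{q+1}\setminus\{\mathbf{0}\}$ by $m(\mathbf{x})=m(\mathbf{x}/\|\mathbf{x}\|)$ and $f(\mathbf{x})=f(\mathbf{x}/\|\mathbf{x}\|)$, $m$ is three times and $f$ twice continuously differentiable, and $f$ is bounded away from zero. - **A2.** $\sigma^2$ is uniformly continuous and bounded away from zero on $\Omega_q$. - **A3.** $L:[0,\infty)\to[0,\infty)$ is continuous, not identically zero, and $L(r)\le Me^{-\alpha r}$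 for all $r\ge 0$, for some $M,\alpha>0$. - **A4.** The bandwidths $h=h_n>0$ satisfy $h\to0$ and $nh^q\to\infty$. Let $\omega_{q-1}=2\pi^{q/2}/\Gamma(q/2)$, $\lambda_{h,q}(L)=\omega_{q-1}\int_0^{2h^{-2}}L(r)r^{\frac q2-1}(2-rh^2)^{\frac q2-1}dr$, $\lambda_q(L)=2^{\frac q2-1}\omega_{q-1}\int_0^\infty L(r)r^{\frac q2-1}dr$, $b_q(L)=\int_0^\infty L(r)r^{\frac q2}dr\big/\int_0^\infty L(r)r^{\frac q2-1}dr$ and $L_h(\mathbf{x},\mathbf{y})=(\lambda_{h,q}(L)h^q)^{-1}L\big((1-\mathbf{x}^T\mathbf{y})/h^2\big)$. For each $\mathbf{x}\in\Omega_q$ let $\mathbf{B}_\mathbf{x}=(\mathbf{b}_1,\ldots,\mathbf{b}_q)$, where $\mathbf{b}_1,\ldots,\mathbf{b}_q$ complete $\mathbf{x}$ to an orthonormal basis of $\mathbb{R}^{q+1}$. For $p\in\{0,1\}$ the projected local estimator is $$\hat m_{h,p}(\mathbf{x})=\mathbf{e}_1^T(\mathcal{X}_{\mathbf{x},p}^T\mathcal{W}_\mathbf{x}\mathcal{X}_{\mathbf{x},p})^{-1}\mathcal{X}_{\mathbf{x},p}^T\mathcal{W}_\mathbf{x}(Y_1,\ldots,Y_n)^T,$$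 where $\mathcal{W}_\mathbf{x}=\mathrm{diag}(L_h(\mathbf{x},\mathbf{X}_1),\ldots,L_h(\mathbf{x},\mathbf{X}_n))$, $\mathcal{X}_{\mathbf{x},0}$ is the column of $n$ ones, and $\mathcal{X}_{\mathbf{x},1}$ has rows $(1,(\mathbf{X}_i-\mathbf{x})^T\mathbf{B}_\mathbf{x})$, $i=1,\ldots,n$ (with the convention that a singular matrix has inverse $0$). Then, for $p=0,1$, with conditional mean and variance taken under the regular conditional distribution given $\mathbf{X}_1,\ldots,\mathbf{X}_n$, $$\mathbb{E}[\hat m_{h,p}(\mathbf{x})-m(\mathbf{x})\,|\,\mathbf{X}_1,\ldots,\mathbf{X}_n]=\frac{b_q(L)}{q}B_p(\mathbf{x})h^2+o_{\mathbb{P}}(h^2)+\delta_{p,0}\,O_{\mathbb{P}}\Big(\frac{h}{\sqrt{nh^q}}\Big),$$ $$\mathbb{V}\mathrm{ar}[\hat m_{h,p}(\mathbf{x})\,|\,\mathbf{X}_1,\ldots,\mathbf{X}_n]=\frac{\lambda_q(L^2)\lambda_q(L)^{-2}}{nh^qf(\mathbf{x})}\sigma^2(\mathbf{x})+o_{\mathbb{P}}\big((nh^q)^{-1}\big),$$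 uniformly in $\mathbf{x}\in\Omega_q$, where, with $\nabla$ the gradient and $\mathcal{H}_m$ the Hessian matrix in $\mathbb{R}^{q+1}$ of the extended functions, $$B_0(\mathbf{x})=2\,\frac{\nabla f(\mathbf{x})^T\nabla m(\mathbf{x})}{f(\mathbf{x})}+\mathrm{tr}\,\mathcal{H}_m(\mathbf{x}),\qquad B_1(\mathbf{x})=\mathrm{tr}\,\mathcal{H}_m(\mathbf{x}).$$ Here $R_n(\mathbf{x})=o_{\mathbb{P}}(r_n)$ uniformly in $\mathbf{x}$ means $\sup_{\mathbf{x}\in\Omega_q}\mathbb{P}(|R_n(\mathbf{x})|>\delta r_n)\to0$ for every $\delta>0$, and $R_n(\mathbf{x})=O_{\mathbb{P}}(r_n)$ uniformly in $\mathbf{x}$ means that for every $\delta>0$ there is $C$ with $\sup_{\mathbf{x}\in\Omega_q}\mathbb{P}(|R_n(\mathbf{x})|>Cr_n)\le\delta$ for all large $n$. -/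

import Mathlib

open MeasureTheory ProbabilityTheory Filter Topology Set

noncomputable section

namespace ProjLocal

/-- The unit sphere `Ω_q` of `ℝ^{q+1}`. -/
abbrev Sph (q : ℕ) : Type :=
  Metric.sphere (0 : EuclideanSpace ℝ (Fin (q + 1))) 1

/-! ### Differential calculus on the sphere through the radial extension -/

/-- The radial extension `x ↦ g (x / ‖x‖)` to `ℝ^{q+1} \ {0}` (the value at `0` is irrelevant). -/
def radialExt {q : ℕ} (g : Sph q → ℝ) (x : EuclideanSpace ℝ (Fin (q + 1))) : ℝ :=
  open Classical in
  if hx : x ≠ 0 then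
    g ⟨‖x‖⁻¹ • x, by simp [norm_smul, norm_ne_zero_iff.mpr hx]⟩
  else 0

/-- The gradient in `ℝ^{q+1}`, at a point of the sphere, of the radial extension of `g`. -/
def sphGrad {q : ℕ} (g : Sph q → ℝ) (x : Sph q) : EuclideanSpace ℝ (Fin (q + 1)) :=
  gradient (radialExt g) (x : EuclideanSpace ℝ (Fin (q + 1)))

/-- The `(q+1) × (q+1)` Hessian matrix, at a point of the sphere, of the radial extension of `g`. -/
def sphHessian {q : ℕ} (g : Sph q → ℝ) (x : Sph q) : Matrix (Fin (q + 1)) (Fin (q + 1)) ℝ :=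
  Matrix.of fun i j =>
    fderiv ℝ (fun y => fderiv ℝ (radialExt g) y (EuclideanSpace.single j 1))
      (x : EuclideanSpace ℝ (Fin (q + 1))) (EuclideanSpace.single i 1)

/-! ### Kernels and their constants -/

/-- The surface area `2 π^{(d+1)/2} / Γ((d+1)/2)` of the `d`-sphere in `ℝ^{d+1}`. -/
def sphereArea (d : ℕ) : ℝ :=
  2 * Real.pi ^ (((d : ℝ) + 1) / 2) / Real.Gamma (((d : ℝ) + 1) / 2)

/-- `λ_{h,q}(L) = ω_{q-1} ∫_0^{2 h⁻²} L(r) r^{q/2-1} (2 - r h²)^{q/2-1} dr` (for `q ≥ 1`). -/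
def lambdaH (q : ℕ) (h : ℝ) (L : ℝ → ℝ) : ℝ :=
  sphereArea (q - 1) *
    ∫ r in (0 : ℝ)..(2 / h ^ 2),
      L r * r ^ ((q : ℝ) / 2 - 1) * (2 - r * h ^ 2) ^ ((q : ℝ) / 2 - 1)

/-- `λ_q(L) = 2^{q/2-1} ω_{q-1} ∫_0^∞ L(r) r^{q/2-1} dr` (for `q ≥ 1`). -/
def lambdaLim (q : ℕ) (L : ℝ → ℝ) : ℝ :=
  (2 : ℝ) ^ ((q : ℝ) / 2 - 1) * sphereArea (q - 1) *
    ∫ r in Ioi (0 : ℝ), L r * r ^ ((q : ℝ) / 2 - 1)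

/-- `b_q(L) = ∫_0^∞ L(r) r^{q/2} dr / ∫_0^∞ L(r) r^{q/2-1} dr`. -/
def bConst (q : ℕ) (L : ℝ → ℝ) : ℝ :=
  (∫ r in Ioi (0 : ℝ), L r * r ^ ((q : ℝ) / 2)) /
    ∫ r in Ioi (0 : ℝ), L r * r ^ ((q : ℝ) / 2 - 1)

/-- The normalized kernel `L_h(x, y) = c_{h,q}(L) L((1 - xᵀy) / h²)`,
with `c_{h,q}(L)⁻¹ = λ_{h,q}(L) h^q`. -/
def kernelH {q : ℕ} (L : ℝ → ℝ) (h : ℝ) (x y : Sph q) : ℝ :=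
  (lambdaH q h L * h ^ q)⁻¹ *
    L ((1 - inner ℝ (x : EuclideanSpace ℝ (Fin (q + 1))) (y : EuclideanSpace ℝ (Fin (q + 1))))
      / h ^ 2)

/-- A directional kernel: a continuous function `L : [0,∞) → [0,∞)`, not identically zero, with
exponential decay (hence bounded). Only the values of `L` on `[0,∞)` matter. -/
structure IsDirectionalKernel (L : ℝ → ℝ) : Prop where
  continuousOn : ContinuousOn L (Ici 0)
  nonneg : ∀ r, 0 ≤ r → 0 ≤ L r
  nonzero : ∃ r, 0 ≤ r ∧ L r ≠ 0
  decay : ∃ M α : ℝ, 0 < M ∧ 0 < α ∧ ∀ r, 0 ≤ r → L r ≤ M * Real.exp (-α * r)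

/-! ### The projected local estimator -/

/-- `b x 0, …, b x (q-1)` complete `x` to an orthonormal basis of `ℝ^{q+1}`. -/
def IsTangentFrame {q : ℕ} (b : Sph q → Fin q → EuclideanSpace ℝ (Fin (q + 1))) : Prop :=
  ∀ x : Sph q, Orthonormal ℝ
    (Fin.cons (x : EuclideanSpace ℝ (Fin (q + 1))) (b x) :
      Fin (q + 1) → EuclideanSpace ℝ (Fin (q + 1)))

/-- The design matrix for `p = 0`: one column of ones. -/
def designZero (n : ℕ) : Matrix (Fin n) (Fin 1) ℝ :=
  Matrix.of fun _ _ => 1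

/-- The design matrix for `p = 1`: its `i`-th row is `(1, (X_i - x)ᵀ B_x)`. -/
def designOne {q n : ℕ} (b : Sph q → Fin q → EuclideanSpace ℝ (Fin (q + 1)))
    (x : Sph q) (xs : Fin n → Sph q) : Matrix (Fin n) (Fin (q + 1)) ℝ :=
  Matrix.of fun i => Fin.cons 1 fun j =>
    inner ℝ ((xs i : EuclideanSpace ℝ (Fin (q + 1))) - (x : EuclideanSpace ℝ (Fin (q + 1)))) (b x j)

/-- The first coefficient `e₁ᵀ (Dᵀ W D)⁻¹ Dᵀ W y` of the weighted least squares fit with design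
matrix `D`, weight matrix `W = diag w` and responses `y`. -/
def wlsIntercept {n d : ℕ} (D : Matrix (Fin n) (Fin (d + 1)) ℝ) (w y : Fin n → ℝ) : ℝ :=
  ((D.transpose * Matrix.diagonal w * D)⁻¹.mulVec
    ((D.transpose * Matrix.diagonal w).mulVec y)) 0

/-- The projected local estimator `m̂_{h,p}(x)`, `p = 0` (local constant) or `p = 1` (local linear),
computed from the sample `(xs i, ys i)`, `i < n`. -/
def projLocalEst {q n : ℕ} (L : ℝ → ℝ) (b : Sph q → Fin q → EuclideanSpace ℝ (Fin (q + 1)))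
    (h : ℝ) (p : Fin 2) (x : Sph q) (xs : Fin n → Sph q) (ys : Fin n → ℝ) : ℝ :=
  match p with
  | 0 => wlsIntercept (designZero n) (fun i => kernelH L h x (xs i)) ys
  | 1 => wlsIntercept (designOne b x xs) (fun i => kernelH L h x (xs i)) ys

/-- `B_p(x)`: `2 ∇f(x)ᵀ∇m(x) / f(x) + tr H_m(x)` for `p = 0`, and `tr H_m(x)` for `p = 1`. -/
def biasTerm {q : ℕ} (f m : Sph q → ℝ) (p : Fin 2) (x : Sph q) : ℝ :=
  match p with
  | 0 => 2 * inner ℝ (sphGrad f x) (sphGrad m x) / f x + (sphHessian m x).trace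
  | 1 => (sphHessian m x).trace

/-! ### The regression model -/

/-- `(X_i, Y_i)`, `i = 0, 1, …`, is an i.i.d. sample from the model `Y = m(X) + σ(X) ε`, where `X`
has density `f` with respect to the surface measure of the sphere, `E[ε | X] = 0`,
`E[ε² | X] = 1`, and `E[|ε|³ | X]`, `E[ε⁴ | X]` are bounded random variables. -/
structure IsRegressionSample {q : ℕ} {Ω : Type*} [MeasurableSpace Ω] (μ : Measure Ω)
    (f m σ : Sph q → ℝ) (X : ℕ → Ω → Sph q) (Y ε : ℕ → Ω → ℝ) : Prop where
  measurable_X : ∀ i, Measurable (X i)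
  measurable_Y : ∀ i, Measurable (Y i)
  measurable_ε : ∀ i, Measurable (ε i)
  measurable_σ : Measurable σ
  indep : iIndepFun (fun i ω => (X i ω, Y i ω)) μ
  identDistrib : ∀ i, IdentDistrib (fun ω => (X i ω, Y i ω)) (fun ω => (X 0 ω, Y 0 ω)) μ μ
  density : μ.map (X 0) =
    (volume : Measure (EuclideanSpace ℝ (Fin (q + 1)))).toSphere.withDensity
      fun x => ENNReal.ofReal (f x)
  model : ∀ i ω, Y i ω = m (X i ω) + σ (X i ω) * ε i ω
  memLp_ε : ∀ i, MemLp (ε i) 4 μ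
  mean_ε : ∀ i, μ[ε i | MeasurableSpace.comap (X i) inferInstance] =ᵐ[μ] fun _ => 0
  var_ε : ∀ i, μ[fun ω => ε i ω ^ 2 | MeasurableSpace.comap (X i) inferInstance] =ᵐ[μ] fun _ => 1
  third_ε : ∃ C : ℝ, ∀ i, ∀ᵐ ω ∂μ,
    (μ[fun ω' => |ε i ω'| ^ 3 | MeasurableSpace.comap (X i) inferInstance]) ω ≤ C
  fourth_ε : ∃ C : ℝ, ∀ i, ∀ᵐ ω ∂μ,
    (μ[fun ω' => ε i ω' ^ 4 | MeasurableSpace.comap (X i) inferInstance]) ω ≤ C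

/-! ### Conditional mean, conditional variance, stochastic orders -/

/-- `E[Z | V]`, as the mean of the regular conditional distribution of `Z` given `V`. If `Z` is
integrable, this is almost surely the usual conditional expectation; it is also meaningful when `Z`
has a finite mean conditionally on `V` but not unconditionally. -/
def condMean {Ω β : Type*} [MeasurableSpace Ω] [MeasurableSpace β] (μ : Measure Ω)
    [IsFiniteMeasure μ] (Z : Ω → ℝ) (V : Ω → β) (ω : Ω) : ℝ :=
  ∫ z, z ∂(condDistrib Z V μ (V ω))

/-- `Var[Z | V]`, as the variance of the regular conditional distribution of `Z` given `V`. -/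
def condVariance {Ω β : Type*} [MeasurableSpace Ω] [MeasurableSpace β] (μ : Measure Ω)
    [IsFiniteMeasure μ] (Z : Ω → ℝ) (V : Ω → β) (ω : Ω) : ℝ :=
  variance (fun z : ℝ => z) (condDistrib Z V μ (V ω))

/-- `R_n(x) = o_P(r_n)` uniformly in `x`: `sup_x P(|R_n(x)| > δ r_n) → 0` for every `δ > 0`. -/
def UnifLittleOP {Ω S : Type*} [MeasurableSpace Ω] (μ : Measure Ω)
    (R : ℕ → S → Ω → ℝ) (r : ℕ → ℝ) : Prop :=
  ∀ δ : ℝ, 0 < δ → Tendsto (fun n => ⨆ x : S, μ {ω | δ * r n < |R n x ω|}) atTop (𝓝 0)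

/-- `R_n(x) = O_P(r_n)` uniformly in `x`: for every `δ > 0` there is `C` with
`sup_x P(|R_n(x)| > C r_n) ≤ δ` for all large `n`. -/
def UnifBigOP {Ω S : Type*} [MeasurableSpace Ω] (μ : Measure Ω)
    (R : ℕ → S → Ω → ℝ) (r : ℕ → ℝ) : Prop :=
  ∀ δ : ℝ, 0 < δ → ∃ C : ℝ, ∀ᶠ n in atTop,
    ⨆ x : S, μ {ω | C * r n < |R n x ω|} ≤ ENNReal.ofReal δ

end ProjLocal

end

open ProjLocal

/-! The weights of least squares depend on the design only, so both estimators have the form `∑ W_j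
Y_j`. Given the design the noise is centred with identity covariance; hence the conditional mean is
`∑ W_j m(X_j)` and the conditional variance is `∑ W_j² σ²(X_j)`
(`IsRegressionSample.ae_condMean_condVariance`). Everything then reduces to kernel averages `(n
h^q)⁻¹ ∑ L((1 - xᵀX_j)/h²) φ(X_j)`.

In the gnomonic chart `u ↦ (x + Bu)/‖x + Bu‖` with `u = h v`, the kernel tends to `L(‖v‖²/2)` and
the rescaled surface measure to Lebesgue measure on `ℝ^q`. If `φ` read in this chart tends to `Φ`,
the mean of the average tends to `f(x) ∫ L(‖v‖²/2) Φ(v) dv` (`LocalLimit.tendsto_integral`), and its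
variance is of order `(n h^q)⁻¹`, so a weak law holds (`Localized.tendsto_kernelAvg`). The limiting
kernel is rotation invariant: Gram matrices become diagonal, second moments become multiples of the
identity, and this is where `λ_q(L)`, `b_q(L)` and the traces come from.

For the bias, `m(y) - m(x)` is split into a linear part and a remainder. Radial extensions have no
derivative along `x`, so only tangential derivatives matter. The remainder is of order `h²` and
yields `b_q(L)/q · tr H_m` for both estimators. For `p = 1` the normal equations annihilate the
linear part exactly. For `p = 0` it survives: it is odd in the chart, so its mean only sees the
variation of `f` and yields the term with `∇fᵀ∇m` (`Localized.tendsto_kernelMean_linearPart`), while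
its fluctuation `linearNoise` is `O_P(h/√(n h^q))` by Chebyshev.

Uniformity in `x` is convergence along `atTop ×ˢ ⊤` on pairs `(n, x)`. By compactness of the space
of orthonormal frames it suffices to treat filters along which `x` and its frame converge
(`mem_of_forall_mem_inf_comap`); this is the setting `Localized`. Convergence in probability is
itself written as convergence along a filter, `probFilter`, so that limits can be added, multiplied
and inverted freely. -/

noncomputable section

namespace ProjLocal

/-! ### Convergence in probability as convergence along a filter -/

/-- The filter of the sets of pairs `(i, ω)` whose `i`-th section has probability tending to one
along `l`. Convergence along this filter to a constant is convergence in probability. -/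
def probFilter {ι Ω : Type*} [MeasurableSpace Ω] (μ : Measure Ω) (l : Filter ι) :
    Filter (ι × Ω) where
  sets := {S | Tendsto (fun i => μ {ω | (i, ω) ∉ S}) l (𝓝 0)}
  univ_sets := by simpa using tendsto_const_nhds
  sets_of_superset := by
    intro S T hS hST
    refine tendsto_of_tendsto_of_tendsto_of_le_of_le tendsto_const_nhds hS (fun _ => zero_le)
      fun i => measure_mono fun ω hω h => hω (hST h)
  inter_sets := by
    intro S T hS hT
    have hS' : Tendsto (fun i => μ {ω | (i, ω) ∉ S}) l (𝓝 0) := hS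
    have := hS'.add hT
    rw [add_zero] at this
    refine tendsto_of_tendsto_of_tendsto_of_le_of_le tendsto_const_nhds this (fun _ => zero_le)
      fun i => (measure_mono fun ω hω => ?_).trans (measure_union_le _ _)
    simp only [mem_inter_iff, not_and_or, mem_ofPred_eq] at hω
    exact hω

section probFilter

variable {ι Ω : Type*} [MeasurableSpace Ω] {μ : Measure Ω} {l : Filter ι}

theorem mem_probFilter {S : Set (ι × Ω)} :
    S ∈ probFilter μ l ↔ Tendsto (fun i => μ {ω | (i, ω) ∉ S}) l (𝓝 0) := Iff.rfl

theorem eventually_probFilter {P : ι → Ω → Prop} :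
    (∀ᶠ z in probFilter μ l, P z.1 z.2) ↔ Tendsto (fun i => μ {ω | ¬ P i ω}) l (𝓝 0) := Iff.rfl

theorem tendsto_fst_probFilter : Tendsto Prod.fst (probFilter μ l) l := by
  intro S hS
  rw [mem_map, mem_probFilter]
  refine tendsto_const_nhds.congr' ?_
  filter_upwards [hS] with i hi
  simp [hi]

theorem eventually_probFilter_of_ae {P : ι → Ω → Prop} (h : ∀ i, ∀ᵐ ω ∂μ, P i ω) :
    ∀ᶠ z in probFilter μ l, P z.1 z.2 := by
  rw [eventually_probFilter]
  refine tendsto_const_nhds.congr fun i => ?_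
  exact (ae_iff.1 (h i)).symm

/-- Convergence in probability from convergence of the means and vanishing variances. -/
theorem tendsto_probFilter_of_variance [IsProbabilityMeasure μ] {A : ι → Ω → ℝ} {a : ℝ}
    (hA : ∀ᶠ i in l, MemLp (A i) 2 μ) (hmean : Tendsto (fun i => ∫ ω, A i ω ∂μ) l (𝓝 a))
    (hvar : Tendsto (fun i => variance (A i) μ) l (𝓝 0)) :
    Tendsto (fun z : ι × Ω => A z.1 z.2) (probFilter μ l) (𝓝 a) := by
  have h1 : Tendsto (fun z : ι × Ω => A z.1 z.2 - ∫ ω, A z.1 ω ∂μ) (probFilter μ l) (𝓝 0) := by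
    rw [Metric.tendsto_nhds]
    intro δ hδ
    rw [eventually_probFilter (P := fun i ω => dist (A i ω - ∫ ω, A i ω ∂μ) 0 < δ)]
    have h2 : Tendsto (fun i => ENNReal.ofReal (variance (A i) μ / δ ^ 2)) l (𝓝 0) := by
      have := ENNReal.tendsto_ofReal (hvar.div_const (δ ^ 2))
      simpa using this
    refine tendsto_of_tendsto_of_tendsto_of_le_of_le' tendsto_const_nhds h2
      (Eventually.of_forall fun _ => zero_le) ?_
    filter_upwards [hA] with i hi
    refine le_trans (measure_mono fun ω hω => ?_) (meas_ge_le_variance_div_sq hi hδ)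
    simpa [Real.dist_eq] using hω
  have h3 := h1.add (hmean.comp (tendsto_fst_probFilter (μ := μ)))
  simpa using h3

end probFilter

/-! ### Localization of a filter in a compact space -/

/-- By compactness the image under `g` of an ultrafilter finer than `l` has a limit `p`, so that
ultrafilter is finer than the filter localized at `p`; and a set lies in `l` once it lies in all
ultrafilters finer than `l`. This reduces uniform statements to convergent base points. -/
theorem mem_of_forall_mem_inf_comap {ι K : Type*} [TopologicalSpace K] [CompactSpace K]
    {l : Filter ι} (g : ι → K) {S : Set ι} (h : ∀ p, S ∈ l ⊓ comap g (𝓝 p)) : S ∈ l := by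
  rw [mem_iff_ultrafilter]
  intro U hU
  obtain ⟨p, -, hp⟩ := isCompact_univ.ultrafilter_le_nhds (U.map g) (by simp)
  exact (le_inf hU (map_le_iff_le_comap.1 hp)) (h p)

theorem tendsto_of_forall_tendsto_inf_comap {ι K Z : Type*} [TopologicalSpace K] [CompactSpace K]
    {l : Filter ι} {l' : Filter Z} (g : ι → K) {G : ι → Z}
    (h : ∀ p, Tendsto G (l ⊓ comap g (𝓝 p)) l') : Tendsto G l l' :=
  fun _ hS => mem_of_forall_mem_inf_comap g fun p => h p hS

/-- The only member of the filter `⊤` is the whole space, so a bound that holds eventually along `l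
×ˢ ⊤` holds for all `x` at once. -/
theorem tendsto_iSup_of_tendsto_prod_top {α S : Type*} {l : Filter α} {G : α → S → ENNReal}
    (h : Tendsto (fun i : α × S => G i.1 i.2) (l ×ˢ ⊤) (𝓝 0)) :
    Tendsto (fun a => ⨆ x, G a x) l (𝓝 0) := by
  rw [ENNReal.tendsto_nhds_zero] at h ⊢
  intro e he
  have := h e he
  rw [eventually_prod_iff] at this
  obtain ⟨pa, hpa, pb, hpb, hab⟩ := this
  rw [eventually_top] at hpb
  filter_upwards [hpa] with a ha
  exact iSup_le fun x => hab ha (hpb x)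

/-! ### Orthonormal frames and the gnomonic chart of the sphere -/

/-- The ambient space `ℝ^{q+1}`. -/
abbrev Amb (q : ℕ) : Type := EuclideanSpace ℝ (Fin (q + 1))

/-- The model `ℝ^q` of the tangent spaces. -/
abbrev Tan (q : ℕ) : Type := EuclideanSpace ℝ (Fin q)

/-- The linear map `u ↦ ∑ j, u j • β j`. -/
def frameMap {q : ℕ} (β : Fin q → Amb q) : Tan q →L[ℝ] Amb q :=
  ∑ j, (EuclideanSpace.proj j : Tan q →L[ℝ] ℝ).smulRight (β j)

theorem frameMap_apply {q : ℕ} (β : Fin q → Amb q) (u : Tan q) :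
    frameMap β u = ∑ j, u j • β j := by
  simp [frameMap]

/-- `β` completes the unit vector `x` to an orthonormal basis. -/
abbrev IsFrameAt {q : ℕ} (x : Sph q) (β : Fin q → Amb q) : Prop :=
  Orthonormal ℝ (Fin.cons (x : Amb q) β : Fin (q + 1) → Amb q)

/-- The orthonormal basis `(x, β)`. -/
def IsFrameAt.basis {q : ℕ} {x : Sph q} {β : Fin q → Amb q} (h : IsFrameAt x β) :
    OrthonormalBasis (Fin (q + 1)) ℝ (Amb q) :=
  (basisOfOrthonormalOfCardEqFinrank h (by simp)).toOrthonormalBasis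
    (by rw [coe_basisOfOrthonormalOfCardEqFinrank]; exact h)

theorem IsFrameAt.coe_basis {q : ℕ} {x : Sph q} {β : Fin q → Amb q} (h : IsFrameAt x β) :
    ⇑h.basis = (Fin.cons (x : Amb q) β : Fin (q + 1) → Amb q) := by
  simp [IsFrameAt.basis]

section Frame

variable {q : ℕ} {x : Sph q} {β : Fin q → Amb q}

theorem norm_coe_sph (x : Sph q) : ‖(x : Amb q)‖ = 1 := by
  simp

theorem IsFrameAt.inner_base (h : IsFrameAt x β) (j : Fin q) : inner ℝ (x : Amb q) (β j) = 0 := by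
  have := h.2 (i := 0) (j := j.succ) (Fin.succ_ne_zero j).symm
  simpa using this

theorem IsFrameAt.inner_frame (h : IsFrameAt x β) (i j : Fin q) :
    inner ℝ (β i) (β j) = if i = j then 1 else 0 := by
  have := orthonormal_iff_ite.1 h i.succ j.succ
  simpa using this

theorem IsFrameAt.inner_frameMap (h : IsFrameAt x β) (u : Tan q) :
    inner ℝ (x : Amb q) (frameMap β u) = 0 := by
  simp [frameMap_apply, inner_sum, inner_smul_right, h.inner_base]

theorem IsFrameAt.inner_frameMap_frame (h : IsFrameAt x β) (u : Tan q) (j : Fin q) :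
    inner ℝ (frameMap β u) (β j) = u j := by
  simp [frameMap_apply, sum_inner, inner_smul_left, h.inner_frame]

theorem IsFrameAt.norm_frameMap (h : IsFrameAt x β) (u : Tan q) : ‖frameMap β u‖ = ‖u‖ := by
  rw [← sq_eq_sq₀ (norm_nonneg _) (norm_nonneg _), ← real_inner_self_eq_norm_sq,
    EuclideanSpace.real_norm_sq_eq]
  conv_lhs => rw [frameMap_apply β u, inner_sum]
  refine Finset.sum_congr rfl fun j _ => ?_
  rw [inner_smul_right, ← frameMap_apply, h.inner_frameMap_frame, sq]

theorem IsFrameAt.norm_add_sq (h : IsFrameAt x β) (u : Tan q) :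
    ‖(x : Amb q) + frameMap β u‖ ^ 2 = 1 + ‖u‖ ^ 2 := by
  rw [norm_add_sq_real, h.inner_frameMap, norm_coe_sph, h.norm_frameMap]; ring

theorem IsFrameAt.norm_add (h : IsFrameAt x β) (u : Tan q) :
    ‖(x : Amb q) + frameMap β u‖ = √(1 + ‖u‖ ^ 2) := by
  rw [← h.norm_add_sq, Real.sqrt_sq (norm_nonneg _)]

theorem IsFrameAt.add_ne_zero (h : IsFrameAt x β) (u : Tan q) :
    (x : Amb q) + frameMap β u ≠ 0 := by
  intro h0
  have := h.norm_add_sq u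
  rw [h0] at this
  simp at this
  nlinarith [sq_nonneg ‖u‖]

/-- The radial projection of `z` to the sphere (and `x` if `z = 0`). -/
def toSph (x : Sph q) (z : Amb q) : Sph q :=
  open Classical in
  if hz : z ≠ 0 then ⟨‖z‖⁻¹ • z, by simp [norm_smul, norm_ne_zero_iff.mpr hz]⟩ else x

theorem coe_toSph (x : Sph q) {z : Amb q} (hz : z ≠ 0) : (toSph x z : Amb q) = ‖z‖⁻¹ • z := by
  simp [toSph, hz]

theorem radialExt_eq (g : Sph q → ℝ) (x : Sph q) {z : Amb q} (hz : z ≠ 0) :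
    radialExt g z = g (toSph x z) := by
  simp [radialExt, toSph, hz]

theorem toSph_coe (x y : Sph q) : toSph x (y : Amb q) = y := by
  have hy : (y : Amb q) ≠ 0 := by
    intro h0
    have := norm_coe_sph y
    simp [h0] at this
  ext1
  rw [coe_toSph x hy, norm_coe_sph]; simp

theorem toSph_smul (x : Sph q) {c : ℝ} (hc : 0 < c) (z : Amb q) : toSph x (c • z) = toSph x z := by
  by_cases hz : z = 0
  · simp [hz]
  · ext1
    rw [coe_toSph x (smul_ne_zero hc.ne' hz), coe_toSph x hz, norm_smul, Real.norm_of_nonneg hc.le,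
      smul_smul]
    congr 1
    field_simp

/-- The gnomonic chart `u ↦ (x + B u) / ‖x + B u‖` of the open half-sphere around `x`. -/
def gnomonic (x : Sph q) (β : Fin q → Amb q) (u : Tan q) : Sph q :=
  toSph x ((x : Amb q) + frameMap β u)

theorem IsFrameAt.coe_gnomonic (h : IsFrameAt x β) (u : Tan q) :
    (gnomonic x β u : Amb q) = (√(1 + ‖u‖ ^ 2))⁻¹ • ((x : Amb q) + frameMap β u) := by
  rw [gnomonic, coe_toSph x (h.add_ne_zero u), h.norm_add]

theorem IsFrameAt.radialExt_add (h : IsFrameAt x β) (g : Sph q → ℝ) (u : Tan q) :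
    radialExt g ((x : Amb q) + frameMap β u) = g (gnomonic x β u) :=
  radialExt_eq g x (h.add_ne_zero u)

theorem sqrt_one_add_pos (u : Tan q) : 0 < √(1 + ‖u‖ ^ 2) := by positivity

theorem IsFrameAt.continuous_gnomonic (h : IsFrameAt x β) : Continuous (gnomonic x β) := by
  rw [Topology.IsInducing.subtypeVal.continuous_iff]
  have : (Subtype.val ∘ gnomonic x β : Tan q → Amb q) =
      fun u => (√(1 + ‖u‖ ^ 2))⁻¹ • ((x : Amb q) + frameMap β u) := funext h.coe_gnomonic
  rw [this]
  exact Continuous.smul (Continuous.inv₀ (by fun_prop) fun u => (sqrt_one_add_pos u).ne')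
    (by fun_prop)

theorem IsFrameAt.inner_gnomonic (h : IsFrameAt x β) (u : Tan q) :
    inner ℝ (x : Amb q) (gnomonic x β u : Amb q) = (√(1 + ‖u‖ ^ 2))⁻¹ := by
  rw [h.coe_gnomonic, inner_smul_right, inner_add_right, h.inner_frameMap,
    real_inner_self_eq_norm_sq, norm_coe_sph]
  simp

theorem IsFrameAt.gnomonic_inner_frame (h : IsFrameAt x β) (u : Tan q) (j : Fin q) :
    inner ℝ ((gnomonic x β u : Amb q) - x) (β j) = (√(1 + ‖u‖ ^ 2))⁻¹ * u j := by
  rw [h.coe_gnomonic, inner_sub_left, inner_smul_left, inner_add_left, h.inner_frameMap_frame,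
    h.inner_base]
  simp

/-- The coordinates `(t, w) ↦ t x + B w` of the ambient space preserve the volume. -/
theorem IsFrameAt.measurePreserving (h : IsFrameAt x β) :
    MeasurePreserving (fun z : ℝ × Tan q => z.1 • (x : Amb q) + frameMap β z.2) := by
  have h1 : MeasurePreserving (Prod.map id (WithLp.ofLp : Tan q → Fin q → ℝ))
      (volume : Measure (ℝ × Tan q)) (volume : Measure (ℝ × (Fin q → ℝ))) :=
    (MeasurePreserving.id volume).prod (PiLp.volume_preserving_ofLp (Fin q))
  have h2 := (volume_preserving_piFinSuccAbove (fun _ : Fin (q + 1) => ℝ) 0).symm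
  have h3 := PiLp.volume_preserving_toLp (Fin (q + 1))
  have h4 := h.basis.measurePreserving_repr_symm
  -- The map glues `t` to `w` as zeroth coordinate and applies the inverse coordinate isometry of
  -- the basis `(x, β)`; every factor preserves volume.
  have heq : (fun z : ℝ × Tan q => z.1 • (x : Amb q) + frameMap β z.2) =
      h.basis.repr.symm ∘ WithLp.toLp 2 ∘ (MeasurableEquiv.piFinSuccAbove (fun _ => ℝ) 0).symm ∘
        Prod.map id WithLp.ofLp := by
    ext1 z
    rw [Function.comp_apply, ← OrthonormalBasis.sum_repr_symm, h.coe_basis, Fin.sum_univ_succ,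
      frameMap_apply]
    simp [MeasurableEquiv.piFinSuccAbove]
  rw [heq]
  exact h4.comp (h3.comp (h2.comp h1))

end Frame

/-! ### The surface measure in the gnomonic chart. -/

section

open scoped Pointwise

section Chart

variable {q : ℕ} {x : Sph q} {β : Fin q → Amb q}

theorem measurable_toSph (x : Sph q) : Measurable (toSph x) := by
  classical
  have h1 : Measurable fun z : Amb q => if z ≠ 0 then ‖z‖⁻¹ • z else (x : Amb q) :=
    Measurable.ite (measurableSet_singleton (0 : Amb q)).compl (by fun_prop) measurable_const
  have h2 : (Subtype.val ∘ toSph x : Amb q → Amb q) =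
      fun z => if z ≠ 0 then ‖z‖⁻¹ • z else (x : Amb q) := by
    ext1 z
    by_cases hz : z = 0
    · simp [toSph, hz]
    · simp [toSph, hz]
  exact (MeasurableEmbedding.subtype_coe Metric.isClosed_sphere.measurableSet).measurable_comp_iff.1
    (h2 ▸ h1)

theorem lintegral_Ioo_pow (n : ℕ) {a : ℝ} (ha : 0 ≤ a) :
    ∫⁻ t in Ioo 0 a, ENNReal.ofReal (t ^ n) = ENNReal.ofReal (a ^ (n + 1) / (n + 1)) := by
  rw [← ofReal_integral_eq_lintegral_ofReal]
  · rw [← integral_Ioc_eq_integral_Ioo, ← intervalIntegral.integral_of_le ha, integral_pow]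
    simp
  · exact ((continuous_pow n).integrableOn_Icc).mono_set Ioo_subset_Icc_self
  · filter_upwards [ae_restrict_mem measurableSet_Ioo] with t ht
    exact pow_nonneg ht.1.le _

/-- `toSphere` measures a set by the dimension times the volume of the unit cone over it. Here the
cone over a piece of the open half-sphere is described by conditions on `z` alone. -/
theorem Ioo_smul_eq (x : Sph q) (s : Set (Sph q)) :
    Ioo (0 : ℝ) 1 • (Subtype.val '' (s ∩ {y : Sph q | 0 < inner ℝ (x : Amb q) y})) =
      {z : Amb q | 0 < inner ℝ (x : Amb q) z ∧ ‖z‖ < 1 ∧ toSph x z ∈ s} := by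
  ext z
  simp only [Set.mem_smul, mem_image, mem_inter_iff]
  constructor
  · rintro ⟨r, hr, -, ⟨y, ⟨hys, hy⟩, rfl⟩, rfl⟩
    refine ⟨?_, ?_, ?_⟩
    · rw [inner_smul_right]
      exact mul_pos hr.1 hy
    · rw [norm_smul, norm_coe_sph, mul_one, Real.norm_of_nonneg hr.1.le]
      exact hr.2
    · rwa [toSph_smul x hr.1, toSph_coe]
  · rintro ⟨h1, h2, h3⟩
    have hz : z ≠ 0 := by
      rintro rfl
      simp at h1
    have hz' : 0 < ‖z‖ := norm_pos_iff.2 hz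
    refine ⟨‖z‖, ⟨hz', h2⟩, _, ⟨toSph x z, ⟨h3, ?_⟩, rfl⟩, ?_⟩
    · change 0 < inner ℝ (x : Amb q) _
      rw [coe_toSph x hz, inner_smul_right]
      positivity
    · rw [coe_toSph x hz, smul_smul, mul_inv_cancel₀ hz'.ne', one_smul]

/-- Write points of the half-space as `t (x + B u)` with `t > 0`. The slice of the cone at height
`t` is `t` times the set of admissible `u`, whence a factor `t ^ q`; integrating it over `0 < t < (1
+ ‖u‖²)^(-1/2)` gives `(1 + ‖u‖²)^(-(q+1)/2) / (q+1)`. The dimension `q + 1` in `toSphere` cancels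
the denominator. -/
theorem IsFrameAt.toSphere_inter (h : IsFrameAt x β) {s : Set (Sph q)} (hs : MeasurableSet s) :
    (volume : Measure (Amb q)).toSphere (s ∩ {y : Sph q | 0 < inner ℝ (x : Amb q) y}) =
      ∫⁻ u in gnomonic x β ⁻¹' s, ENNReal.ofReal ((√(1 + ‖u‖ ^ 2) ^ (q + 1))⁻¹) := by
  have hH : MeasurableSet {y : Sph q | 0 < inner ℝ (x : Amb q) (y : Amb q)} :=
    measurableSet_lt measurable_const (by fun_prop)
  have hg : Measurable (gnomonic x β) := h.continuous_gnomonic.measurable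
  set A : Set (Amb q) := {z | 0 < inner ℝ (x : Amb q) z ∧ ‖z‖ < 1 ∧ toSph x z ∈ s} with hA
  have hAm : MeasurableSet A := by
    have h1 : MeasurableSet {z : Amb q | 0 < inner ℝ (x : Amb q) z} :=
      measurableSet_lt measurable_const (by fun_prop)
    have h2 : MeasurableSet {z : Amb q | ‖z‖ < 1} := measurableSet_lt (by fun_prop) measurable_const
    exact h1.inter (h2.inter (measurable_toSph x hs))
  set C : Set (ℝ × Tan q) := {z | z.1 * √(1 + ‖z.2‖ ^ 2) < 1 ∧ gnomonic x β z.2 ∈ s} with hC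
  have hCm : MeasurableSet C := by
    have h1 : MeasurableSet {z : ℝ × Tan q | z.1 * √(1 + ‖z.2‖ ^ 2) < 1} :=
      measurableSet_lt (by fun_prop) measurable_const
    exact h1.inter ((hg.comp measurable_snd) hs)
  have hpos : ∀ t : ℝ, 0 < t → ∀ w : Tan q,
      (t • (x : Amb q) + frameMap β w ∈ A ↔ (t, t⁻¹ • w) ∈ C) := by
    intro t ht w
    have hz : t • (x : Amb q) + frameMap β w = t • ((x : Amb q) + frameMap β (t⁻¹ • w)) := by
      rw [smul_add, map_smul, smul_smul, mul_inv_cancel₀ ht.ne', one_smul]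
    rw [hz]
    simp only [hA, hC, mem_ofPred_eq, inner_smul_right, inner_add_right, h.inner_frameMap,
      toSph_smul x ht, real_inner_self_eq_norm_sq, norm_coe_sph, norm_smul, h.norm_add,
      Real.norm_of_nonneg ht.le]
    simp [ht, gnomonic]
  have hneg : ∀ t : ℝ, ¬ 0 < t → ∀ w : Tan q, t • (x : Amb q) + frameMap β w ∉ A := by
    intro t ht w hw
    have := hw.1
    rw [inner_add_right, h.inner_frameMap, inner_smul_right, real_inner_self_eq_norm_sq,
      norm_coe_sph] at this
    simp at this
    exact ht this
  have hvol : volume A = ∫⁻ u in gnomonic x β ⁻¹' s,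
      ENNReal.ofReal ((√(1 + ‖u‖ ^ 2))⁻¹ ^ (q + 1) / (q + 1)) := by
    rw [← h.measurePreserving.measure_preimage hAm.nullMeasurableSet, Measure.volume_eq_prod,
      Measure.prod_apply (h.measurePreserving.measurable hAm)]
    have h1 : ∀ t : ℝ, (volume (Prod.mk t ⁻¹'
          ((fun z : ℝ × Tan q => z.1 • (x : Amb q) + frameMap β z.2) ⁻¹' A)) : ENNReal) =
        (Ioi (0 : ℝ)).indicator
          (fun t => ∫⁻ u : Tan q, ENNReal.ofReal (t ^ q) * C.indicator 1 (t, u)) t := by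
      intro t
      by_cases ht : 0 < t
      · rw [indicator_of_mem (mem_Ioi.2 ht), lintegral_const_mul _ (by
          exact (measurable_one.indicator hCm).comp measurable_prodMk_left)]
        have : Prod.mk t ⁻¹' ((fun z : ℝ × Tan q => z.1 • (x : Amb q) + frameMap β z.2) ⁻¹' A) =
            (fun w : Tan q => t⁻¹ • w) ⁻¹' (Prod.mk t ⁻¹' C) := by
          ext w
          exact hpos t ht w
        rw [this, Measure.addHaar_preimage_smul _ (inv_ne_zero ht.ne')]
        congr 1
        · simp [abs_of_pos ht]
        · rw [← lintegral_indicator_one (measurable_prodMk_left hCm)]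
          rfl
      · rw [indicator_of_notMem (by simpa using ht)]
        have : Prod.mk t ⁻¹' ((fun z : ℝ × Tan q => z.1 • (x : Amb q) + frameMap β z.2) ⁻¹' A) =
            ∅ := by
          ext w
          simpa using hneg t ht w
        rw [this, measure_empty]
    rw [lintegral_congr h1, lintegral_indicator measurableSet_Ioi, lintegral_lintegral_swap]
    · rw [← lintegral_indicator (hg hs)]
      refine lintegral_congr fun u => ?_
      by_cases hu : gnomonic x β u ∈ s
      · rw [indicator_of_mem (by exact hu), ← lintegral_Ioo_pow q (by positivity),
          ← lintegral_indicator measurableSet_Ioi, ← lintegral_indicator measurableSet_Ioo]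
        refine lintegral_congr fun t => ?_
        have : (t, u) ∈ C ↔ t < (√(1 + ‖u‖ ^ 2))⁻¹ := by
          rw [← one_div, lt_div_iff₀ (sqrt_one_add_pos u)]
          simp [hC, hu]
        by_cases ht : 0 < t
        · by_cases ht' : t < (√(1 + ‖u‖ ^ 2))⁻¹
          · simp [ht, ht', this]
          · simp [ht, ht', this]
        · simp [ht]
      · rw [indicator_of_notMem (by exact hu)]
        have : ∀ t : ℝ, (t, u) ∉ C := fun t ht => hu ht.2
        simp [this]
    · refine Measurable.aemeasurable ?_
      refine Measurable.mul (by fun_prop) ?_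
      exact measurable_one.indicator hCm
  rw [Measure.toSphere_apply' _ (hs.inter hH), Ioo_smul_eq, ← hA, hvol,
    ← lintegral_const_mul _ (by fun_prop)]
  refine lintegral_congr fun u => ?_
  rw [finrank_euclideanSpace_fin, ← ENNReal.ofReal_natCast, ← ENNReal.ofReal_mul (by positivity)]
  congr 1
  have := sqrt_one_add_pos u
  rw [inv_pow]
  push_cast
  field_simp

/-- The surface measure on the half-sphere around `x`, in the gnomonic chart. -/
theorem IsFrameAt.toSphere_restrict (h : IsFrameAt x β) :
    (volume : Measure (Amb q)).toSphere.restrict {y : Sph q | 0 < inner ℝ (x : Amb q) y} =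
      (volume.withDensity fun u : Tan q =>
        ENNReal.ofReal ((√(1 + ‖u‖ ^ 2) ^ (q + 1))⁻¹)).map (gnomonic x β) := by
  have hg : Measurable (gnomonic x β) := h.continuous_gnomonic.measurable
  ext s hs
  rw [Measure.restrict_apply hs, h.toSphere_inter hs, Measure.map_apply hg hs,
    withDensity_apply _ (hg hs)]

end Chart

end

/-! ### Asymptotics of kernel integrals on the sphere -/

/-- The unnormalized kernel `L ((1 - xᵀ y) / h²)`. -/
def rawKernel {q : ℕ} (L : ℝ → ℝ) (h : ℝ) (x y : Sph q) : ℝ :=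
  L ((1 - inner ℝ (x : Amb q) (y : Amb q)) / h ^ 2)

/-- The surface measure of the sphere. -/
abbrev surf (q : ℕ) : Measure (Sph q) := (volume : Measure (Amb q)).toSphere

/-- The functions `φ i` on the sphere, read in the gnomonic chart at `x i` rescaled by `h i`,
converge to `Φ` with polynomial growth, and they grow at most polynomially in `(h i)⁻¹`. -/
structure LocalLimit {q : ℕ} {ι : Type*} (l : Filter ι) (h : ι → ℝ) (x : ι → Sph q)
    (β : ι → Fin q → Amb q) (φ : ι → Sph q → ℝ) (Φ : Tan q → ℝ) : Prop where
  measurable : ∀ i, Measurable (φ i)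
  far : ∃ C : ℝ, ∃ k : ℕ, 0 ≤ C ∧ ∀ᶠ i in l, ∀ y, |φ i y| ≤ C * (h i)⁻¹ ^ k
  near : ∃ C : ℝ, ∃ k : ℕ, 0 ≤ C ∧ ∀ᶠ i in l, ∀ v : Tan q, ‖h i • v‖ ≤ 1 →
    |φ i (gnomonic (x i) (β i) (h i • v))| ≤ C * (1 + ‖v‖) ^ k
  tendsto : ∀ v, Tendsto (fun i => φ i (gnomonic (x i) (β i) (h i • v))) l (𝓝 (Φ v))

theorem LocalLimit.mul {q : ℕ} {ι : Type*} {l : Filter ι} {h : ι → ℝ} {x : ι → Sph q}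
    {β : ι → Fin q → Amb q} {φ ψ : ι → Sph q → ℝ} {Φ Ψ : Tan q → ℝ}
    (h1 : LocalLimit l h x β φ Φ) (h2 : LocalLimit l h x β ψ Ψ) :
    LocalLimit l h x β (fun i y => φ i y * ψ i y) (fun v => Φ v * Ψ v) where
  measurable i := (h1.measurable i).mul (h2.measurable i)
  far := by
    obtain ⟨C1, k1, hC1, H1⟩ := h1.far
    obtain ⟨C2, k2, hC2, H2⟩ := h2.far
    refine ⟨C1 * C2, k1 + k2, mul_nonneg hC1 hC2, ?_⟩
    filter_upwards [H1, H2] with i hi1 hi2 y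
    rw [abs_mul, pow_add, mul_mul_mul_comm]
    exact mul_le_mul (hi1 y) (hi2 y) (abs_nonneg _) ((abs_nonneg _).trans (hi1 y))
  near := by
    obtain ⟨C1, k1, hC1, H1⟩ := h1.near
    obtain ⟨C2, k2, hC2, H2⟩ := h2.near
    refine ⟨C1 * C2, k1 + k2, mul_nonneg hC1 hC2, ?_⟩
    filter_upwards [H1, H2] with i hi1 hi2 v hv
    rw [abs_mul, pow_add, mul_mul_mul_comm]
    exact mul_le_mul (hi1 v hv) (hi2 v hv) (abs_nonneg _) ((abs_nonneg _).trans (hi1 v hv))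
  tendsto v := (h1.tendsto v).mul (h2.tendsto v)

/-! ### Elementary properties of the kernel and exponential bounds. -/

section Kernel

variable {q : ℕ} {L : ℝ → ℝ}

theorem inner_sph_le_one (x y : Sph q) : inner ℝ (x : Amb q) (y : Amb q) ≤ 1 := by
  have := real_inner_le_norm (x : Amb q) (y : Amb q)
  rwa [norm_coe_sph, norm_coe_sph, mul_one] at this

theorem rawKernel_arg_nonneg (h : ℝ) (x y : Sph q) :
    0 ≤ (1 - inner ℝ (x : Amb q) (y : Amb q)) / h ^ 2 :=
  div_nonneg (sub_nonneg.2 (inner_sph_le_one x y)) (sq_nonneg _)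

theorem continuous_rawKernel (hL : IsDirectionalKernel L) (h : ℝ) (x : Sph q) :
    Continuous (rawKernel L h x) :=
  hL.continuousOn.comp_continuous (by fun_prop) fun y => rawKernel_arg_nonneg h x y

theorem rawKernel_nonneg (hL : IsDirectionalKernel L) (h : ℝ) (x y : Sph q) :
    0 ≤ rawKernel L h x y :=
  hL.nonneg _ (rawKernel_arg_nonneg h x y)

theorem IsDirectionalKernel.sq (hL : IsDirectionalKernel L) :
    IsDirectionalKernel fun r => L r ^ 2 where
  continuousOn := hL.continuousOn.pow 2
  nonneg r _ := sq_nonneg _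
  nonzero := by
    obtain ⟨r, hr, h⟩ := hL.nonzero
    exact ⟨r, hr, pow_ne_zero 2 h⟩
  decay := by
    obtain ⟨M, α, hM, hα, h⟩ := hL.decay
    refine ⟨M ^ 2, 2 * α, by positivity, by positivity, fun r hr => ?_⟩
    calc L r ^ 2 ≤ (M * Real.exp (-α * r)) ^ 2 := pow_le_pow_left₀ (hL.nonneg r hr) (h r hr) 2
      _ = M ^ 2 * Real.exp (-(2 * α) * r) := by
        rw [mul_pow, ← Real.exp_nat_mul]
        congr 2
        push_cast
        ring

/-- The comparison function is `(1 + ‖v‖)^(-(q+1))`, which is integrable on `ℝ^q`. It is reached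
through `(1 + ‖v‖)² ≤ 2 (1 + ‖v‖²)` and `s^n / n! ≤ exp s`, with `n` so large that `k + q + 1 ≤ 2
n`. -/
theorem integrable_one_add_norm_pow_mul_exp {a : ℝ} (ha : 0 < a) (k : ℕ) :
    Integrable fun v : Tan q => (1 + ‖v‖) ^ k * Real.exp (-a * ‖v‖ ^ 2) := by
  set n := k + q + 1 with hn
  set B : ℝ := Real.exp a * (n.factorial / (a / 2) ^ n) with hB
  have hint := (integrable_one_add_norm (E := Tan q) (μ := volume) (r := (q : ℝ) + 1)
    (by simp)).const_mul B
  refine hint.mono' (by fun_prop) (Eventually.of_forall fun v => ?_)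
  have ht : 1 ≤ 1 + ‖v‖ := by simp
  have ht0 : 0 < 1 + ‖v‖ := by linarith
  rw [Real.norm_of_nonneg (by positivity)]
  have h1 : Real.exp (-a * ‖v‖ ^ 2) ≤ Real.exp a * Real.exp (-(a / 2 * (1 + ‖v‖) ^ 2)) := by
    rw [← Real.exp_add, Real.exp_le_exp]
    nlinarith [mul_nonneg ha.le (sq_nonneg (1 - ‖v‖))]
  have h2 : Real.exp (-(a / 2 * (1 + ‖v‖) ^ 2)) ≤
      n.factorial / (a / 2) ^ n * ((1 + ‖v‖) ^ (2 * n))⁻¹ := by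
    have := Real.pow_div_factorial_le_exp (a / 2 * (1 + ‖v‖) ^ 2) (by positivity) n
    rw [Real.exp_neg]
    refine (inv_anti₀ (by positivity) this).trans (le_of_eq ?_)
    rw [mul_pow, ← pow_mul]
    field_simp
  have h3 : (1 + ‖v‖) ^ (-((q : ℝ) + 1)) = ((1 + ‖v‖) ^ (q + 1))⁻¹ := by
    rw [Real.rpow_neg ht0.le]
    congr 1
    exact_mod_cast Real.rpow_natCast (1 + ‖v‖) (q + 1)
  have h4 : (1 + ‖v‖) ^ k * ((1 + ‖v‖) ^ (2 * n))⁻¹ ≤ ((1 + ‖v‖) ^ (q + 1))⁻¹ := by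
    rw [← div_eq_mul_inv, div_le_iff₀ (by positivity), inv_mul_eq_div, le_div_iff₀ (by positivity),
      ← pow_add]
    exact pow_le_pow_right₀ ht (by omega)
  rw [h3]
  calc (1 + ‖v‖) ^ k * Real.exp (-a * ‖v‖ ^ 2)
      ≤ (1 + ‖v‖) ^ k * (Real.exp a *
        (n.factorial / (a / 2) ^ n * ((1 + ‖v‖) ^ (2 * n))⁻¹)) := by gcongr; exact h1.trans (by gcongr)
    _ = B * ((1 + ‖v‖) ^ k * ((1 + ‖v‖) ^ (2 * n))⁻¹) := by rw [hB]; ring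
    _ ≤ B * ((1 + ‖v‖) ^ (q + 1))⁻¹ := by gcongr

/-- This is why the `far` bound of `LocalLimit` may be any power of `h⁻¹`: away from `x` the kernel
is exponentially small in `h⁻²`. -/
theorem tendsto_inv_pow_mul_exp {ι : Type*} {l : Filter ι} {h : ι → ℝ} (h_pos : ∀ i, 0 < h i)
    (h_zero : Tendsto h l (𝓝 0)) {a : ℝ} (ha : 0 < a) (n : ℕ) :
    Tendsto (fun i => (h i)⁻¹ ^ n * Real.exp (-a / h i ^ 2)) l (𝓝 0) := by
  have h1 : Tendsto (fun i => (h i)⁻¹) l atTop :=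
    tendsto_inv_nhdsGT_zero.comp (tendsto_nhdsWithin_iff.2 ⟨h_zero, Eventually.of_forall h_pos⟩)
  have h2 : Tendsto (fun i => (h i)⁻¹ ^ 2) l atTop := (tendsto_pow_atTop two_ne_zero).comp h1
  refine ((tendsto_rpow_mul_exp_neg_mul_atTop_nhds_zero ((n : ℝ) / 2) a ha).comp h2).congr
    fun i => ?_
  have := inv_pos.2 (h_pos i)
  simp only [Function.comp_apply]
  congr 1
  · rw [← Real.rpow_natCast ((h i)⁻¹) 2, ← Real.rpow_mul this.le, ← Real.rpow_natCast]
    congr 1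
    push_cast
    ring
  · congr 1
    rw [inv_pow]
    ring

end Kernel

/-! ### Kernel integrals over the cap covered by the unit ball of the chart. -/

section Near

variable {q : ℕ} {x : Sph q} {β : Fin q → Amb q} {L : ℝ → ℝ}

/-- The spherical cap around `x` which is the image of the unit ball in the gnomonic chart. -/
def nearCap (x : Sph q) : Set (Sph q) :=
  {y | (√2)⁻¹ ≤ inner ℝ (x : Amb q) (y : Amb q)}

theorem measurableSet_nearCap (x : Sph q) : MeasurableSet (nearCap x) :=
  measurableSet_le measurable_const (by fun_prop)

theorem IsFrameAt.gnomonic_mem_nearCap (h : IsFrameAt x β) (u : Tan q) :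
    gnomonic x β u ∈ nearCap x ↔ ‖u‖ ≤ 1 := by
  change (√2)⁻¹ ≤ _ ↔ _
  rw [h.inner_gnomonic, inv_le_inv₀ (by positivity) (sqrt_one_add_pos u),
    Real.sqrt_le_sqrt_iff (by norm_num)]
  constructor
  · intro h1
    nlinarith [norm_nonneg u]
  · intro h1
    nlinarith [norm_nonneg u]

theorem IsFrameAt.setIntegral_nearCap (h : IsFrameAt x β) {G : Sph q → ℝ} (hG : Measurable G) :
    ∫ y in nearCap x, G y ∂surf q =
      ∫ u : Tan q, if ‖u‖ ≤ 1 then (√(1 + ‖u‖ ^ 2) ^ (q + 1))⁻¹ * G (gnomonic x β u) else 0 := by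
  have hg : Measurable (gnomonic x β) := h.continuous_gnomonic.measurable
  have hsub : nearCap x ⊆ {y : Sph q | 0 < inner ℝ (x : Amb q) (y : Amb q)} := fun y hy =>
    lt_of_lt_of_le (show (0 : ℝ) < (√2)⁻¹ by positivity) hy
  rw [← Measure.restrict_restrict_of_subset hsub, h.toSphere_restrict,
    ← integral_indicator (measurableSet_nearCap x),
    integral_map hg.aemeasurable
      (hG.indicator (measurableSet_nearCap x)).aestronglyMeasurable,
    integral_withDensity_eq_integral_toReal_smul (by fun_prop) (by simp)]
  refine integral_congr_ae (Eventually.of_forall fun u => ?_)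
  have h0 : 0 ≤ (√(1 + ‖u‖ ^ 2) ^ (q + 1))⁻¹ := by positivity
  by_cases hu : ‖u‖ ≤ 1
  · simp only [smul_eq_mul, ENNReal.toReal_ofReal h0, if_pos hu,
      indicator_of_mem ((h.gnomonic_mem_nearCap u).2 hu)]
  · simp only [smul_eq_mul, if_neg hu,
      indicator_of_notMem (fun hh => hu ((h.gnomonic_mem_nearCap u).1 hh)), mul_zero]

/-- With `s = √(1 + ‖h v‖²)` one has `1 - 1/s = (s² - 1)/(s (s + 1))` and `s² - 1 = h² ‖v‖²`. The
division by `h²` thus disappears, and both the limit `‖v‖²/2` and a lower bound for the argument of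
`L` can be read off. -/
theorem IsFrameAt.rawKernel_gnomonic (hf : IsFrameAt x β) {h : ℝ} (hh : 0 < h) (v : Tan q) :
    rawKernel L h x (gnomonic x β (h • v)) =
      L (‖v‖ ^ 2 / (√(1 + ‖h • v‖ ^ 2) * (√(1 + ‖h • v‖ ^ 2) + 1))) := by
  rw [rawKernel, hf.inner_gnomonic]
  congr 1
  have hs := sqrt_one_add_pos (h • v)
  have hs2 : √(1 + ‖h • v‖ ^ 2) ^ 2 = 1 + h ^ 2 * ‖v‖ ^ 2 := by
    rw [Real.sq_sqrt (by positivity), norm_smul, mul_pow, Real.norm_eq_abs, sq_abs]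
  generalize √(1 + ‖h • v‖ ^ 2) = s at *
  field_simp
  linear_combination hs2

theorem IsFrameAt.scaled_setIntegral_nearCap (hf : IsFrameAt x β) (hL : IsDirectionalKernel L)
    {h : ℝ} (hh : 0 < h) {φ : Sph q → ℝ} (hφ : Measurable φ) :
    (h ^ q)⁻¹ * ∫ y in nearCap x, rawKernel L h x y * φ y ∂surf q =
      ∫ v : Tan q, if ‖h • v‖ ≤ 1 then (√(1 + ‖h • v‖ ^ 2) ^ (q + 1))⁻¹ *
        (rawKernel L h x (gnomonic x β (h • v)) * φ (gnomonic x β (h • v))) else 0 := by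
  rw [hf.setIntegral_nearCap (G := fun y => rawKernel L h x y * φ y)
    ((continuous_rawKernel hL h x).measurable.mul hφ)]
  have := Measure.integral_comp_smul (volume : Measure (Tan q)) (fun u : Tan q =>
    if ‖u‖ ≤ 1 then (√(1 + ‖u‖ ^ 2) ^ (q + 1))⁻¹ *
      (rawKernel L h x (gnomonic x β u) * φ (gnomonic x β u)) else 0) h
  rw [this, finrank_euclideanSpace_fin, abs_of_pos (by positivity), smul_eq_mul]

end Near

/-! ### Limits of the rescaled kernel integrals. -/

section Asymptotics

variable {q : ℕ} {ι : Type*} {l : Filter ι} {h : ι → ℝ} {x : ι → Sph q}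
  {β : ι → Fin q → Amb q} {φ : ι → Sph q → ℝ} {Φ : Tan q → ℝ} {L : ℝ → ℝ}

theorem integrable_of_bound {φ : Sph q → ℝ} (hφ : Measurable φ) {C : ℝ} (hC : ∀ y, |φ y| ≤ C) :
    Integrable φ (surf q) :=
  Integrable.of_bound hφ.aestronglyMeasurable C (Eventually.of_forall hC)

theorem rawKernel_le {M α : ℝ} (hM : ∀ r, 0 ≤ r → L r ≤ M * Real.exp (-α * r))
    (h : ℝ) (x y : Sph q) : rawKernel L h x y ≤
      M * Real.exp (-α * ((1 - inner ℝ (x : Amb q) (y : Amb q)) / h ^ 2)) :=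
  hM _ (rawKernel_arg_nonneg h x y)

theorem eventually_integrable_rawKernel_mul (hL : IsDirectionalKernel L)
    (hm : ∀ i, Measurable (φ i))
    (hfar : ∃ C : ℝ, ∃ k : ℕ, 0 ≤ C ∧ ∀ᶠ i in l, ∀ y, |φ i y| ≤ C * (h i)⁻¹ ^ k) :
    ∀ᶠ i in l, Integrable (fun y => rawKernel L (h i) (x i) y * φ i y) (surf q) := by
  obtain ⟨C, k, -, hC⟩ := hfar
  filter_upwards [hC] with i hi
  refine (integrable_of_bound (hm i) hi).bdd_mul
    (c := sSup (range fun y => ‖rawKernel L (h i) (x i) y‖))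
    (continuous_rawKernel hL (h i) (x i)).aestronglyMeasurable (Eventually.of_forall fun y => ?_)
  exact le_csSup (isCompact_range (continuous_rawKernel hL (h i) (x i)).norm).bddAbove
    (mem_range_self y)

/-- Off the cap `1 - xᵀy > 1 - 1/√2`, so the kernel is at most `M exp(-α (1 - 1/√2)/h²)`, which
beats `h^(-q)` and the growth of `φ` together. -/
theorem tendsto_integral_compl_nearCap (hL : IsDirectionalKernel L) (h_pos : ∀ i, 0 < h i)
    (h_zero : Tendsto h l (𝓝 0))
    (hfar : ∃ C : ℝ, ∃ k : ℕ, 0 ≤ C ∧ ∀ᶠ i in l, ∀ y, |φ i y| ≤ C * (h i)⁻¹ ^ k) :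
    Tendsto (fun i => (h i ^ q)⁻¹ * ∫ y in (nearCap (x i))ᶜ,
      rawKernel L (h i) (x i) y * φ i y ∂surf q) l (𝓝 0) := by
  obtain ⟨C, k, hC0, hC⟩ := hfar
  obtain ⟨M, α, hM, hα, hLM⟩ := hL.decay
  have hd : 0 < 1 - (√2)⁻¹ := by
    rw [sub_pos]
    exact inv_lt_one_of_one_lt₀ (by rw [Real.lt_sqrt] <;> norm_num)
  have hlim := (tendsto_inv_pow_mul_exp h_pos h_zero (a := α * (1 - (√2)⁻¹)) (by positivity)
    (q + k)).const_mul (M * C * (surf q).real univ)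
  rw [mul_zero] at hlim
  refine squeeze_zero_norm' ?_ hlim
  filter_upwards [hC] with i hi
  have hh := h_pos i
  have hb : ‖∫ y in (nearCap (x i))ᶜ, rawKernel L (h i) (x i) y * φ i y ∂surf q‖ ≤
      M * Real.exp (-(α * (1 - (√2)⁻¹)) / h i ^ 2) * (C * (h i)⁻¹ ^ k) *
        (surf q).real (nearCap (x i))ᶜ := by
    refine norm_setIntegral_le_of_norm_le_const (measure_lt_top _ _) fun y hy => ?_
    have hy' : inner ℝ (x i : Amb q) (y : Amb q) < (√2)⁻¹ := not_le.1 hy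
    rw [norm_mul, Real.norm_of_nonneg (rawKernel_nonneg hL _ _ _)]
    refine mul_le_mul ((rawKernel_le hLM _ _ _).trans ?_) (hi y) (norm_nonneg _) (by positivity)
    gcongr
    rw [neg_mul, neg_div, mul_div_assoc]
    gcongr
  rw [norm_mul, Real.norm_of_nonneg (by positivity)]
  calc (h i ^ q)⁻¹ * ‖∫ y in (nearCap (x i))ᶜ, rawKernel L (h i) (x i) y * φ i y ∂surf q‖
      ≤ (h i ^ q)⁻¹ * (M * Real.exp (-(α * (1 - (√2)⁻¹)) / h i ^ 2) * (C * (h i)⁻¹ ^ k) *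
        (surf q).real univ) := by
        gcongr
        refine hb.trans ?_
        gcongr
        · exact measure_ne_top _ _
        · exact subset_univ _
    _ = _ := by rw [pow_add, inv_pow, inv_pow]; ring

/-- Dominated convergence in the rescaled chart, with a polynomial times a Gaussian as dominating
function. -/
theorem LocalLimit.tendsto_near [l.IsCountablyGenerated] (hL : IsDirectionalKernel L)
    (h_pos : ∀ i, 0 < h i) (h_zero : Tendsto h l (𝓝 0)) (hβ : ∀ i, IsFrameAt (x i) (β i))
    (hφ : LocalLimit l h x β φ Φ) :
    Tendsto (fun i => (h i ^ q)⁻¹ * ∫ y in nearCap (x i),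
      rawKernel L (h i) (x i) y * φ i y ∂surf q) l
      (𝓝 (∫ v : Tan q, L (‖v‖ ^ 2 / 2) * Φ v)) := by
  obtain ⟨C, k, hC0, hC⟩ := hφ.near
  obtain ⟨M, α, hM, hα, hLM⟩ := hL.decay
  simp_rw [fun i => (hβ i).scaled_setIntegral_nearCap hL (h_pos i) (hφ.measurable i)]
  have hsq : ∀ v : Tan q, Tendsto (fun i => √(1 + ‖h i • v‖ ^ 2)) l (𝓝 1) := by
    intro v
    have h1 : Tendsto (fun i => √(1 + ‖h i • v‖ ^ 2)) l (𝓝 (√(1 + ‖(0 : ℝ) • v‖ ^ 2))) :=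
      (((h_zero.smul_const v).norm.pow 2).const_add 1).sqrt
    simpa using h1
  refine tendsto_integral_filter_of_dominated_convergence
    (fun v => M * C * ((1 + ‖v‖) ^ k * Real.exp (-(α / 4) * ‖v‖ ^ 2))) ?_ ?_
    ((integrable_one_add_norm_pow_mul_exp (by positivity) k).const_mul _) ?_
  · refine Eventually.of_forall fun i => Measurable.aestronglyMeasurable ?_
    have hg : Measurable fun v : Tan q => gnomonic (x i) (β i) (h i • v) :=
      ((hβ i).continuous_gnomonic.comp (continuous_const_smul (h i))).measurable
    refine Measurable.ite (measurableSet_le (by fun_prop) measurable_const) ?_ measurable_const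
    exact Measurable.mul (by fun_prop)
      (((continuous_rawKernel hL (h i) (x i)).measurable.comp hg).mul ((hφ.measurable i).comp hg))
  · filter_upwards [hC] with i hi
    refine Eventually.of_forall fun v => ?_
    by_cases hv : ‖h i • v‖ ≤ 1
    · rw [if_pos hv, norm_mul, norm_mul, Real.norm_of_nonneg (rawKernel_nonneg hL _ _ _),
        Real.norm_of_nonneg (by positivity), (hβ i).rawKernel_gnomonic (h_pos i)]
      have hs0 := sqrt_one_add_pos (h i • v)
      have hs1 : 1 ≤ √(1 + ‖h i • v‖ ^ 2) := by
        rw [Real.one_le_sqrt]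
        nlinarith [sq_nonneg ‖h i • v‖]
      -- On the cap `s ≤ √2 ≤ 3/2`, hence `s (s + 1) ≤ 15/4 < 4`; this is the origin of the rate `α
      -- / 4` in the dominating function.
      have hs2 : √(1 + ‖h i • v‖ ^ 2) ≤ 3 / 2 := by
        rw [Real.sqrt_le_iff]
        constructor
        · norm_num
        · nlinarith [norm_nonneg (h i • v)]
      set s := √(1 + ‖h i • v‖ ^ 2)
      have hK : L (‖v‖ ^ 2 / (s * (s + 1))) ≤ M * Real.exp (-(α / 4) * ‖v‖ ^ 2) := by
        refine (hLM _ (by positivity)).trans ?_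
        have : ‖v‖ ^ 2 / 4 ≤ ‖v‖ ^ 2 / (s * (s + 1)) := by
          gcongr
          nlinarith
        refine mul_le_mul_of_nonneg_left (Real.exp_le_exp.2 ?_) hM.le
        have := mul_le_mul_of_nonneg_left this hα.le
        linarith
      calc (s ^ (q + 1))⁻¹ * (L (‖v‖ ^ 2 / (s * (s + 1))) *
            ‖φ i (gnomonic (x i) (β i) (h i • v))‖)
          ≤ 1 * (M * Real.exp (-(α / 4) * ‖v‖ ^ 2) * (C * (1 + ‖v‖) ^ k)) := by
            have h0 : 0 ≤ L (‖v‖ ^ 2 / (s * (s + 1))) := hL.nonneg _ (by positivity)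
            refine mul_le_mul ?_ ?_ (by positivity) zero_le_one
            · exact inv_le_one_of_one_le₀ (one_le_pow₀ hs1)
            · exact mul_le_mul hK (hi v hv) (norm_nonneg _) (by positivity)
        _ = _ := by ring
    · rw [if_neg hv, norm_zero]
      positivity
  · refine Eventually.of_forall fun v => ?_
    have hsmall : ∀ᶠ i in l, ‖h i • v‖ ≤ 1 := by
      have h1 : Tendsto (fun i => ‖h i • v‖) l (𝓝 ‖(0 : ℝ) • v‖) := (h_zero.smul_const v).norm
      rw [zero_smul, norm_zero] at h1
      exact h1.eventually_le_const zero_lt_one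
    have hJ : Tendsto (fun i => (√(1 + ‖h i • v‖ ^ 2) ^ (q + 1))⁻¹) l (𝓝 1) := by
      simpa using ((hsq v).pow (q + 1)).inv₀ (by simp)
    have hK : Tendsto (fun i => rawKernel L (h i) (x i) (gnomonic (x i) (β i) (h i • v))) l
        (𝓝 (L (‖v‖ ^ 2 / 2))) := by
      simp_rw [fun i => (hβ i).rawKernel_gnomonic (L := L) (h_pos i) v]
      refine (hL.continuousOn _ (by simp; positivity)).tendsto.comp (tendsto_nhdsWithin_iff.2
        ⟨?_, Eventually.of_forall fun i => ?_⟩)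
      · have := (tendsto_const_nhds (x := ‖v‖ ^ 2)).div ((hsq v).mul ((hsq v).add_const 1))
          (by norm_num)
        rw [one_mul, one_add_one_eq_two] at this
        exact this
      · exact mem_Ici.2 (by positivity)
    have := hJ.mul (hK.mul (hφ.tendsto v))
    rw [one_mul] at this
    refine this.congr' ?_
    filter_upwards [hsmall] with i hi
    rw [if_pos hi]

/-- The rescaled kernel integral of functions with a local limit `Φ` converges to
`∫ L (‖v‖² / 2) Φ v dv`. -/
theorem LocalLimit.tendsto_integral [l.IsCountablyGenerated] (hL : IsDirectionalKernel L)
    (h_pos : ∀ i, 0 < h i) (h_zero : Tendsto h l (𝓝 0)) (hβ : ∀ i, IsFrameAt (x i) (β i))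
    (hφ : LocalLimit l h x β φ Φ) :
    Tendsto (fun i => (h i ^ q)⁻¹ * ∫ y, rawKernel L (h i) (x i) y * φ i y ∂surf q) l
      (𝓝 (∫ v : Tan q, L (‖v‖ ^ 2 / 2) * Φ v)) := by
  have := (hφ.tendsto_near hL h_pos h_zero hβ).add
    (tendsto_integral_compl_nearCap (x := x) hL h_pos h_zero hφ.far)
  rw [add_zero] at this
  refine this.congr' ?_
  filter_upwards [eventually_integrable_rawKernel_mul hL hφ.measurable hφ.far] with i hi
  rw [← mul_add, integral_add_compl (measurableSet_nearCap (x i)) hi]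

/-- The kernel integral of a function which is odd in the gnomonic chart is negligible. -/
theorem tendsto_integral_of_odd (hL : IsDirectionalKernel L)
    (h_pos : ∀ i, 0 < h i) (h_zero : Tendsto h l (𝓝 0)) (hβ : ∀ i, IsFrameAt (x i) (β i))
    (hm : ∀ i, Measurable (φ i))
    (hfar : ∃ C : ℝ, ∃ k : ℕ, 0 ≤ C ∧ ∀ᶠ i in l, ∀ y, |φ i y| ≤ C * (h i)⁻¹ ^ k)
    (hodd : ∀ i u, φ i (gnomonic (x i) (β i) (-u)) = -φ i (gnomonic (x i) (β i) u)) :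
    Tendsto (fun i => (h i ^ q)⁻¹ * ∫ y, rawKernel L (h i) (x i) y * φ i y ∂surf q) l (𝓝 0) := by
  refine (tendsto_integral_compl_nearCap (x := x) hL h_pos h_zero hfar).congr' ?_
  filter_upwards [eventually_integrable_rawKernel_mul hL hm hfar] with i hi
  -- The cap contributes exactly zero: in the chart the kernel and the density depend on `‖v‖` only,
  -- so the integrand is odd. Only the exponentially small complement remains.
  rw [← integral_add_compl (measurableSet_nearCap (x i)) hi, mul_add,
    (hβ i).scaled_setIntegral_nearCap hL (h_pos i) (hm i), right_eq_add]
  set g : Tan q → ℝ := fun v => if ‖h i • v‖ ≤ 1 then (√(1 + ‖h i • v‖ ^ 2) ^ (q + 1))⁻¹ *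
    (rawKernel L (h i) (x i) (gnomonic (x i) (β i) (h i • v)) *
      φ i (gnomonic (x i) (β i) (h i • v))) else 0 with hg
  have h1 : ∀ v, g (-v) = -g v := by
    intro v
    simp only [hg, (hβ i).rawKernel_gnomonic (h_pos i), smul_neg, norm_neg, hodd]
    split_ifs
    · ring
    · simp
  have h2 := integral_neg_eq_self g volume
  simp_rw [h1, integral_neg] at h2
  linarith

end Asymptotics

/-! ### The constants of the kernel -/

section Constants

variable {q : ℕ} {L : ℝ → ℝ}

theorem continuous_kernel_norm (hL : IsDirectionalKernel L) :
    Continuous fun v : Tan q => L (‖v‖ ^ 2 / 2) :=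
  hL.continuousOn.comp_continuous (by fun_prop) fun v => mem_Ici.2 (by positivity)

/-- The point provided by `nonzero` may be `0`, where powers of `r` degenerate; continuity on `[0,
∞)` moves it to the right. -/
theorem exists_kernel_pos (hL : IsDirectionalKernel L) : ∃ r, 0 < r ∧ 0 < L r := by
  obtain ⟨r₁, hr₁, hLr₁⟩ := hL.nonzero
  have hpos : 0 < L r₁ := lt_of_le_of_ne (hL.nonneg r₁ hr₁) hLr₁.symm
  have h1 : ∀ᶠ r in 𝓝[>] r₁, 0 < L r :=
    ((hL.continuousOn r₁ hr₁).eventually_const_lt hpos).filter_mono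
      (nhdsWithin_mono _ fun r hr => hr₁.trans (le_of_lt hr))
  obtain ⟨r, hr, hr'⟩ := (h1.and self_mem_nhdsWithin).exists
  exact ⟨r, lt_of_le_of_lt hr₁ hr', hr⟩

theorem integrable_kernel_norm_mul (hL : IsDirectionalKernel L) {g : Tan q → ℝ}
    (hg : AEStronglyMeasurable g) {C : ℝ} {k : ℕ} (hC : ∀ v, |g v| ≤ C * (1 + ‖v‖) ^ k) :
    Integrable fun v : Tan q => L (‖v‖ ^ 2 / 2) * g v := by
  obtain ⟨M, α, hM, hα, hLM⟩ := hL.decay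
  refine ((integrable_one_add_norm_pow_mul_exp (q := q) (a := α / 2) (by positivity) k).const_mul
    (M * C)).mono' ((continuous_kernel_norm hL).aestronglyMeasurable.mul hg)
    (Eventually.of_forall fun v => ?_)
  have h0 : 0 ≤ ‖v‖ ^ 2 / 2 := by positivity
  rw [norm_mul, Real.norm_of_nonneg (hL.nonneg _ h0)]
  calc L (‖v‖ ^ 2 / 2) * ‖g v‖ ≤ M * Real.exp (-α * (‖v‖ ^ 2 / 2)) * (C * (1 + ‖v‖) ^ k) :=
        mul_le_mul (hLM _ h0) (hC v) (norm_nonneg _) (by positivity)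
    _ = _ := by
      rw [show -α * (‖v‖ ^ 2 / 2) = -(α / 2) * ‖v‖ ^ 2 by ring]
      ring

/-- The substitution `r = y² / 2`, done as `s = y²` followed by `s = 2 r`. -/
theorem integral_Ioi_kernel_sq (L : ℝ → ℝ) (a : ℝ) :
    ∫ y in Ioi (0 : ℝ), y ^ (2 * a + 1) * L (y ^ 2 / 2) =
      2 ^ a * ∫ r in Ioi (0 : ℝ), L r * r ^ a := by
  have h1 := integral_comp_rpow_Ioi (fun s => s ^ a * L (s / 2)) (p := 2) two_ne_zero
  have h2 := integral_comp_mul_left_Ioi (fun s => s ^ a * L (s / 2)) 0 (b := 2) two_pos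
  rw [mul_zero, ← h1, smul_eq_mul] at h2
  have h3 : ∫ y in Ioi (0 : ℝ), (|(2 : ℝ)| * y ^ ((2 : ℝ) - 1)) • ((y ^ (2 : ℝ)) ^ a *
      L (y ^ (2 : ℝ) / 2)) = 2 * ∫ y in Ioi (0 : ℝ), y ^ (2 * a + 1) * L (y ^ 2 / 2) := by
    rw [← integral_const_mul]
    refine setIntegral_congr_fun measurableSet_Ioi fun y hy => ?_
    have hy' : 0 < y := hy
    simp only [smul_eq_mul, abs_two]
    rw [← Real.rpow_mul hy'.le, Real.rpow_add hy', Real.rpow_two,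
      show (2 : ℝ) - 1 = 1 by norm_num]
    ring
  have h4 : ∫ r in Ioi (0 : ℝ), (2 * r) ^ a * L (2 * r / 2) =
      2 ^ a * ∫ r in Ioi (0 : ℝ), L r * r ^ a := by
    rw [← integral_const_mul]
    refine setIntegral_congr_fun measurableSet_Ioi fun y hy => ?_
    have hy' : 0 < y := hy
    rw [Real.mul_rpow zero_le_two hy'.le, mul_div_cancel_left₀ _ two_ne_zero]
    ring
  rw [h3, h4] at h2
  linarith

/-- Polar integration in `ℝ^q` produces `q` times the volume of the unit ball; `Γ(q/2 + 1) = (q/2)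
Γ(q/2)` turns this into `ω_{q-1}`. -/
theorem sphereArea_eq (hq : 1 ≤ q) :
    sphereArea (q - 1) = q * (volume : Measure (Tan q)).real (Metric.ball 0 1) := by
  have : Nonempty (Fin q) := ⟨⟨0, hq⟩⟩
  have hq' : (0 : ℝ) < q := by exact_mod_cast hq
  have hG : Real.Gamma ((q : ℝ) / 2 + 1) = q / 2 * Real.Gamma ((q : ℝ) / 2) :=
    Real.Gamma_add_one (by positivity)
  have hG0 : 0 < Real.Gamma ((q : ℝ) / 2) := Real.Gamma_pos_of_pos (by positivity)
  have hcast : ((q - 1 : ℕ) : ℝ) + 1 = q := by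
    rw [Nat.cast_sub hq]
    simp
  have hpi : √Real.pi ^ q = Real.pi ^ ((q : ℝ) / 2) := by
    rw [Real.sqrt_eq_rpow, ← Real.rpow_mul_natCast Real.pi_pos.le]
    congr 1
    ring
  rw [measureReal_def, EuclideanSpace.volume_ball, Fintype.card_fin, hG, hpi, sphereArea, hcast,
    ENNReal.ofReal_one, one_pow, one_mul, ENNReal.toReal_ofReal (by positivity)]
  field_simp

/-- Polar coordinates. The case `k = 0` is `λ_q(L)`, and `k = 1` contains the numerator of `b_q(L)`.
-/
theorem integral_norm_kernel (hq : 1 ≤ q) (L : ℝ → ℝ) (k : ℕ) :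
    ∫ v : Tan q, L (‖v‖ ^ 2 / 2) * ‖v‖ ^ (2 * k) =
      2 ^ ((q : ℝ) / 2 - 1 + k) * sphereArea (q - 1) *
        ∫ r in Ioi (0 : ℝ), L r * r ^ ((q : ℝ) / 2 - 1 + k) := by
  have : Nonempty (Fin q) := ⟨⟨0, hq⟩⟩
  rw [integral_fun_norm_addHaar volume (fun y => L (y ^ 2 / 2) * y ^ (2 * k)),
    finrank_euclideanSpace_fin, sphereArea_eq hq, nsmul_eq_mul, smul_eq_mul]
  have : ∫ y in Ioi (0 : ℝ), y ^ (q - 1) • (L (y ^ 2 / 2) * y ^ (2 * k)) =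
      ∫ y in Ioi (0 : ℝ), y ^ (2 * ((q : ℝ) / 2 - 1 + k) + 1) * L (y ^ 2 / 2) := by
    refine setIntegral_congr_fun measurableSet_Ioi fun y hy => ?_
    have hy' : 0 < y := hy
    have he : 2 * ((q : ℝ) / 2 - 1 + k) + 1 = ((q - 1 + 2 * k : ℕ) : ℝ) := by
      push_cast [Nat.cast_sub hq]
      ring
    simp only [smul_eq_mul]
    rw [he, Real.rpow_natCast, pow_add]
    ring
  rw [this, integral_Ioi_kernel_sq]
  ring

theorem integral_kernel_norm (hq : 1 ≤ q) (L : ℝ → ℝ) :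
    ∫ v : Tan q, L (‖v‖ ^ 2 / 2) = lambdaLim q L := by
  have := integral_norm_kernel hq L 0
  simpa [lambdaLim] using this

theorem lambdaLim_pos (hq : 1 ≤ q) (hL : IsDirectionalKernel L) : 0 < lambdaLim q L := by
  rw [← integral_kernel_norm hq]
  have hc := continuous_kernel_norm (q := q) hL
  have hint : Integrable fun v : Tan q => L (‖v‖ ^ 2 / 2) := by
    have := integrable_kernel_norm_mul (q := q) hL (g := fun _ => 1) (C := 1) (k := 0)
      aestronglyMeasurable_const (by simp)
    simpa using this
  rw [integral_pos_iff_support_of_nonneg (fun v => hL.nonneg _ (by positivity)) hint]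
  refine hc.isOpen_support.measure_pos _ ?_
  obtain ⟨r, hr, hLr⟩ := hL.nonzero
  refine ⟨EuclideanSpace.single ⟨0, hq⟩ (√(2 * r)), ?_⟩
  rw [Function.mem_support]
  convert hLr
  rw [PiLp.norm_single, Real.norm_of_nonneg (Real.sqrt_nonneg _),
    Real.sq_sqrt (by positivity)]
  ring

theorem integral_kernel_norm_sq (hq : 1 ≤ q) (hL : IsDirectionalKernel L) :
    ∫ v : Tan q, L (‖v‖ ^ 2 / 2) * ‖v‖ ^ 2 = 2 * bConst q L * lambdaLim q L := by
  have h1 := integral_norm_kernel hq L 1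
  have h2 := lambdaLim_pos hq hL
  rw [Nat.cast_one, sub_add_cancel, mul_one] at h1
  rw [h1, bConst, lambdaLim, Real.rpow_sub_one two_ne_zero]
  have h3 : ∫ r in Ioi (0 : ℝ), L r * r ^ ((q : ℝ) / 2 - 1) ≠ 0 := by
    intro h0
    rw [lambdaLim, h0, mul_zero] at h2
    exact lt_irrefl _ h2
  generalize ∫ r in Ioi (0 : ℝ), L r * r ^ ((q : ℝ) / 2 - 1) = I at h3
  field_simp

/-- The measure `L(‖v‖²/2) dv` is invariant under linear isometries. Swapping coordinates makes the
diagonal moments equal, so each is the `q`-th part of their sum; flipping the sign of one coordinate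
kills the others. -/
theorem integral_kernel_coord_mul (hL : IsDirectionalKernel L) (i j : Fin q) :
    ∫ v : Tan q, L (‖v‖ ^ 2 / 2) * (v i * v j) =
      if i = j then (∫ v : Tan q, L (‖v‖ ^ 2 / 2) * ‖v‖ ^ 2) / q else 0 := by
  have hcomp : ∀ (e : Tan q ≃ₗᵢ[ℝ] Tan q) (g : Tan q → ℝ),
      ∫ v : Tan q, L (‖v‖ ^ 2 / 2) * g (e v) = ∫ v : Tan q, L (‖v‖ ^ 2 / 2) * g v := by
    intro e g
    have := e.measurePreserving.integral_comp e.toHomeomorph.measurableEmbedding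
      (fun w => L (‖w‖ ^ 2 / 2) * g w)
    simpa using this
  have hint : ∀ i j : Fin q, Integrable fun v : Tan q => L (‖v‖ ^ 2 / 2) * (v i * v j) := by
    intro i j
    refine integrable_kernel_norm_mul hL (by fun_prop) (C := 1) (k := 2) fun v => ?_
    rw [abs_mul, one_mul, sq]
    have hv : ∀ i, |v i| ≤ 1 + ‖v‖ := fun i => (PiLp.norm_apply_le v i).trans (by simp)
    exact mul_le_mul (hv i) (hv j) (abs_nonneg _) (by positivity)
  split_ifs with hij
  · subst hij
    have hsw : ∀ k : Fin q, ∫ v : Tan q, L (‖v‖ ^ 2 / 2) * (v k * v k) =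
        ∫ v : Tan q, L (‖v‖ ^ 2 / 2) * (v i * v i) := by
      intro k
      rw [← hcomp (LinearIsometryEquiv.piLpCongrLeft 2 ℝ ℝ (Equiv.swap i k))
        (fun v => v i * v i)]
      simp
    have hsum : ∫ v : Tan q, L (‖v‖ ^ 2 / 2) * ‖v‖ ^ 2 =
        q * ∫ v : Tan q, L (‖v‖ ^ 2 / 2) * (v i * v i) := by
      have hpt : ∀ v : Tan q, L (‖v‖ ^ 2 / 2) * ‖v‖ ^ 2 =
          ∑ k, L (‖v‖ ^ 2 / 2) * (v k * v k) := by
        intro v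
        rw [← Finset.mul_sum]
        congr 1
        rw [EuclideanSpace.real_norm_sq_eq]
        exact Finset.sum_congr rfl fun k _ => sq _
      simp_rw [hpt]
      rw [integral_finsetSum _ fun k _ => hint k k, Finset.sum_congr rfl fun k _ => hsw k]
      simp
    have hq0 : (q : ℝ) ≠ 0 := by
      have := i.pos
      positivity
    rw [hsum, mul_div_cancel_left₀ _ hq0]
  · have h1 := hcomp (LinearIsometryEquiv.piLpCongrRight 2 fun k : Fin q =>
      if k = i then LinearIsometryEquiv.neg ℝ else LinearIsometryEquiv.refl ℝ ℝ)
      (fun v => v i * v j)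
    have hji : j ≠ i := fun h => hij h.symm
    simp only [LinearIsometryEquiv.piLpCongrRight_apply, if_true, if_neg hji,
      LinearIsometryEquiv.coe_neg, LinearIsometryEquiv.coe_refl, id, neg_mul, mul_neg,
      integral_neg] at h1
    linarith

/-- The second moments of the kernel: `∫ L (‖v‖² / 2) v_i v_j dv = δ_ij 2 b_q(L) λ_q(L) / q`. -/
theorem integral_kernel_bilin (hq : 1 ≤ q) (hL : IsDirectionalKernel L)
    (A : Fin q → Fin q → ℝ) :
    ∫ v : Tan q, L (‖v‖ ^ 2 / 2) * ∑ i, ∑ j, A i j * (v i * v j) =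
      2 * bConst q L * lambdaLim q L / q * ∑ i, A i i := by
  have hint : ∀ i j : Fin q, Integrable fun v : Tan q => L (‖v‖ ^ 2 / 2) * (A i j * (v i * v j)) := by
    intro i j
    refine integrable_kernel_norm_mul hL (by fun_prop) (C := |A i j|) (k := 2) fun v => ?_
    rw [abs_mul, abs_mul, sq]
    have hv : ∀ i, |v i| ≤ 1 + ‖v‖ := fun i => (PiLp.norm_apply_le v i).trans (by simp)
    gcongr
    · exact hv i
    · exact hv j
  simp_rw [Finset.mul_sum]
  rw [integral_finsetSum _ fun i _ => integrable_finsetSum _ fun j _ => hint i j]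
  simp_rw [fun i => integral_finsetSum (μ := (volume : Measure (Tan q))) Finset.univ
    fun j _ => hint i j, mul_left_comm _ (A _ _), integral_const_mul,
    integral_kernel_coord_mul hL, integral_kernel_norm_sq hq hL]
  simp [mul_comm]

/-- For negative `s` (which occurs when `q = 1`) both endpoints are singular; cutting at the
midpoint `1 / h²` leaves one integrable singularity on each piece. -/
theorem intervalIntegrable_rpow_mul_rpow {s h : ℝ} (hs : -1 < s) (hh : 0 < h) :
    IntervalIntegrable (fun r : ℝ => r ^ s * (2 - r * h ^ 2) ^ s) volume 0 (2 / h ^ 2) := by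
  have hh2 : 0 < h ^ 2 := by positivity
  refine IntervalIntegrable.trans (b := 1 / h ^ 2) ?_ ?_
  · refine (intervalIntegral.intervalIntegrable_rpow' hs).mul_continuousOn ?_
    refine ContinuousOn.rpow_const (by fun_prop) fun r hr => Or.inl ?_
    rw [uIcc_of_le (by positivity), mem_Icc, le_div_iff₀ hh2] at hr
    linarith [hr.2]
  · refine IntervalIntegrable.continuousOn_mul ?_ ?_
    · have h1 : IntervalIntegrable (fun r : ℝ => r ^ s) volume 1 0 :=
        intervalIntegral.intervalIntegrable_rpow' hs
      have h2 := (h1.comp_sub_left 2).comp_mul_left (c := h ^ 2)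
      convert h2 using 2
      · ring_nf
      · norm_num
      · norm_num
    · refine ContinuousOn.rpow_const (by fun_prop) fun r hr => Or.inl ?_
      rw [uIcc_of_le (by gcongr; norm_num), mem_Icc] at hr
      have : 0 < 1 / h ^ 2 := by positivity
      linarith [hr.1]

/-- The normalization of the kernel cancels in least squares, so only its not being zero matters. It
is positive once the range `(0, 2/h²)` contains a point where `L > 0`; for larger `h` it could
vanish. -/
theorem exists_lambdaH_pos (hL : IsDirectionalKernel L) (hq : 1 ≤ q) :
    ∃ η : ℝ, 0 < η ∧ ∀ h, 0 < h → h < η → 0 < lambdaH q h L := by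
  obtain ⟨M, α, hM, hα, hLM⟩ := hL.decay
  obtain ⟨r₀, hr₀, hLr₀⟩ := exists_kernel_pos hL
  refine ⟨√(1 / r₀), by positivity, fun h hh hη => ?_⟩
  have hh2 : 0 < h ^ 2 := by positivity
  have hrc : r₀ < 2 / h ^ 2 := by
    rw [Real.lt_sqrt hh.le, lt_div_iff₀ hr₀] at hη
    rw [lt_div_iff₀ hh2]
    linarith
  have hs : -1 < (q : ℝ) / 2 - 1 := by
    have : (0 : ℝ) < q := by exact_mod_cast hq
    linarith [half_pos this]
  have hint : IntegrableOn (fun r : ℝ => L r * r ^ ((q : ℝ) / 2 - 1) *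
      (2 - r * h ^ 2) ^ ((q : ℝ) / 2 - 1)) (Ioo 0 (2 / h ^ 2)) := by
    have h1 := ((intervalIntegrable_iff_integrableOn_Ioo_of_le (by positivity)).1
      (intervalIntegrable_rpow_mul_rpow hs hh))
    simp_rw [mul_assoc]
    refine h1.bdd_mul (c := M) ?_ ?_
    · exact (hL.continuousOn.mono fun r hr => le_of_lt hr.1).aestronglyMeasurable measurableSet_Ioo
    · filter_upwards [ae_restrict_mem measurableSet_Ioo] with r hr
      rw [Real.norm_of_nonneg (hL.nonneg r hr.1.le)]
      refine (hLM r hr.1.le).trans (mul_le_of_le_one_right hM.le ?_)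
      rw [Real.exp_le_one_iff]
      nlinarith [hr.1]
  have hfac : ∀ r ∈ Ioo 0 (2 / h ^ 2),
      0 < r ^ ((q : ℝ) / 2 - 1) * (2 - r * h ^ 2) ^ ((q : ℝ) / 2 - 1) := by
    intro r hr
    have := hr.2
    rw [lt_div_iff₀ hh2] at this
    exact mul_pos (Real.rpow_pos_of_pos hr.1 _) (Real.rpow_pos_of_pos (by linarith) _)
  have hA : 0 < sphereArea (q - 1) := by
    rw [sphereArea]
    have := Real.Gamma_pos_of_pos (s := (((q - 1 : ℕ) : ℝ) + 1) / 2) (by positivity)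
    have := Real.pi_pos
    positivity
  refine mul_pos hA ?_
  rw [intervalIntegral.integral_of_le (by positivity), integral_Ioc_eq_integral_Ioo,
    setIntegral_pos_iff_support_of_nonneg_ae _ hint]
  · have hopen : IsOpen (Ioo 0 (2 / h ^ 2) ∩ L ⁻¹' Ioi 0) :=
      (hL.continuousOn.mono fun r hr => le_of_lt hr.1).isOpen_inter_preimage isOpen_Ioo isOpen_Ioi
    refine (hopen.measure_pos volume ⟨r₀, ⟨hr₀, hrc⟩, hLr₀⟩).trans_le (measure_mono ?_)
    rintro r ⟨hr, hLr⟩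
    refine ⟨?_, hr⟩
    rw [Function.mem_support, mul_assoc]
    exact (mul_pos hLr (hfac r hr)).ne'
  · filter_upwards [ae_restrict_mem measurableSet_Ioo] with r hr
    rw [mul_assoc]
    exact mul_nonneg (hL.nonneg r hr.1.le) (hfac r hr).le

end Constants

/-! ### Calculus of radial extensions -/

/-- Second order Taylor expansion with Lagrange remainder along a segment. -/
theorem exists_taylor_two {E : Type*} [NormedAddCommGroup E] [NormedSpace ℝ E] {G : E → ℝ}
    {x w : E} (hG : ∀ t ∈ Icc (0 : ℝ) 1, ContDiffAt ℝ 2 G (x + t • w)) :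
    ∃ ξ ∈ Ioo (0 : ℝ) 1, G (x + w) = G x + fderiv ℝ G x w +
      1 / 2 * fderiv ℝ (fderiv ℝ G) (x + ξ • w) w w := by
  have hline : ∀ t : ℝ, HasDerivAt (fun t : ℝ => x + t • w) w t := fun t => by
    simpa using ((hasDerivAt_id t).smul_const w).const_add x
  have h1 : ∀ t ∈ Icc (0 : ℝ) 1, HasDerivAt (fun t : ℝ => G (x + t • w))
      (fderiv ℝ G (x + t • w) w) t := fun t ht =>
    ((hG t ht).differentiableAt (by norm_num)).hasFDerivAt.comp_hasDerivAt t (hline t)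
  have h2 : ∀ t ∈ Icc (0 : ℝ) 1, HasDerivAt (fun t : ℝ => fderiv ℝ G (x + t • w) w)
      (fderiv ℝ (fderiv ℝ G) (x + t • w) w w) t := fun t ht => by
    have hd : DifferentiableAt ℝ (fderiv ℝ G) (x + t • w) :=
      ((hG t ht).fderiv_right (m := 1) (by norm_num)).differentiableAt (by norm_num)
    have := hd.hasFDerivAt.comp_hasDerivAt t (hline t)
    simpa using this.clm_apply (hasDerivAt_const t w)
  -- `K` makes `G (x + t w) - G'(x) w t - K t²` take equal values at `t = 0` and `t = 1`. Its
  -- derivative vanishes at an interior `c` by Rolle and also at `0`, so Rolle on `[0, c]` gives a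
  -- point where the second derivative is `2 K`.
  set K := G (x + w) - G x - fderiv ℝ G x w with hK
  have e1 : ∀ t ∈ Icc (0 : ℝ) 1, HasDerivAt
      (fun t : ℝ => G (x + t • w) - fderiv ℝ G x w * t - K * t ^ 2)
      (fderiv ℝ G (x + t • w) w - fderiv ℝ G x w - K * (2 * t)) t := fun t ht => by
    have ha : HasDerivAt (fun t : ℝ => fderiv ℝ G x w * t) (fderiv ℝ G x w) t := by
      simpa using (hasDerivAt_id t).const_mul (fderiv ℝ G x w)
    have hb : HasDerivAt (fun t : ℝ => K * t ^ 2) (K * (2 * t)) t := by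
      simpa using ((hasDerivAt_id t).pow 2).const_mul K
    exact ((h1 t ht).sub ha).sub hb
  have e2 : ∀ t ∈ Icc (0 : ℝ) 1, HasDerivAt
      (fun t : ℝ => fderiv ℝ G (x + t • w) w - fderiv ℝ G x w - K * (2 * t))
      (fderiv ℝ (fderiv ℝ G) (x + t • w) w w - K * 2) t := fun t ht => by
    have hb : HasDerivAt (fun t : ℝ => K * (2 * t)) (K * 2) t := by
      simpa using ((hasDerivAt_id t).const_mul 2).const_mul K
    exact ((h2 t ht).sub_const (fderiv ℝ G x w)).sub hb
  obtain ⟨c, hc, hc0⟩ := exists_hasDerivAt_eq_zero zero_lt_one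
    (fun t ht => (e1 t ht).continuousAt.continuousWithinAt) (by simp [hK])
    (fun t ht => e1 t (Ioo_subset_Icc_self ht))
  obtain ⟨ξ, hξ, hξ0⟩ := exists_hasDerivAt_eq_zero hc.1
    (fun t ht => (e2 t ⟨ht.1, ht.2.trans hc.2.le⟩).continuousAt.continuousWithinAt)
    (by rw [hc0]; simp) (fun t ht => e2 t ⟨ht.1.le, (ht.2.trans hc.2).le⟩)
  refine ⟨ξ, ⟨hξ.1, hξ.2.trans hc.2⟩, ?_⟩
  linarith

section Radial

variable {q : ℕ} {g : Sph q → ℝ}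

theorem coe_sph_ne_zero (x : Sph q) : (x : Amb q) ≠ 0 := by
  intro h0
  have := norm_coe_sph x
  simp [h0] at this

theorem radialExt_coe (g : Sph q → ℝ) (x : Sph q) : radialExt g (x : Amb q) = g x := by
  rw [radialExt_eq g x (coe_sph_ne_zero x), toSph_coe]

theorem continuous_of_contDiffOn {n : ℕ∞} (hg : ContDiffOn ℝ n (radialExt g) {0}ᶜ) :
    Continuous g := by
  have := hg.continuousOn.comp_continuous (f := fun x : Sph q => (x : Amb q))
    continuous_subtype_val coe_sph_ne_zero
  exact this.congr fun x => radialExt_coe g x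

theorem contDiffAt_radialExt (hg : ContDiffOn ℝ 2 (radialExt g) {0}ᶜ) {z : Amb q} (hz : z ≠ 0) :
    ContDiffAt ℝ 2 (radialExt g) z :=
  hg.contDiffAt (isOpen_compl_singleton.mem_nhds hz)

theorem continuousAt_fderiv_radialExt (hg : ContDiffOn ℝ 2 (radialExt g) {0}ᶜ) {z : Amb q}
    (hz : z ≠ 0) : ContinuousAt (fderiv ℝ (radialExt g)) z :=
  ((contDiffAt_radialExt hg hz).fderiv_right (m := 1) (by norm_num)).continuousAt

theorem continuousAt_fderiv_fderiv_radialExt (hg : ContDiffOn ℝ 2 (radialExt g) {0}ᶜ) {z : Amb q}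
    (hz : z ≠ 0) : ContinuousAt (fderiv ℝ (fderiv ℝ (radialExt g))) z :=
  (((contDiffAt_radialExt hg hz).fderiv_right (m := 1) (by norm_num)).fderiv_right (m := 0)
    (by norm_num)).continuousAt

/-- The extension is constant along the ray `t ↦ t z`. Radial terms therefore drop out of all later
expansions. -/
theorem fderiv_radialExt_self (hg : ContDiffOn ℝ 2 (radialExt g) {0}ᶜ) {z : Amb q}
    (hz : z ≠ 0) : fderiv ℝ (radialExt g) z z = 0 := by
  have hd : HasFDerivAt (radialExt g) (fderiv ℝ (radialExt g) z) ((1 : ℝ) • z) := by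
    rw [one_smul]
    exact ((contDiffAt_radialExt hg hz).differentiableAt (by norm_num)).hasFDerivAt
  have hl : HasDerivAt (fun t : ℝ => t • z) z 1 := by
    simpa using (hasDerivAt_id (1 : ℝ)).smul_const z
  have h1 := hd.comp_hasDerivAt (1 : ℝ) hl
  have h2 : (radialExt g ∘ fun t : ℝ => t • z) =ᶠ[𝓝 1] fun _ => radialExt g z := by
    filter_upwards [lt_mem_nhds (zero_lt_one' ℝ)] with t ht
    obtain ⟨y⟩ : Nonempty (Sph q) := ⟨⟨‖z‖⁻¹ • z, by simp [norm_smul, norm_ne_zero_iff.mpr hz]⟩⟩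
    rw [Function.comp_apply, radialExt_eq g y (smul_ne_zero ht.ne' hz), radialExt_eq g y hz,
      toSph_smul y ht]
  exact h1.unique ((hasDerivAt_const (1 : ℝ) (radialExt g z)).congr_of_eventuallyEq h2)

/-- Differentiate the identity `DG(y) y = 0` at `z` in the direction `z`; the extra term `DG(z) z`
is zero again. -/
theorem fderiv_fderiv_radialExt_self (hg : ContDiffOn ℝ 2 (radialExt g) {0}ᶜ) {z : Amb q}
    (hz : z ≠ 0) : fderiv ℝ (fderiv ℝ (radialExt g)) z z z = 0 := by
  have hd : HasFDerivAt (fderiv ℝ (radialExt g)) (fderiv ℝ (fderiv ℝ (radialExt g)) z) z :=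
    (((contDiffAt_radialExt hg hz).fderiv_right (m := 1) (by norm_num)).differentiableAt
      (by norm_num)).hasFDerivAt
  have h1 := hd.clm_apply (hasFDerivAt_id z)
  have h2 : (fun y => fderiv ℝ (radialExt g) y (id y)) =ᶠ[𝓝 z] fun _ => 0 := by
    filter_upwards [isOpen_compl_singleton.mem_nhds hz] with y hy
    exact fderiv_radialExt_self hg hy
  have h3 := h1.unique ((hasFDerivAt_const (0 : ℝ) z).congr_of_eventuallyEq h2)
  have h4 := congrArg (fun A : Amb q →L[ℝ] ℝ => A z) h3
  simpa [fderiv_radialExt_self hg hz] using h4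

theorem sphHessian_apply (hg : ContDiffOn ℝ 2 (radialExt g) {0}ᶜ) (x : Sph q)
    (i j : Fin (q + 1)) : sphHessian g x i j =
      fderiv ℝ (fderiv ℝ (radialExt g)) (x : Amb q) (EuclideanSpace.single i 1)
        (EuclideanSpace.single j 1) := by
  have hd : DifferentiableAt ℝ (fderiv ℝ (radialExt g)) (x : Amb q) :=
    ((contDiffAt_radialExt hg (coe_sph_ne_zero x)).fderiv_right (m := 1)
      (by norm_num)).differentiableAt (by norm_num)
  have := (hd.hasFDerivAt.clm_apply (hasFDerivAt_const
    (EuclideanSpace.single j (1 : ℝ) : Amb q) (x : Amb q))).fderiv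
  rw [sphHessian, Matrix.of_apply, this]
  simp

/-- Basis independence of the trace: expand each `a i` in `b` and apply Parseval to `∑ i, ⟪b j, a i⟫
⟪b k, a i⟫`. -/
theorem sum_bilin_orthonormalBasis {E ι κ : Type*} [NormedAddCommGroup E] [InnerProductSpace ℝ E]
    [Fintype ι] [Fintype κ] [DecidableEq κ] (A : E →L[ℝ] E →L[ℝ] ℝ) (a : OrthonormalBasis ι ℝ E)
    (b : OrthonormalBasis κ ℝ E) : ∑ i, A (a i) (a i) = ∑ j, A (b j) (b j) := by
  have h1 : ∀ i, A (a i) (a i) = ∑ j, ∑ k, inner ℝ (b j) (a i) * inner ℝ (b k) (a i) *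
      A (b j) (b k) := by
    intro i
    conv_lhs => rw [← b.sum_repr' (a i)]
    simp only [map_sum, map_smul, _root_.sum_apply, _root_.smul_apply,
      smul_eq_mul, Finset.mul_sum]
    rw [Finset.sum_comm]
    exact Finset.sum_congr rfl fun j _ => Finset.sum_congr rfl fun k _ => by ring
  simp_rw [h1]
  rw [Finset.sum_comm]
  refine Finset.sum_congr rfl fun j _ => ?_
  rw [Finset.sum_comm]
  have h2 : ∀ k, ∑ i, inner ℝ (b j) (a i) * inner ℝ (b k) (a i) * A (b j) (b k) =
      (if j = k then 1 else 0) * A (b j) (b k) := by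
    intro k
    rw [← Finset.sum_mul, ← orthonormal_iff_ite.1 b.orthonormal j k,
      ← a.sum_inner_mul_inner (b j) (b k)]
    congr 1
    exact Finset.sum_congr rfl fun i _ => by rw [real_inner_comm (a i) (b k)]
  simp [h2]

/-- The trace is computed in the basis `(x, β)`, whose radial diagonal entry is zero, so the ambient
Hessian sees only tangential directions. -/
theorem trace_sphHessian (hg : ContDiffOn ℝ 2 (radialExt g) {0}ᶜ) {x : Sph q}
    {β : Fin q → Amb q} (h : IsFrameAt x β) : (sphHessian g x).trace =
      ∑ j, fderiv ℝ (fderiv ℝ (radialExt g)) (x : Amb q) (β j) (β j) := by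
  have h1 := sum_bilin_orthonormalBasis (fderiv ℝ (fderiv ℝ (radialExt g)) (x : Amb q))
    (EuclideanSpace.basisFun (Fin (q + 1)) ℝ) h.basis
  rw [Fin.sum_univ_succ (fun j => fderiv ℝ (fderiv ℝ (radialExt g)) (x : Amb q) (h.basis j)
    (h.basis j))] at h1
  simp only [h.coe_basis, Fin.cons_zero, Fin.cons_succ,
    fderiv_fderiv_radialExt_self hg (coe_sph_ne_zero x), zero_add] at h1
  rw [← h1, Matrix.trace]
  simp [sphHessian_apply hg]

theorem inner_sphGrad (g : Sph q → ℝ) (x : Sph q) (w : Amb q) :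
    inner ℝ (sphGrad g x) w = fderiv ℝ (radialExt g) (x : Amb q) w := by
  rw [sphGrad, gradient, InnerProductSpace.toDual_symm_apply]

theorem inner_sphGrad_sphGrad {f m : Sph q → ℝ} (hf : ContDiffOn ℝ 2 (radialExt f) {0}ᶜ)
    {x : Sph q} {β : Fin q → Amb q} (h : IsFrameAt x β) :
    inner ℝ (sphGrad f x) (sphGrad m x) =
      ∑ j, fderiv ℝ (radialExt f) (x : Amb q) (β j) * fderiv ℝ (radialExt m) (x : Amb q) (β j) := by
  rw [← h.basis.sum_inner_mul_inner, Fin.sum_univ_succ, h.coe_basis]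
  simp only [Fin.cons_zero, Fin.cons_succ, real_inner_comm (sphGrad m x), inner_sphGrad,
    fderiv_radialExt_self hf (coe_sph_ne_zero x), zero_mul, zero_add]

theorem exists_bound_fderiv (hg : ContDiffOn ℝ 2 (radialExt g) {0}ᶜ) :
    ∃ C : ℝ, 0 ≤ C ∧ ∀ x : Sph q, ‖fderiv ℝ (radialExt g) (x : Amb q)‖ ≤ C := by
  have hc : Continuous fun x : Sph q => ‖fderiv ℝ (radialExt g) (x : Amb q)‖ :=
    continuous_iff_continuousAt.2 fun x =>
      ((continuousAt_fderiv_radialExt hg (coe_sph_ne_zero x)).comp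
        continuous_subtype_val.continuousAt).norm
  obtain ⟨C, hC⟩ := (isCompact_range hc).bddAbove
  exact ⟨max C 0, le_max_right _ _, fun x => (hC (mem_range_self x)).trans (le_max_left _ _)⟩

/-- This shell contains every `x + B u` with `‖u‖ ≤ 1`, where the Taylor remainder is evaluated. -/
theorem exists_bound_fderiv_fderiv (hg : ContDiffOn ℝ 2 (radialExt g) {0}ᶜ) :
    ∃ C : ℝ, 0 ≤ C ∧ ∀ z : Amb q, 1 ≤ ‖z‖ → ‖z‖ ≤ 2 →
      ‖fderiv ℝ (fderiv ℝ (radialExt g)) z‖ ≤ C := by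
  have hK : IsCompact (Metric.closedBall (0 : Amb q) 2 ∩ {z | 1 ≤ ‖z‖}) :=
    (isCompact_closedBall _ _).inter_right (isClosed_le continuous_const continuous_norm)
  have hc : ContinuousOn (fun z : Amb q => ‖fderiv ℝ (fderiv ℝ (radialExt g)) z‖)
      (Metric.closedBall (0 : Amb q) 2 ∩ {z | 1 ≤ ‖z‖}) := fun z hz => by
    have hz0 : z ≠ 0 := by
      rintro rfl
      have := hz.2
      simp only [mem_ofPred_eq, norm_zero] at this
      linarith
    exact ((continuous_norm (E := Amb q →L[ℝ] Amb q →L[ℝ] ℝ)).continuousAt.comp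
      (continuousAt_fderiv_fderiv_radialExt hg hz0)).continuousWithinAt
  obtain ⟨C, hC⟩ := hK.bddAbove_image hc
  refine ⟨max C 0, le_max_right _ _, fun z h1 h2 => ?_⟩
  exact (hC (mem_image_of_mem _ ⟨by simpa using h2, h1⟩)).trans (le_max_left _ _)

end Radial

/-! ### Local limits of the functions entering the estimator -/

/-- Bandwidths tending to zero, and points of the sphere with frames converging to `x₀`, `β₀`. -/
structure Localized {q : ℕ} {ι : Type*} (l : Filter ι) (h : ι → ℝ) (x : ι → Sph q)
    (β : ι → Fin q → Amb q) (x₀ : Sph q) (β₀ : Fin q → Amb q) : Prop where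
  h_pos : ∀ i, 0 < h i
  h_zero : Tendsto h l (𝓝 0)
  frame : ∀ i, IsFrameAt (x i) (β i)
  frame₀ : IsFrameAt x₀ β₀
  tendsto_x : Tendsto x l (𝓝 x₀)
  tendsto_β : ∀ j, Tendsto (fun i => β i j) l (𝓝 (β₀ j))

theorem tendsto_clm_apply {ι E F : Type*} [NormedAddCommGroup E] [NormedSpace ℝ E]
    [NormedAddCommGroup F] [NormedSpace ℝ F] {l : Filter ι} {A : ι → E →L[ℝ] F} {A₀ : E →L[ℝ] F}
    {w : ι → E} {w₀ : E} (hA : Tendsto A l (𝓝 A₀)) (hw : Tendsto w l (𝓝 w₀)) :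
    Tendsto (fun i => A i (w i)) l (𝓝 (A₀ w₀)) :=
  (isBoundedBilinearMap_apply.continuous.tendsto (A₀, w₀)).comp (hA.prodMk_nhds hw)

namespace Localized

variable {q : ℕ} {ι : Type*} {l : Filter ι} {h : ι → ℝ} {x : ι → Sph q}
  {β : ι → Fin q → Amb q} {x₀ : Sph q} {β₀ : Fin q → Amb q} {g : Sph q → ℝ}

theorem tendsto_coe (H : Localized l h x β x₀ β₀) :
    Tendsto (fun i => (x i : Amb q)) l (𝓝 (x₀ : Amb q)) :=
  (continuous_subtype_val.tendsto x₀).comp H.tendsto_x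

theorem tendsto_frameMap (H : Localized l h x β x₀ β₀) (v : Tan q) :
    Tendsto (fun i => frameMap (β i) v) l (𝓝 (frameMap β₀ v)) := by
  simp_rw [frameMap_apply]
  exact tendsto_finsetSum _ fun j _ => (H.tendsto_β j).const_smul (v j)

theorem tendsto_sqrt (H : Localized l h x β x₀ β₀) (v : Tan q) :
    Tendsto (fun i => √(1 + ‖h i • v‖ ^ 2)) l (𝓝 1) := by
  have h1 : Tendsto (fun i => √(1 + ‖h i • v‖ ^ 2)) l (𝓝 (√(1 + ‖(0 : ℝ) • v‖ ^ 2))) :=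
    (((H.h_zero.smul_const v).norm.pow 2).const_add 1).sqrt
  simpa using h1

theorem tendsto_gnomonic (H : Localized l h x β x₀ β₀) (v : Tan q) :
    Tendsto (fun i => gnomonic (x i) (β i) (h i • v)) l (𝓝 x₀) := by
  rw [tendsto_subtype_rng]
  simp_rw [fun i => (H.frame i).coe_gnomonic (h i • v), map_smul]
  have h1 := ((H.tendsto_sqrt v).inv₀ one_ne_zero).smul
    (H.tendsto_coe.add (H.h_zero.smul (H.tendsto_frameMap v)))
  simpa using h1

theorem localLimit_continuous (H : Localized l h x β x₀ β₀) {a : Sph q → ℝ} (ha : Continuous a) :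
    LocalLimit l h x β (fun _ => a) (fun _ => a x₀) := by
  obtain ⟨C, hC⟩ := (isCompact_range ha.norm).bddAbove
  have hC' : ∀ y, |a y| ≤ max C 0 := fun y => (hC (mem_range_self y)).trans (le_max_left _ _)
  exact
    { measurable := fun _ => ha.measurable
      far := ⟨max C 0, 0, le_max_right _ _, Eventually.of_forall fun i y => by simpa using hC' y⟩
      near := ⟨max C 0, 0, le_max_right _ _, Eventually.of_forall fun i v _ => by
        simpa using hC' _⟩
      tendsto := fun v => (ha.tendsto x₀).comp (H.tendsto_gnomonic v) }

theorem localLimit_coord (H : Localized l h x β x₀ β₀) (j : Fin q) :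
    LocalLimit l h x β (fun i y => inner ℝ ((y : Amb q) - x i) (β i j) / h i)
      (fun v => v j) where
  measurable i := by fun_prop
  far := by
    refine ⟨2, 1, zero_le_two, Eventually.of_forall fun i y => ?_⟩
    have hβ : ‖β i j‖ = 1 := by simpa using (H.frame i).1 j.succ
    rw [abs_div, abs_of_pos (H.h_pos i), pow_one, div_eq_mul_inv]
    have := inv_pos.2 (H.h_pos i)
    gcongr
    calc |inner ℝ ((y : Amb q) - x i) (β i j)| ≤ ‖(y : Amb q) - x i‖ * ‖β i j‖ :=
          abs_real_inner_le_norm _ _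
      _ ≤ 2 := by
        rw [hβ, mul_one]
        refine (norm_sub_le _ _).trans ?_
        rw [norm_coe_sph, norm_coe_sph]
        norm_num
  near := by
    refine ⟨1, 1, zero_le_one, Eventually.of_forall fun i v _ => ?_⟩
    have hs : (√(1 + ‖h i • v‖ ^ 2))⁻¹ ≤ 1 := by
      refine inv_le_one_of_one_le₀ ?_
      rw [Real.one_le_sqrt]
      nlinarith [sq_nonneg ‖h i • v‖]
    rw [(H.frame i).gnomonic_inner_frame, PiLp.smul_apply, smul_eq_mul, mul_div_assoc,
      mul_div_cancel_left₀ _ (H.h_pos i).ne', abs_mul, abs_of_pos (by positivity), pow_one]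
    gcongr
    exact (PiLp.norm_apply_le v j).trans (by simp)
  tendsto v := by
    have h1 := ((H.tendsto_sqrt v).inv₀ one_ne_zero).mul_const (v j)
    rw [inv_one, one_mul] at h1
    refine h1.congr fun i => ?_
    rw [(H.frame i).gnomonic_inner_frame, PiLp.smul_apply, smul_eq_mul, mul_div_assoc,
      mul_div_cancel_left₀ _ (H.h_pos i).ne']

/-- Constancy on rays lets `g` at the chart point be replaced by its extension at the affine point
`x + h B v`, so Taylor's formula runs along a straight segment and no curvature term appears. -/
theorem exists_taylor (H : Localized l h x β x₀ β₀) (hg : ContDiffOn ℝ 2 (radialExt g) {0}ᶜ)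
    (i : ι) (v : Tan q) : ∃ ξ ∈ Ioo (0 : ℝ) 1,
      g (gnomonic (x i) (β i) (h i • v)) - g (x i) =
        h i * fderiv ℝ (radialExt g) (x i : Amb q) (frameMap (β i) v) +
        h i ^ 2 / 2 * fderiv ℝ (fderiv ℝ (radialExt g))
          ((x i : Amb q) + frameMap (β i) (ξ • h i • v)) (frameMap (β i) v) (frameMap (β i) v) := by
  obtain ⟨ξ, hξ, hξ'⟩ := exists_taylor_two (G := radialExt g) (x := (x i : Amb q))
    (w := frameMap (β i) (h i • v)) fun t _ => by
      rw [← map_smul]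
      exact contDiffAt_radialExt hg ((H.frame i).add_ne_zero _)
  refine ⟨ξ, hξ, ?_⟩
  rw [(H.frame i).radialExt_add, radialExt_coe] at hξ'
  rw [hξ', map_smul (frameMap (β i)) ξ]
  simp only [map_smul, _root_.smul_apply, smul_eq_mul]
  ring

theorem norm_fderiv_fderiv_le (H : Localized l h x β x₀ β₀) {C : ℝ}
    (hC : ∀ z : Amb q, 1 ≤ ‖z‖ → ‖z‖ ≤ 2 → ‖fderiv ℝ (fderiv ℝ (radialExt g)) z‖ ≤ C)
    (i : ι) {v : Tan q} (hv : ‖h i • v‖ ≤ 1) {ξ : ℝ} (hξ : ξ ∈ Ioo (0 : ℝ) 1) :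
    |fderiv ℝ (fderiv ℝ (radialExt g)) ((x i : Amb q) + frameMap (β i) (ξ • h i • v))
      (frameMap (β i) v) (frameMap (β i) v)| ≤ C * ‖v‖ ^ 2 := by
  have h1 := (H.frame i).norm_add_sq (ξ • h i • v)
  have h2 : ‖ξ • h i • v‖ ≤ 1 := by
    rw [norm_smul, Real.norm_of_nonneg hξ.1.le]
    exact mul_le_one₀ hξ.2.le (norm_nonneg _) hv
  have h3 : ‖(x i : Amb q) + frameMap (β i) (ξ • h i • v)‖ ≤ 2 := by
    nlinarith [norm_nonneg (ξ • h i • v),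
      norm_nonneg ((x i : Amb q) + frameMap (β i) (ξ • h i • v))]
  have h4 : 1 ≤ ‖(x i : Amb q) + frameMap (β i) (ξ • h i • v)‖ := by
    nlinarith [norm_nonneg (ξ • h i • v),
      norm_nonneg ((x i : Amb q) + frameMap (β i) (ξ • h i • v))]
  rw [← Real.norm_eq_abs]
  refine (ContinuousLinearMap.le_opNorm₂ _ _ _).trans ?_
  rw [(H.frame i).norm_frameMap, mul_assoc, ← sq]
  gcongr
  exact hC _ h4 h3

theorem tendsto_fderiv (H : Localized l h x β x₀ β₀) (hg : ContDiffOn ℝ 2 (radialExt g) {0}ᶜ)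
    (v : Tan q) :
    Tendsto (fun i => fderiv ℝ (radialExt g) (x i : Amb q) (frameMap (β i) v)) l
      (𝓝 (fderiv ℝ (radialExt g) (x₀ : Amb q) (frameMap β₀ v))) := by
  have h1 : Tendsto (fun i => fderiv ℝ (radialExt g) (x i : Amb q)) l
      (𝓝 (fderiv ℝ (radialExt g) (x₀ : Amb q))) :=
    (continuousAt_fderiv_radialExt hg (coe_sph_ne_zero x₀)).tendsto.comp H.tendsto_coe
  exact tendsto_clm_apply h1 (H.tendsto_frameMap v)

theorem tendsto_fderiv_fderiv (H : Localized l h x β x₀ β₀)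
    (hg : ContDiffOn ℝ 2 (radialExt g) {0}ᶜ) (v : Tan q) {ξ : ι → ℝ}
    (hξ : ∀ i, ξ i ∈ Ioo (0 : ℝ) 1) :
    Tendsto (fun i => fderiv ℝ (fderiv ℝ (radialExt g))
      ((x i : Amb q) + frameMap (β i) (ξ i • h i • v)) (frameMap (β i) v) (frameMap (β i) v)) l
      (𝓝 (fderiv ℝ (fderiv ℝ (radialExt g)) (x₀ : Amb q) (frameMap β₀ v) (frameMap β₀ v))) := by
  have h0 : Tendsto (fun i => frameMap (β i) (ξ i • h i • v)) l (𝓝 0) := by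
    have hb : Tendsto (fun i => h i * ‖v‖) l (𝓝 0) := by simpa using H.h_zero.mul_const ‖v‖
    refine squeeze_zero_norm (fun i => ?_) hb
    rw [(H.frame i).norm_frameMap, norm_smul, norm_smul, Real.norm_of_nonneg (hξ i).1.le,
      Real.norm_of_nonneg (H.h_pos i).le]
    exact mul_le_of_le_one_left (mul_nonneg (H.h_pos i).le (norm_nonneg _)) (hξ i).2.le
  have h1 : Tendsto (fun i => (x i : Amb q) + frameMap (β i) (ξ i • h i • v)) l
      (𝓝 (x₀ : Amb q)) := by
    simpa using H.tendsto_coe.add h0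
  have h2 : Tendsto (fun i => fderiv ℝ (fderiv ℝ (radialExt g))
      ((x i : Amb q) + frameMap (β i) (ξ i • h i • v))) l
      (𝓝 (fderiv ℝ (fderiv ℝ (radialExt g)) (x₀ : Amb q))) :=
    (continuousAt_fderiv_fderiv_radialExt hg (coe_sph_ne_zero x₀)).tendsto.comp h1
  exact tendsto_clm_apply (tendsto_clm_apply h2 (H.tendsto_frameMap v)) (H.tendsto_frameMap v)

/-- Applied to the density `f`, this is the source of `∇f` in the bias for `p = 0`. -/
theorem localLimit_slope (H : Localized l h x β x₀ β₀) (hg : ContDiffOn ℝ 2 (radialExt g) {0}ᶜ) :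
    LocalLimit l h x β (fun i y => (g y - g (x i)) / h i)
      (fun v => fderiv ℝ (radialExt g) (x₀ : Amb q) (frameMap β₀ v)) := by
  have hgc : Continuous g := continuous_of_contDiffOn (n := 2) hg
  obtain ⟨C, hC⟩ := (isCompact_range hgc.norm).bddAbove
  obtain ⟨C₁, hC₁0, hC₁⟩ := exists_bound_fderiv hg
  obtain ⟨C₂, hC₂0, hC₂⟩ := exists_bound_fderiv_fderiv hg
  choose ξ hξ hT using H.exists_taylor hg
  have hT' : ∀ i v, (g (gnomonic (x i) (β i) (h i • v)) - g (x i)) / h i =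
      fderiv ℝ (radialExt g) (x i : Amb q) (frameMap (β i) v) +
        h i / 2 * fderiv ℝ (fderiv ℝ (radialExt g))
          ((x i : Amb q) + frameMap (β i) (ξ i v • h i • v)) (frameMap (β i) v)
          (frameMap (β i) v) := by
    intro i v
    have := H.h_pos i
    rw [hT]
    field_simp
  refine ⟨fun i => (hgc.measurable.sub_const _).div_const _, ?_, ?_, ?_⟩
  · refine ⟨2 * max C 0, 1, by positivity, Eventually.of_forall fun i y => ?_⟩
    rw [abs_div, abs_of_pos (H.h_pos i), pow_one, div_eq_mul_inv]
    have := inv_pos.2 (H.h_pos i)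
    have hb : ∀ y, |g y| ≤ max C 0 := fun y => (hC (mem_range_self y)).trans (le_max_left _ _)
    gcongr
    refine (abs_sub _ _).trans ?_
    linarith [hb y, hb (x i)]
  · refine ⟨C₁ + C₂, 1, by positivity, Eventually.of_forall fun i v hv => ?_⟩
    rw [hT', pow_one]
    have h1 : |fderiv ℝ (radialExt g) (x i : Amb q) (frameMap (β i) v)| ≤ C₁ * ‖v‖ := by
      rw [← Real.norm_eq_abs]
      refine (ContinuousLinearMap.le_opNorm _ _).trans ?_
      rw [(H.frame i).norm_frameMap]
      gcongr
      exact hC₁ _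
    have h2 := H.norm_fderiv_fderiv_le hC₂ i hv (hξ i v)
    rw [norm_smul, Real.norm_of_nonneg (H.h_pos i).le] at hv
    refine (abs_add_le _ _).trans ?_
    rw [abs_mul, abs_of_pos (half_pos (H.h_pos i))]
    have h3 : h i / 2 * |fderiv ℝ (fderiv ℝ (radialExt g))
          ((x i : Amb q) + frameMap (β i) (ξ i v • h i • v)) (frameMap (β i) v)
          (frameMap (β i) v)| ≤ C₂ * ‖v‖ := by
      calc _ ≤ h i / 2 * (C₂ * ‖v‖ ^ 2) := by
            have := H.h_pos i
            gcongr
        _ = C₂ * ‖v‖ * (h i * ‖v‖) / 2 := by ring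
        _ ≤ C₂ * ‖v‖ * 1 / 2 := by gcongr
        _ ≤ C₂ * ‖v‖ := by
          have : 0 ≤ C₂ * ‖v‖ := by positivity
          linarith
    have : (C₁ + C₂) * (1 + ‖v‖) = C₁ + C₂ + C₁ * ‖v‖ + C₂ * ‖v‖ := by ring
    linarith
  · intro v
    simp_rw [hT']
    have h1 := (H.tendsto_fderiv hg v).add ((H.h_zero.div_const 2).mul
      (H.tendsto_fderiv_fderiv hg v (ξ := fun i => ξ i v) fun i => hξ i v))
    simpa using h1

/-- The remainder of the first order expansion of `g` at `x`, along the sphere. -/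
def remainder (g : Sph q → ℝ) (x y : Sph q) : ℝ :=
  g y - g x - fderiv ℝ (radialExt g) (x : Amb q) ((y : Amb q) - x)

/-- The linear part is taken at the chord `y - x`, whose tangential component is `h B v / s` with `s
= √(1 + ‖h v‖²)`, not `h B v`. The discrepancy `h (1 - 1/s)` is of order `h³` and survives in `hT'`
as a term of order `h`; the rest is half the second derivative. -/
theorem localLimit_remainder (H : Localized l h x β x₀ β₀)
    (hg : ContDiffOn ℝ 2 (radialExt g) {0}ᶜ) :
    LocalLimit l h x β (fun i y => remainder g (x i) y / h i ^ 2)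
      (fun v => 1 / 2 * fderiv ℝ (fderiv ℝ (radialExt g)) (x₀ : Amb q) (frameMap β₀ v)
        (frameMap β₀ v)) := by
  have hgc : Continuous g := continuous_of_contDiffOn (n := 2) hg
  obtain ⟨C, hC⟩ := (isCompact_range hgc.norm).bddAbove
  obtain ⟨C₁, hC₁0, hC₁⟩ := exists_bound_fderiv hg
  obtain ⟨C₂, hC₂0, hC₂⟩ := exists_bound_fderiv_fderiv hg
  choose ξ hξ hT using H.exists_taylor hg
  have hT' : ∀ i v, remainder g (x i) (gnomonic (x i) (β i) (h i • v)) / h i ^ 2 =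
      1 / 2 * fderiv ℝ (fderiv ℝ (radialExt g))
          ((x i : Amb q) + frameMap (β i) (ξ i v • h i • v)) (frameMap (β i) v)
          (frameMap (β i) v) +
      h i * (‖v‖ ^ 2 / (√(1 + ‖h i • v‖ ^ 2) * (√(1 + ‖h i • v‖ ^ 2) + 1))) *
        fderiv ℝ (radialExt g) (x i : Amb q) (frameMap (β i) v) := by
    intro i v
    have := H.h_pos i
    have hs := sqrt_one_add_pos (h i • v)
    have hs2 : √(1 + ‖h i • v‖ ^ 2) ^ 2 = 1 + h i ^ 2 * ‖v‖ ^ 2 := by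
      rw [Real.sq_sqrt (by positivity), norm_smul, mul_pow, Real.norm_eq_abs, sq_abs]
    rw [remainder, hT, (H.frame i).coe_gnomonic]
    simp only [map_sub, map_smul, map_add, smul_eq_mul,
      fderiv_radialExt_self hg (coe_sph_ne_zero (x i))]
    generalize √(1 + ‖h i • v‖ ^ 2) = s at *
    have hv2 : ‖v‖ ^ 2 = (s ^ 2 - 1) / h i ^ 2 := by
      field_simp
      linarith
    rw [hv2]
    field_simp
    ring
  refine ⟨fun i => ?_, ?_, ?_, ?_⟩
  · unfold remainder
    have := hgc.measurable
    fun_prop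
  · refine ⟨2 * max C 0 + 2 * C₁, 2, by positivity, Eventually.of_forall fun i y => ?_⟩
    rw [abs_div, abs_of_pos (pow_pos (H.h_pos i) 2), div_eq_mul_inv, inv_pow]
    have := inv_pos.2 (pow_pos (H.h_pos i) 2)
    have hb : ∀ y, |g y| ≤ max C 0 := fun y => (hC (mem_range_self y)).trans (le_max_left _ _)
    have h1 : |fderiv ℝ (radialExt g) (x i : Amb q) ((y : Amb q) - x i)| ≤ 2 * C₁ := by
      rw [← Real.norm_eq_abs]
      refine (ContinuousLinearMap.le_opNorm _ _).trans ?_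
      have h2 : ‖(y : Amb q) - x i‖ ≤ 2 := by
        refine (norm_sub_le _ _).trans ?_
        rw [norm_coe_sph, norm_coe_sph]
        norm_num
      rw [mul_comm]
      exact mul_le_mul h2 (hC₁ _) (norm_nonneg _) zero_le_two
    gcongr
    refine (abs_sub _ _).trans ((add_le_add_left (abs_sub _ _) _).trans ?_)
    linarith [hb y, hb (x i)]
  · refine ⟨C₁ + C₂, 2, by positivity, Eventually.of_forall fun i v hv => ?_⟩
    rw [hT']
    have h1 : |fderiv ℝ (radialExt g) (x i : Amb q) (frameMap (β i) v)| ≤ C₁ * ‖v‖ := by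
      rw [← Real.norm_eq_abs]
      refine (ContinuousLinearMap.le_opNorm _ _).trans ?_
      rw [(H.frame i).norm_frameMap]
      gcongr
      exact hC₁ _
    have h2 := H.norm_fderiv_fderiv_le hC₂ i hv (hξ i v)
    have hs1 : 1 ≤ √(1 + ‖h i • v‖ ^ 2) := by
      rw [Real.one_le_sqrt]
      nlinarith [sq_nonneg ‖h i • v‖]
    have hq1 : ‖v‖ ^ 2 / (√(1 + ‖h i • v‖ ^ 2) * (√(1 + ‖h i • v‖ ^ 2) + 1)) ≤ ‖v‖ ^ 2 :=
      div_le_self (by positivity) (by nlinarith)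
    rw [norm_smul, Real.norm_of_nonneg (H.h_pos i).le] at hv
    refine (abs_add_le _ _).trans ?_
    rw [abs_mul, abs_mul (h i * _), abs_of_nonneg (mul_nonneg (H.h_pos i).le (by positivity))]
    have h3 : h i * (‖v‖ ^ 2 / (√(1 + ‖h i • v‖ ^ 2) * (√(1 + ‖h i • v‖ ^ 2) + 1))) *
        |fderiv ℝ (radialExt g) (x i : Amb q) (frameMap (β i) v)| ≤ C₁ * ‖v‖ ^ 2 := by
      have := H.h_pos i
      calc _ ≤ h i * ‖v‖ ^ 2 * (C₁ * ‖v‖) := by gcongr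
        _ = C₁ * ‖v‖ ^ 2 * (h i * ‖v‖) := by ring
        _ ≤ C₁ * ‖v‖ ^ 2 * 1 := by gcongr
        _ = _ := mul_one _
    have h4 : ‖v‖ ^ 2 ≤ (1 + ‖v‖) ^ 2 := by nlinarith [norm_nonneg v]
    have h5 := mul_le_mul_of_nonneg_left h4 (add_nonneg hC₁0 hC₂0)
    have h6 : |(1 / 2 : ℝ)| = 1 / 2 := by norm_num
    rw [h6]
    have h7 : 0 ≤ C₂ * ‖v‖ ^ 2 := by positivity
    linarith
  · intro v
    simp_rw [hT']
    have hfrac : Tendsto (fun i => ‖v‖ ^ 2 / (√(1 + ‖h i • v‖ ^ 2) * (√(1 + ‖h i • v‖ ^ 2) + 1)))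
        l (𝓝 (‖v‖ ^ 2 / (1 * (1 + 1)))) :=
      tendsto_const_nhds.div ((H.tendsto_sqrt v).mul ((H.tendsto_sqrt v).add_const 1))
        (by norm_num)
    have h1 := ((H.tendsto_fderiv_fderiv hg v (ξ := fun i => ξ i v)
      fun i => hξ i v).const_mul (1 / 2)).add
        ((H.h_zero.mul hfrac).mul (H.tendsto_fderiv hg v))
    rw [zero_mul, zero_mul, add_zero] at h1
    exact h1

end Localized

/-! ### Conditional moments of a linear estimator given the design -/

section CondDistrib

variable {Ω β γ : Type*} [MeasurableSpace Ω] [MeasurableSpace β] [MeasurableSpace γ]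
  [StandardBorelSpace γ] [Nonempty γ] {μ : Measure Ω} [IsFiniteMeasure μ]

/-- The conditional distribution of `G (V, U)` given `V` is the image under `G (v, ·)` of that
of `U`. -/
theorem condDistrib_prod_ae_eq_map {V : Ω → β} {U : Ω → γ} {G : β → γ → ℝ} (hV : Measurable V)
    (hU : Measurable U) (hG : Measurable (Function.uncurry G)) :
    ∀ᵐ ω ∂μ, condDistrib (fun ω => G (V ω) (U ω)) V μ (V ω) =
      (condDistrib U V μ (V ω)).map (G (V ω)) := by
  have hGv : ∀ v, Measurable (G v) := fun v => hG.comp measurable_prodMk_left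
  have happ : ∀ v, ((Kernel.id ×ₖ condDistrib U V μ).map (Function.uncurry G)) v =
      (condDistrib U V μ v).map (G v) := by
    intro v
    rw [Kernel.map_apply _ hG, Kernel.prod_apply, Kernel.id_apply, Measure.dirac_prod,
      Measure.map_map hG measurable_prodMk_left]
    rfl
  -- Disintegrations are almost surely unique, so it suffices that this kernel reproduces the joint
  -- law of `(V, G (V, U))`.
  have hκ : μ.map (fun ω => (V ω, G (V ω) (U ω))) =
      μ.map V ⊗ₘ (Kernel.id ×ₖ condDistrib U V μ).map (Function.uncurry G) := by
    have hf : Measurable fun z : β × γ => (z.1, G z.1 z.2) := measurable_fst.prodMk hG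
    have h1 : μ.map (fun ω => (V ω, G (V ω) (U ω))) =
        (μ.map fun ω => (V ω, U ω)).map fun z => (z.1, G z.1 z.2) := by
      rw [Measure.map_map hf (hV.prodMk hU)]
      rfl
    rw [h1, ← compProd_map_condDistrib hU.aemeasurable]
    ext s hs
    rw [Measure.map_apply hf hs, Measure.compProd_apply (hf hs), Measure.compProd_apply hs]
    refine lintegral_congr fun v => ?_
    rw [happ, Measure.map_apply (hGv v) (measurable_prodMk_left hs)]
    rfl
  have hZ : Measurable fun ω => G (V ω) (U ω) := hG.comp (hV.prodMk hU)
  have := condDistrib_ae_eq_of_measure_eq_compProd V hZ.aemeasurable hκ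
  filter_upwards [ae_of_ae_map hV.aemeasurable this] with ω hω
  rw [hω, happ]

end CondDistrib

/-- On rectangles the integral factorizes by independence and each factor is known from `hc`; a π-λ
induction gives all measurable sets. -/
theorem setIntegral_prod_eq {Ω S : Type*} [MeasurableSpace Ω] [MeasurableSpace S]
    {μ : Measure Ω} [IsProbabilityMeasure μ] {n : ℕ} {X : Fin n → Ω → S} {W : Fin n → Ω → ℝ}
    (hX : ∀ i, Measurable (X i)) (hW : ∀ i, Measurable (W i))
    (hind : iIndepFun (fun i ω => (X i ω, W i ω)) μ) (hint : Integrable (fun ω => ∏ i, W i ω) μ)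
    {c : Fin n → ℝ}
    (hc : ∀ i, ∀ A, MeasurableSet A → ∫ ω in X i ⁻¹' A, W i ω ∂μ = c i * μ.real (X i ⁻¹' A))
    {s : Set (Fin n → S)} (hs : MeasurableSet s) :
    ∫ ω in (fun ω i => X i ω) ⁻¹' s, ∏ i, W i ω ∂μ =
      (∏ i, c i) * μ.real ((fun ω i => X i ω) ⁻¹' s) := by
  have hV : Measurable fun ω i => X i ω := measurable_pi_lambda _ hX
  have hrect : ∀ A : Fin n → Set S, (∀ i, MeasurableSet (A i)) →
      ∫ ω in (fun ω i => X i ω) ⁻¹' (univ.pi A), ∏ i, W i ω ∂μ =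
        (∏ i, c i) * μ.real ((fun ω i => X i ω) ⁻¹' (univ.pi A)) := by
    intro A hA
    -- Used twice: with the second coordinate for the integral of the product, and with the constant
    -- `1` for the probability of the rectangle.
    have hgen : ∀ w : Fin n → S × ℝ → ℝ, (∀ i, Measurable (w i)) →
        ∫ ω in (fun ω i => X i ω) ⁻¹' (univ.pi A), ∏ i, w i (X i ω, W i ω) ∂μ =
          ∏ i, ∫ ω in X i ⁻¹' (A i), w i (X i ω, W i ω) ∂μ := by
      intro w hw
      have hm : ∀ i, Measurable ((Prod.fst ⁻¹' (A i)).indicator (w i)) := fun i =>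
        (hw i).indicator (measurable_fst (hA i))
      have h1 := hind.integral_fun_prod_comp
        (f := fun i => (Prod.fst ⁻¹' (A i)).indicator (w i))
        (fun i => ((hX i).prodMk (hW i)).aemeasurable) fun i => (hm i).aestronglyMeasurable
      rw [← integral_indicator (hV (MeasurableSet.univ_pi hA))]
      simp_rw [← fun i => integral_indicator (μ := μ) (f := fun ω => w i (X i ω, W i ω))
        (hX i (hA i))]
      refine Eq.trans (integral_congr_ae (Eventually.of_forall fun ω => ?_)) h1
      by_cases hω : ∀ i, X i ω ∈ A i
      · have : ω ∈ (fun ω i => X i ω) ⁻¹' (univ.pi A) := fun i _ => hω i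
        simp only [indicator_of_mem this]
        exact Finset.prod_congr rfl fun i _ => (indicator_of_mem (by exact hω i) _).symm
      · have : ω ∉ (fun ω i => X i ω) ⁻¹' (univ.pi A) := fun h => hω fun i => h i (mem_univ i)
        simp only [indicator_of_notMem this]
        obtain ⟨i, hi⟩ := not_forall.1 hω
        exact (Finset.prod_eq_zero (Finset.mem_univ i) (indicator_of_notMem (by exact hi) _)).symm
    have h1 := hgen (fun _ z => z.2) fun _ => measurable_snd
    have h2 := hgen (fun _ _ => 1) fun _ => measurable_const
    simp only [Finset.prod_const_one, integral_const, smul_eq_mul, mul_one,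
      measureReal_restrict_apply_univ] at h2
    rw [h1, h2, ← Finset.prod_mul_distrib]
    exact Finset.prod_congr rfl fun i _ => hc i (A i) (hA i)
  have huniv := hrect (fun _ => univ) fun _ => MeasurableSet.univ
  rw [pi_univ, preimage_univ] at huniv
  refine MeasurableSpace.induction_on_inter
    (C := fun s _ => ∫ ω in (fun ω i => X i ω) ⁻¹' s, ∏ i, W i ω ∂μ =
      (∏ i, c i) * μ.real ((fun ω i => X i ω) ⁻¹' s))
    generateFrom_pi.symm isPiSystem_pi ?_ ?_ ?_ ?_ s hs
  · simp
  · rintro _ ⟨A, hA, rfl⟩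
    exact hrect A fun i => hA i (mem_univ i)
  · intro t htm ih
    rw [preimage_compl, setIntegral_compl (hV htm) hint, ih, measureReal_compl (hV htm)]
    rw [setIntegral_univ] at huniv
    rw [huniv]
    ring
  · intro f hd hm ih
    rw [preimage_iUnion, integral_iUnion (fun i => hV (hm i))
      (fun i j hij => (hd hij).preimage _) hint.integrableOn]
    simp_rw [ih, tsum_mul_left]
    congr 1
    rw [measureReal_def, measure_iUnion (fun i j hij => (hd hij).preimage _) fun i => hV (hm i),
      ENNReal.tsum_toReal_eq fun i => measure_ne_top _ _]
    rfl

/-- If the pairs `(X i, W i)` are independent and `E[W i | X i] = c i`, then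
`E[∏ i, W i | X] = ∏ i, c i`. -/
theorem condExp_prod_eq {Ω S : Type*} [MeasurableSpace Ω] [MeasurableSpace S]
    {μ : Measure Ω} [IsProbabilityMeasure μ] {n : ℕ} {X : Fin n → Ω → S} {W : Fin n → Ω → ℝ}
    (hX : ∀ i, Measurable (X i)) (hW : ∀ i, Measurable (W i))
    (hind : iIndepFun (fun i ω => (X i ω, W i ω)) μ) (hint : Integrable (fun ω => ∏ i, W i ω) μ)
    {c : Fin n → ℝ}
    (hc : ∀ i, ∀ A, MeasurableSet A → ∫ ω in X i ⁻¹' A, W i ω ∂μ = c i * μ.real (X i ⁻¹' A)) :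
    μ[fun ω => ∏ i, W i ω | MeasurableSpace.comap (fun ω i => X i ω) inferInstance] =ᵐ[μ]
      fun _ => ∏ i, c i := by
  have hV : Measurable fun ω i => X i ω := measurable_pi_lambda _ hX
  refine (ae_eq_condExp_of_forall_setIntegral_eq hV.comap_le hint
    (fun s _ _ => integrableOn_const) ?_ aestronglyMeasurable_const).symm
  rintro _ ⟨s, hs, rfl⟩ -
  rw [setIntegral_const, setIntegral_prod_eq hX hW hind hint hc hs, smul_eq_mul, mul_comm]

/-! ### The noise given the design, and linear estimators. -/

section Sample

variable {q : ℕ} {Ω : Type*} [MeasurableSpace Ω] {μ : Measure Ω}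
  {f m σ : Sph q → ℝ} {X : ℕ → Ω → Sph q} {Y ε : ℕ → Ω → ℝ}

/-- Since `σ` does not vanish, `ε = (Y - m(X))/σ(X)` is a function of the pair `(X, Y)`, for which
independence is assumed. -/
theorem IsRegressionSample.iIndepFun_noise (hs : IsRegressionSample μ f m σ X Y ε)
    (hm : Measurable m) (hσ : ∀ x, σ x ≠ 0) : iIndepFun (fun i ω => (X i ω, ε i ω)) μ := by
  have hσm := hs.measurable_σ
  have h1 := hs.indep.comp (fun _ z => (z.1, (z.2 - m z.1) / σ z.1)) fun _ => by fun_prop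
  convert h1 using 3 with i ω
  simp only [Function.comp_apply, hs.model]
  rw [add_sub_cancel_left, mul_div_cancel_left₀ _ (hσ _)]

variable [IsProbabilityMeasure μ]

theorem setIntegral_eq_of_condExp_eq {S : Type*} [MeasurableSpace S] {X : Ω → S} {W : Ω → ℝ}
    (hX : Measurable X) (hW : Integrable W μ) {c : ℝ}
    (hc : μ[W | MeasurableSpace.comap X inferInstance] =ᵐ[μ] fun _ => c) {A : Set S}
    (hA : MeasurableSet A) : ∫ ω in X ⁻¹' A, W ω ∂μ = c * μ.real (X ⁻¹' A) := by
  rw [← setIntegral_condExp hX.comap_le hW ⟨A, hA, rfl⟩,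
    setIntegral_congr_ae (hX hA) (hc.mono fun ω hω _ => hω), setIntegral_const, smul_eq_mul,
    mul_comm]

/-- The conditional moments of order `0`, `1`, `2` are the constants `1`, `0`, `1`, which explains
the restriction on the exponents. -/
theorem IsRegressionSample.condExp_noise_prod (hs : IsRegressionSample μ f m σ X Y ε)
    (hm : Measurable m) (hσ : ∀ x, σ x ≠ 0) {n : ℕ} (k : Fin n → ℕ) (hk : ∀ i, k i ≤ 2)
    (hint : Integrable (fun ω => ∏ i : Fin n, ε i ω ^ k i) μ) :
    μ[fun ω => ∏ i : Fin n, ε i ω ^ k i |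
      MeasurableSpace.comap (fun ω (i : Fin n) => X i ω) inferInstance] =ᵐ[μ]
      fun _ => ∏ i, if k i = 1 then (0 : ℝ) else 1 := by
  refine condExp_prod_eq (X := fun i : Fin n => X i) (fun i => hs.measurable_X i)
    (fun i => (hs.measurable_ε i).pow_const _) ?_ hint fun i A hA => ?_
  · have h1 := (hs.iIndepFun_noise hm hσ).precomp (g := fun i : Fin n => (i : ℕ))
      Fin.val_injective
    exact h1.comp (fun i z => (z.1, z.2 ^ k i)) fun i => by fun_prop
  · have hε2 : MemLp (ε i) 2 μ := (hs.memLp_ε i).mono_exponent (by norm_num)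
    have hki := hk i
    interval_cases k i
    · simp
    · simpa using setIntegral_eq_of_condExp_eq (hs.measurable_X i)
        (hε2.integrable (by norm_num)) (hs.mean_ε i) hA
    · simpa using setIntegral_eq_of_condExp_eq (hs.measurable_X i) hε2.integrable_sq
        (hs.var_ε i) hA

/-- One monomial covers both cases: distinct indices with exponents `1, 1`, and equal indices with
exponent `2`. -/
theorem prod_pow_indicator {n : ℕ} (a : Fin n → ℝ) (j k : Fin n) :
    ∏ i, a i ^ ((if i = j then 1 else 0) + if i = k then 1 else 0) = a j * a k := by
  simp_rw [pow_add, Finset.prod_mul_distrib, pow_ite, pow_one, pow_zero]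
  simp

/-- The conditional distribution of the noise given the design is centred, with identity
covariance matrix. -/
theorem IsRegressionSample.ae_condDistrib_noise (hs : IsRegressionSample μ f m σ X Y ε)
    (hm : Measurable m) (hσ : ∀ x, σ x ≠ 0) (n : ℕ) :
    ∀ᵐ ω ∂μ, ∀ j k : Fin n,
      (Integrable (fun e : Fin n → ℝ => e j)
        (condDistrib (fun ω (i : Fin n) => ε i ω) (fun ω (i : Fin n) => X i ω) μ
          fun i => X i ω) ∧
      ∫ e, e j ∂(condDistrib (fun ω (i : Fin n) => ε i ω) (fun ω (i : Fin n) => X i ω) μ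
          fun i => X i ω) = 0) ∧
      Integrable (fun e : Fin n → ℝ => e j * e k)
        (condDistrib (fun ω (i : Fin n) => ε i ω) (fun ω (i : Fin n) => X i ω) μ
          fun i => X i ω) ∧
      ∫ e, e j * e k ∂(condDistrib (fun ω (i : Fin n) => ε i ω) (fun ω (i : Fin n) => X i ω) μ
          fun i => X i ω) = if j = k then 1 else 0 := by
  have hV : Measurable fun ω (i : Fin n) => X i ω :=
    measurable_pi_lambda _ fun i => hs.measurable_X i
  have hU : Measurable fun ω (i : Fin n) => ε i ω :=
    measurable_pi_lambda _ fun i => hs.measurable_ε i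
  have hε2 : ∀ i, MemLp (ε i) 2 μ := fun i => (hs.memLp_ε i).mono_exponent (by norm_num)
  have hgen : ∀ g : (Fin n → ℝ) → ℝ, Measurable g → Integrable (fun ω => g fun i => ε i ω) μ →
      ∀ c : ℝ, μ[fun ω => g fun i => ε i ω |
        MeasurableSpace.comap (fun ω (i : Fin n) => X i ω) inferInstance] =ᵐ[μ] (fun _ => c) →
      ∀ᵐ ω ∂μ, Integrable g (condDistrib (fun ω (i : Fin n) => ε i ω)
          (fun ω (i : Fin n) => X i ω) μ fun i => X i ω) ∧
        ∫ e, g e ∂(condDistrib (fun ω (i : Fin n) => ε i ω)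
          (fun ω (i : Fin n) => X i ω) μ fun i => X i ω) = c := by
    intro g hg hint c hc
    have h1 := condExp_ae_eq_integral_condDistrib hV hU.aemeasurable hg.stronglyMeasurable hint
    have hint' : Integrable (fun z : (Fin n → Sph q) × (Fin n → ℝ) => g z.2)
        (μ.map fun ω => (fun (i : Fin n) => X i ω, fun (i : Fin n) => ε i ω)) :=
      (integrable_map_measure (hg.comp measurable_snd).aestronglyMeasurable
        (hV.prodMk hU).aemeasurable).2 hint
    have h2 := hint'.condDistrib_ae hV.aemeasurable hU.aemeasurable
    filter_upwards [h1, h2, hc] with ω h1 h2 hc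
    exact ⟨h2, h1.symm.trans hc⟩
  refine ae_all_iff.2 fun j => ae_all_iff.2 fun k => ?_
  have hj : Integrable (fun ω => ε j ω) μ := (hε2 j).integrable (by norm_num)
  have hjk : Integrable (fun ω => ε j ω * ε k ω) μ := (hε2 j).integrable_mul (hε2 k)
  have e1 : ∀ a : Fin n → ℝ, ∏ i, a i ^ (if i = j then 1 else 0) = a j := by
    intro a
    simp_rw [pow_ite, pow_one, pow_zero]
    simp
  have h1 := hs.condExp_noise_prod hm hσ (n := n) (fun i => if i = j then 1 else 0)
    (fun i => by split_ifs <;> norm_num) (by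
      simp_rw [fun ω => e1 fun i => ε i ω]
      exact hj)
  have h2 := hs.condExp_noise_prod hm hσ (n := n)
    (fun i => (if i = j then 1 else 0) + if i = k then 1 else 0)
    (fun i => by split_ifs <;> norm_num) (by
      simp_rw [fun ω => prod_pow_indicator (fun i => ε i ω) j k]
      exact hjk)
  simp_rw [fun ω => e1 fun i => ε i ω] at h1
  simp_rw [fun ω => prod_pow_indicator (fun i => ε i ω) j k] at h2
  have c1 : ∏ i, (if (if i = j then 1 else 0) = 1 then (0 : ℝ) else 1) = 0 :=
    Finset.prod_eq_zero (Finset.mem_univ j) (by simp)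
  have c2 : ∏ i, (if ((if i = j then 1 else 0) + if i = k then 1 else 0) = 1 then (0 : ℝ) else 1) =
      if j = k then 1 else 0 := by
    by_cases hjk : j = k
    · subst hjk
      rw [if_pos rfl]
      refine Finset.prod_eq_one fun i _ => ?_
      by_cases hi : i = j <;> simp [hi]
    · rw [if_neg hjk]
      exact Finset.prod_eq_zero (Finset.mem_univ j) (by simp [hjk])
  rw [c1] at h1
  rw [c2] at h2
  filter_upwards [hgen (fun e => e j) (by fun_prop) hj 0 h1,
    hgen (fun e => e j * e k) (by fun_prop) hjk _ h2] with ω h3 h4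
  exact ⟨h3, h4⟩

/-- The conditional mean and variance, given the design, of an estimator which is linear in the
responses. -/
theorem IsRegressionSample.ae_condMean_condVariance (hs : IsRegressionSample μ f m σ X Y ε)
    (hm : Measurable m) (hσ : ∀ x, σ x ≠ 0) {n : ℕ} {a : (Fin n → Sph q) → Fin n → ℝ}
    (ha : Measurable a) (c : ℝ) :
    ∀ᵐ ω ∂μ,
      condMean μ (fun ω => (∑ i : Fin n, a (fun i => X i ω) i * Y i ω) - c)
        (fun ω (i : Fin n) => X i ω) ω =
        (∑ i : Fin n, a (fun i => X i ω) i * m (X i ω)) - c ∧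
      condVariance μ (fun ω => ∑ i : Fin n, a (fun i => X i ω) i * Y i ω)
        (fun ω (i : Fin n) => X i ω) ω =
        ∑ i : Fin n, a (fun i => X i ω) i ^ 2 * σ (X i ω) ^ 2 := by
  have hV : Measurable fun ω (i : Fin n) => X i ω :=
    measurable_pi_lambda _ fun i => hs.measurable_X i
  have hU : Measurable fun ω (i : Fin n) => ε i ω :=
    measurable_pi_lambda _ fun i => hs.measurable_ε i
  have hσm := hs.measurable_σ
  -- `G c v e` is the estimator minus `c`, as a function of design and noise; the given centring
  -- serves the mean and `0` the variance.
  set G : ℝ → (Fin n → Sph q) → (Fin n → ℝ) → ℝ :=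
    fun c v e => (∑ i, a v i * (m (v i) + σ (v i) * e i)) - c with hGdef
  have hG : ∀ c, Measurable (Function.uncurry (G c)) := by
    intro c
    have ha' : ∀ i, Measurable fun v => a v i := fun i => (measurable_pi_apply i).comp ha
    simp only [hGdef, Function.uncurry_def]
    refine Measurable.sub_const (Finset.measurable_sum _ fun i _ => ?_) _
    have h1 : Measurable fun z : (Fin n → Sph q) × (Fin n → ℝ) => z.1 i := by fun_prop
    exact ((ha' i).comp measurable_fst).mul ((hm.comp h1).add ((hσm.comp h1).mul (by fun_prop)))
  have hGc : ∀ c ω, (∑ i : Fin n, a (fun i => X i ω) i * Y i ω) - c =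
      G c (fun i => X i ω) (fun i => ε i ω) := by
    intro c ω
    simp only [hGdef, hs.model]
  -- Once the design is fixed the weights are constants, so the estimator itself need not be
  -- integrable.
  have h1 := condDistrib_prod_ae_eq_map (μ := μ) hV hU (hG c)
  have h2 := condDistrib_prod_ae_eq_map (μ := μ) hV hU (hG 0)
  filter_upwards [h1, h2, hs.ae_condDistrib_noise hm hσ n] with ω h1 h2 h3
  set κ := condDistrib (fun ω (i : Fin n) => ε i ω) (fun ω (i : Fin n) => X i ω) μ
    (fun i => X i ω) with hκ
  set v : Fin n → Sph q := fun i => X i ω with hv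
  have hGv : ∀ c, Measurable (G c v) := fun c => (hG c).comp measurable_prodMk_left
  have hmean : ∀ c, ∫ e, G c v e ∂κ = (∑ i, a v i * m (v i)) - c := by
    intro c
    have hi : ∀ i ∈ Finset.univ, Integrable (fun e : Fin n → ℝ => a v i * (m (v i) + σ (v i) * e i)) κ :=
      fun i _ => ((integrable_const _).add ((h3 i i).1.1.const_mul _)).const_mul _
    rw [integral_sub (integrable_finsetSum _ hi) (integrable_const _), integral_finsetSum _ hi,
      integral_const, probReal_univ, one_smul]
    congr 1
    refine Finset.sum_congr rfl fun i _ => ?_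
    rw [integral_const_mul, integral_add (integrable_const _) ((h3 i i).1.1.const_mul _),
      integral_const_mul, (h3 i i).1.2, integral_const, probReal_univ, one_smul, mul_zero, add_zero]
  have hmean' : ∀ c, ∫ z, z ∂(κ.map (G c v)) = (∑ i, a v i * m (v i)) - c := fun c =>
    (integral_map (hGv c).aemeasurable (f := fun z : ℝ => z) aestronglyMeasurable_id).trans
      (hmean c)
  constructor
  · simp_rw [condMean, hGc]
    rw [h1, hmean']
  · have hG0 : (fun ω => ∑ i : Fin n, a (fun i => X i ω) i * Y i ω) =
        fun ω => G 0 (fun i => X i ω) (fun i => ε i ω) := by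
      ext ω
      rw [← hGc, sub_zero]
    rw [condVariance, hG0, h2, variance_eq_integral aemeasurable_id', hmean',
      integral_map (hGv 0).aemeasurable (by fun_prop)]
    have hexp : ∀ e, (G 0 v e - (∑ i, a v i * m (v i) - 0)) ^ 2 =
        ∑ i, ∑ j, (a v i * σ (v i)) * (a v j * σ (v j)) * (e i * e j) := by
      intro e
      have : G 0 v e - (∑ i, a v i * m (v i) - 0) = ∑ i, a v i * σ (v i) * e i := by
        simp only [hGdef, sub_zero]
        rw [← Finset.sum_sub_distrib]
        exact Finset.sum_congr rfl fun i _ => by ring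
      rw [this, sq, Finset.sum_mul_sum]
      exact Finset.sum_congr rfl fun i _ => Finset.sum_congr rfl fun j _ => by ring
    simp_rw [hexp]
    rw [integral_finsetSum _ fun i _ => integrable_finsetSum _ fun j _ =>
      (h3 i j).2.1.const_mul _]
    refine Finset.sum_congr rfl fun i _ => ?_
    rw [integral_finsetSum _ fun j _ => (h3 i j).2.1.const_mul _]
    simp_rw [integral_const_mul, fun j => (h3 i j).2.2]
    simp
    ring

end Sample

/-! ### Kernel averages over the sample -/

theorem exists_bound_rawKernel {q : ℕ} {L : ℝ → ℝ} (hL : IsDirectionalKernel L) (h : ℝ)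
    (x : Sph q) : ∃ C : ℝ, 0 ≤ C ∧ ∀ y, |rawKernel L h x y| ≤ C := by
  obtain ⟨C, hC⟩ := (isCompact_range (continuous_rawKernel hL h x).norm).bddAbove
  exact ⟨max C 0, le_max_right _ _, fun y => (hC (mem_range_self y)).trans (le_max_left _ _)⟩

section Averages

variable {q : ℕ} {Ω : Type*} [MeasurableSpace Ω] {μ : Measure Ω}
  {f m σ : Sph q → ℝ} {X : ℕ → Ω → Sph q} {Y ε : ℕ → Ω → ℝ}

theorem IsRegressionSample.integral_comp (hs : IsRegressionSample μ f m σ X Y ε)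
    (hf : Measurable f) (hf0 : ∀ y, 0 ≤ f y) {ψ : Sph q → ℝ} (hψ : Measurable ψ) (j : ℕ) :
    ∫ ω, ψ (X j ω) ∂μ = ∫ y, ψ y * f y ∂surf q := by
  have h1 : μ.map (X j) = μ.map (X 0) := ((hs.identDistrib j).comp measurable_fst).map_eq
  rw [← integral_map (hs.measurable_X j).aemeasurable hψ.aestronglyMeasurable, h1, hs.density,
    integral_withDensity_eq_integral_toReal_smul (by fun_prop) (by simp)]
  refine integral_congr_ae (Eventually.of_forall fun y => ?_)
  simp only [smul_eq_mul, ENNReal.toReal_ofReal (hf0 y)]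
  ring

variable [IsProbabilityMeasure μ]

theorem memLp_comp_of_bound {X : Ω → Sph q} (hX : Measurable X) {ψ : Sph q → ℝ}
    (hψ : Measurable ψ) {C : ℝ} (hC : ∀ y, |ψ y| ≤ C) : MemLp (fun ω => ψ (X ω)) 2 μ :=
  MemLp.of_bound (hψ.comp hX).aestronglyMeasurable C (Eventually.of_forall fun ω => hC (X ω))

theorem IsRegressionSample.memLp_sum (hs : IsRegressionSample μ f m σ X Y ε) (n : ℕ) (c : ℝ)
    {ψ : Sph q → ℝ} (hψ : Measurable ψ) {C : ℝ} (hC : ∀ y, |ψ y| ≤ C) :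
    MemLp (fun ω => c * ∑ j : Fin n, ψ (X j ω)) 2 μ :=
  (memLp_finsetSum _ fun (j : Fin n) _ =>
    memLp_comp_of_bound (hs.measurable_X j) hψ hC).const_mul c

theorem IsRegressionSample.integral_sum (hs : IsRegressionSample μ f m σ X Y ε)
    (hf : Measurable f) (hf0 : ∀ y, 0 ≤ f y) (n : ℕ) (c : ℝ)
    {ψ : Sph q → ℝ} (hψ : Measurable ψ) {C : ℝ} (hC : ∀ y, |ψ y| ≤ C) :
    ∫ ω, c * ∑ j : Fin n, ψ (X j ω) ∂μ = c * n * ∫ y, ψ y * f y ∂surf q := by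
  rw [integral_const_mul, integral_finsetSum _ fun (j : Fin n) _ =>
    (memLp_comp_of_bound (hs.measurable_X j) hψ hC).integrable (by norm_num)]
  simp_rw [fun j : Fin n => hs.integral_comp hf hf0 hψ j]
  simp
  ring

theorem IsRegressionSample.variance_sum_le (hs : IsRegressionSample μ f m σ X Y ε)
    (hf : Measurable f) (hf0 : ∀ y, 0 ≤ f y) (n : ℕ) (c : ℝ)
    {ψ : Sph q → ℝ} (hψ : Measurable ψ) {C : ℝ} (hC : ∀ y, |ψ y| ≤ C) :
    variance (fun ω => c * ∑ j : Fin n, ψ (X j ω)) μ ≤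
      c ^ 2 * n * ∫ y, ψ y ^ 2 * f y ∂surf q := by
  have hL2 : ∀ j : Fin n, MemLp (fun ω => ψ (X j ω)) 2 μ := fun j =>
    memLp_comp_of_bound (hs.measurable_X j) hψ hC
  have hsum : variance (fun ω => ∑ j : Fin n, ψ (X j ω)) μ =
      ∑ j : Fin n, variance (fun ω => ψ (X j ω)) μ := by
    have h1 := IndepFun.variance_sum (μ := μ) (s := Finset.univ)
      (X := fun (j : Fin n) ω => ψ (X j ω)) (fun j _ => hL2 j) (fun i _ j _ hij =>
        (hs.indep.indepFun (i := i) (j := j) (fun h => hij (Fin.ext h))).comp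
          (hψ.comp measurable_fst) (hψ.comp measurable_fst))
    rw [← h1]
    congr 1
    ext ω
    simp
  rw [variance_const_mul, hsum, mul_assoc]
  refine mul_le_mul_of_nonneg_left ?_ (sq_nonneg c)
  calc ∑ j : Fin n, variance (fun ω => ψ (X j ω)) μ
      ≤ ∑ _j : Fin n, ∫ y, ψ y ^ 2 * f y ∂surf q := by
        refine Finset.sum_le_sum fun j _ => ?_
        refine (variance_le_expectation_sq (hL2 j).1).trans (le_of_eq ?_)
        rw [← hs.integral_comp hf hf0 (hψ.pow_const 2) j]
        rfl
    _ = _ := by simp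

/-- The weighted sum `∑ j, L ((1 - xᵀ X_j) / h²) φ (X_j)` divided by `n h^q`. -/
def kernelAvg (L : ℝ → ℝ) (X : ℕ → Ω → Sph q) (n : ℕ) (h : ℝ) (x : Sph q) (φ : Sph q → ℝ)
    (ω : Ω) : ℝ :=
  ((n : ℝ) * h ^ q)⁻¹ * ∑ j : Fin n, rawKernel L h x (X j ω) * φ (X j ω)

variable {ι : Type*} {l : Filter ι} {h : ι → ℝ} {x : ι → Sph q}
  {β : ι → Fin q → Amb q} {x₀ : Sph q} {β₀ : Fin q → Amb q} {L : ℝ → ℝ}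

/-- The weak law of large numbers for kernel averages. -/
theorem Localized.tendsto_kernelAvg [l.IsCountablyGenerated] (H : Localized l h x β x₀ β₀)
    (hs : IsRegressionSample μ f m σ X Y ε) (hf : Continuous f) (hf0 : ∀ y, 0 ≤ f y)
    (hL : IsDirectionalKernel L) {N : ι → ℕ}
    (hN : Tendsto (fun i => (N i : ℝ) * h i ^ q) l atTop)
    {φ : ι → Sph q → ℝ} {Φ : Tan q → ℝ} (hφ : LocalLimit l h x β φ Φ) :
    Tendsto (fun z : ι × Ω => kernelAvg L X (N z.1) (h z.1) (x z.1) (φ z.1) z.2) (probFilter μ l)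
      (𝓝 (f x₀ * ∫ v : Tan q, L (‖v‖ ^ 2 / 2) * Φ v)) := by
  have hfL := H.localLimit_continuous hf
  have hψm : ∀ i, Measurable fun y => rawKernel L (h i) (x i) y * φ i y := fun i =>
    (continuous_rawKernel hL _ _).measurable.mul (hφ.measurable i)
  have hb : ∀ᶠ i in l, ∃ C : ℝ, ∀ y, |rawKernel L (h i) (x i) y * φ i y| ≤ C := by
    obtain ⟨C, k, -, hC⟩ := hφ.far
    filter_upwards [hC] with i hi
    obtain ⟨C', hC'0, hC'⟩ := exists_bound_rawKernel hL (h i) (x i)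
    refine ⟨C' * (C * (h i)⁻¹ ^ k), fun y => ?_⟩
    rw [abs_mul]
    exact mul_le_mul (hC' y) (hi y) (abs_nonneg _) hC'0
  have hN0 : ∀ᶠ i in l, (N i : ℝ) ≠ 0 := by
    filter_upwards [hN.eventually_gt_atTop 0] with i hi h0
    rw [h0, zero_mul] at hi
    exact lt_irrefl _ hi
  -- `h1` is the mean of the average, with the density absorbed into the test function. `h2` is a
  -- second moment with kernel `L²`; divided by `n h^q` it bounds the variance.
  have h1 := (hφ.mul hfL).tendsto_integral hL H.h_pos H.h_zero H.frame
  have h2 := ((hφ.mul hφ).mul hfL).tendsto_integral hL.sq H.h_pos H.h_zero H.frame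
  refine tendsto_probFilter_of_variance
    (A := fun i ω => kernelAvg L X (N i) (h i) (x i) (φ i) ω) ?_ ?_ ?_
  · filter_upwards [hb] with i ⟨C, hC⟩
    exact hs.memLp_sum _ _ (hψm i) hC
  · have h3 : ∫ v : Tan q, L (‖v‖ ^ 2 / 2) * (Φ v * f x₀) =
        f x₀ * ∫ v : Tan q, L (‖v‖ ^ 2 / 2) * Φ v := by
      rw [← integral_const_mul]
      congr 1
      ext v
      ring
    rw [h3] at h1
    refine h1.congr' ?_
    filter_upwards [hb, hN0] with i ⟨C, hC⟩ hi
    have h4 := hs.integral_sum hf.measurable hf0 (N i) ((N i : ℝ) * h i ^ q)⁻¹ (hψm i) hC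
    have hh := (H.h_pos i).ne'
    unfold kernelAvg
    rw [h4]
    simp_rw [fun y => mul_assoc (rawKernel L (h i) (x i) y) (φ i y) (f y)]
    congr 1
    field_simp
  · have h3 := (tendsto_inv_atTop_zero.comp hN).mul h2
    rw [zero_mul] at h3
    refine tendsto_of_tendsto_of_tendsto_of_le_of_le' tendsto_const_nhds h3
      (Eventually.of_forall fun i => variance_nonneg _ _) ?_
    filter_upwards [hb, hN0] with i ⟨C, hC⟩ hi
    refine (hs.variance_sum_le hf.measurable hf0 (N i) ((N i : ℝ) * h i ^ q)⁻¹ (hψm i) hC).trans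
      (le_of_eq ?_)
    have hh := (H.h_pos i).ne'
    have h5 : ∀ y, (rawKernel L (h i) (x i) y * φ i y) ^ 2 * f y =
        rawKernel (fun r => L r ^ 2) (h i) (x i) y * (φ i y * φ i y * f y) := by
      intro y
      simp only [rawKernel]
      ring
    simp_rw [h5]
    rw [Function.comp_apply, ← mul_assoc]
    congr 1
    field_simp

end Averages

/-! ### Weighted least squares -/

section WLS

variable {n d : ℕ}

/-- The weights of the responses in the weighted least squares intercept. -/
def wlsWeight (D : Matrix (Fin n) (Fin (d + 1)) ℝ) (w : Fin n → ℝ) (j : Fin n) : ℝ :=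
  ((D.transpose * Matrix.diagonal w * D)⁻¹ * (D.transpose * Matrix.diagonal w)) 0 j

theorem wlsIntercept_eq_sum (D : Matrix (Fin n) (Fin (d + 1)) ℝ) (w y : Fin n → ℝ) :
    wlsIntercept D w y = ∑ j, wlsWeight D w j * y j := by
  rw [wlsIntercept, Matrix.mulVec_mulVec]
  rfl

/-- The weights of the intercept in terms of a rescaled design `Z`, rescaled weights `K` and the
normalized Gram matrix `G`. -/
theorem wlsWeight_eq {D Z : Matrix (Fin n) (Fin (d + 1)) ℝ} {w K : Fin n → ℝ}
    {S : Fin (d + 1) → ℝ} (hS : ∀ a, S a ≠ 0) (hS0 : S 0 = 1) (hD : ∀ j a, D j a = Z j a * S a)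
    {c s : ℝ} (hc : c ≠ 0) (hs : s ≠ 0) (hw : ∀ j, w j = c * K j)
    {G : Matrix (Fin (d + 1)) (Fin (d + 1)) ℝ}
    (hG : ∀ a b, G a b = s * ∑ j, K j * (Z j a * Z j b)) (hdet : G.det ≠ 0) (j : Fin n) :
    wlsWeight D w j = s * K j * ∑ a, G⁻¹ 0 a * Z j a := by
  have hDm : D = Z * Matrix.diagonal S := by
    ext j a
    rw [Matrix.mul_diagonal, hD]
  have hWm : Matrix.diagonal w = c • Matrix.diagonal K := by
    rw [← Matrix.diagonal_smul]
    congr 1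
    ext j
    simp [hw]
  have hGm : G = s • (Z.transpose * Matrix.diagonal K * Z) := by
    ext a b
    rw [hG, Matrix.smul_apply, Matrix.mul_apply, smul_eq_mul]
    congr 1
    refine Finset.sum_congr rfl fun j _ => ?_
    rw [Matrix.mul_diagonal, Matrix.transpose_apply]
    ring
  have hGu : IsUnit G.det := isUnit_iff_ne_zero.2 hdet
  have hA : D.transpose * Matrix.diagonal w * D =
      (c * s⁻¹) • (Matrix.diagonal S * G * Matrix.diagonal S) := by
    rw [hDm, hWm, hGm, Matrix.transpose_mul, Matrix.diagonal_transpose]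
    simp only [Matrix.mul_smul, Matrix.smul_mul, smul_smul, Matrix.mul_assoc]
    rw [mul_assoc, inv_mul_cancel₀ hs, mul_one]
  have hSS : Matrix.diagonal S * Matrix.diagonal (fun a => (S a)⁻¹) = 1 := by
    rw [Matrix.diagonal_mul_diagonal, ← Matrix.diagonal_one]
    congr 1
    ext a
    exact mul_inv_cancel₀ (hS a)
  have hAinv : (D.transpose * Matrix.diagonal w * D)⁻¹ =
      (c⁻¹ * s) • (Matrix.diagonal (fun a => (S a)⁻¹) * G⁻¹ *
        Matrix.diagonal (fun a => (S a)⁻¹)) := by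
    refine Matrix.inv_eq_right_inv ?_
    rw [hA, Matrix.smul_mul, Matrix.mul_smul, smul_smul]
    have h1 : Matrix.diagonal S * G * Matrix.diagonal S *
        (Matrix.diagonal (fun a => (S a)⁻¹) * G⁻¹ * Matrix.diagonal (fun a => (S a)⁻¹)) = 1 := by
      calc _ = Matrix.diagonal S * G * (Matrix.diagonal S *
            Matrix.diagonal (fun a => (S a)⁻¹)) * G⁻¹ * Matrix.diagonal (fun a => (S a)⁻¹) := by
            simp only [Matrix.mul_assoc]
        _ = Matrix.diagonal S * (G * G⁻¹) * Matrix.diagonal (fun a => (S a)⁻¹) := by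
            rw [hSS, Matrix.mul_one]
            simp only [Matrix.mul_assoc]
        _ = 1 := by rw [Matrix.mul_nonsing_inv _ hGu, Matrix.mul_one, hSS]
    rw [h1]
    have h2 : c * s⁻¹ * (c⁻¹ * s) = 1 := by field_simp
    rw [h2, one_smul]
  -- Each scale `S a` cancels against its column of `D`, the constant `c` cancels against the kernel
  -- weights, and `S 0 = 1` leaves the intercept unscaled.
  rw [wlsWeight, hAinv, Matrix.mul_apply, Finset.mul_sum]
  refine Finset.sum_congr rfl fun a _ => ?_
  rw [Matrix.mul_diagonal, Matrix.transpose_apply, Matrix.smul_apply, Matrix.mul_diagonal,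
    Matrix.diagonal_mul, hD, hw, hS0, smul_eq_mul]
  have := hS a
  field_simp

theorem measurable_det {α ι : Type*} [MeasurableSpace α] [Fintype ι] [DecidableEq ι]
    {A : α → Matrix ι ι ℝ} (hA : ∀ i j, Measurable fun v => A v i j) :
    Measurable fun v => (A v).det := by
  simp_rw [Matrix.det_apply]
  exact Finset.measurable_fun_sum _ fun τ _ =>
    (Finset.measurable_fun_prod _ fun i _ => hA _ _).const_smul _

/-- The formula `det⁻¹ • adjugate` also holds for singular matrices, where both sides are zero, so
no case distinction is needed. -/
theorem measurable_matrix_inv {α ι : Type*} [MeasurableSpace α] [Fintype ι] [DecidableEq ι]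
    {A : α → Matrix ι ι ℝ} (hA : ∀ i j, Measurable fun v => A v i j) (i j : ι) :
    Measurable fun v => (A v)⁻¹ i j := by
  simp_rw [Matrix.inv_def, Matrix.smul_apply, Ring.inverse_eq_inv', Matrix.adjugate_apply]
  refine (measurable_det hA).inv.smul (measurable_det fun k l => ?_)
  simp_rw [Matrix.updateRow_apply]
  split_ifs
  · exact measurable_const
  · exact hA k l

theorem measurable_wlsWeight {α : Type*} [MeasurableSpace α]
    {D : α → Matrix (Fin n) (Fin (d + 1)) ℝ} {w : α → Fin n → ℝ}
    (hD : ∀ j a, Measurable fun v => D v j a) (hw : ∀ j, Measurable fun v => w v j) (j : Fin n) :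
    Measurable fun v => wlsWeight (D v) (w v) j := by
  have h1 : ∀ a k, Measurable fun v => ((D v).transpose * Matrix.diagonal (w v)) a k := by
    intro a k
    simp_rw [Matrix.mul_diagonal, Matrix.transpose_apply]
    exact (hD k a).mul (hw k)
  simp_rw [wlsWeight, Matrix.mul_apply]
  refine Finset.measurable_fun_sum _ fun a _ => (measurable_matrix_inv (fun b b' => ?_) 0 a).mul ?_
  · simp_rw [Matrix.mul_apply (N := D _)]
    exact Finset.measurable_fun_sum _ fun k _ => (h1 b k).mul (hD k b')
  · simpa [Matrix.mul_apply] using h1 a j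

theorem tendsto_matrix_inv_of_diagonal {α ι : Type*} [Fintype ι] [DecidableEq ι] {F : Filter α}
    {A : α → Matrix ι ι ℝ} {D : ι → ℝ} (hD : ∀ i, D i ≠ 0)
    (hA : ∀ i j, Tendsto (fun z => A z i j) F (𝓝 (if i = j then D i else 0))) :
    (∀ᶠ z in F, (A z).det ≠ 0) ∧
      ∀ i j, Tendsto (fun z => (A z)⁻¹ i j) F (𝓝 (if i = j then (D i)⁻¹ else 0)) := by
  have hA' : Tendsto A F (𝓝 (Matrix.diagonal D)) :=
    tendsto_pi_nhds.2 fun i => tendsto_pi_nhds.2 fun j => by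
      simpa [Matrix.diagonal_apply] using hA i j
  have hdet : Tendsto (fun z => (A z).det) F (𝓝 (Matrix.diagonal D).det) :=
    (continuous_id.matrix_det.tendsto _).comp hA'
  have hdet0 : (Matrix.diagonal D).det ≠ 0 := by
    rw [Matrix.det_diagonal]
    exact Finset.prod_ne_zero_iff.2 fun i _ => hD i
  have hadj : Tendsto (fun z => (A z).adjugate) F (𝓝 (Matrix.diagonal D).adjugate) :=
    (continuous_id.matrix_adjugate.tendsto _).comp hA'
  have hinv : (Matrix.diagonal D)⁻¹ = Matrix.diagonal fun i => (D i)⁻¹ := by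
    refine Matrix.inv_eq_right_inv ?_
    rw [Matrix.diagonal_mul_diagonal, ← Matrix.diagonal_one]
    congr 1
    ext i
    exact mul_inv_cancel₀ (hD i)
  refine ⟨hdet.eventually_ne hdet0, fun i j => ?_⟩
  have h1 := (hdet.inv₀ hdet0).mul ((tendsto_pi_nhds.1 (tendsto_pi_nhds.1 hadj i)) j)
  have h2 : ∀ B : Matrix ι ι ℝ, B⁻¹ i j = B.det⁻¹ * B.adjugate i j := by
    intro B
    rw [Matrix.inv_def, Matrix.smul_apply, Ring.inverse_eq_inv', smul_eq_mul]
  rw [← h2, hinv, Matrix.diagonal_apply] at h1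
  simpa only [h2] using h1

end WLS

/-! ### Local regression weights -/

section LocalWeights

variable {q d : ℕ} {Ω : Type*} {X : ℕ → Ω → Sph q} {L : ℝ → ℝ}

/-- The Gram matrix of the functions `ζ a` for the kernel average. -/
def gram (L : ℝ → ℝ) (X : ℕ → Ω → Sph q) (n : ℕ) (h : ℝ) (x : Sph q)
    (ζ : Fin (d + 1) → Sph q → ℝ) (ω : Ω) : Matrix (Fin (d + 1)) (Fin (d + 1)) ℝ :=
  Matrix.of fun a b => kernelAvg L X n h x (fun y => ζ a y * ζ b y) ω

/-- The weights of the intercept in the kernel regression on the functions `ζ a`. -/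
def localWeight (L : ℝ → ℝ) (X : ℕ → Ω → Sph q) (n : ℕ) (h : ℝ) (x : Sph q)
    (ζ : Fin (d + 1) → Sph q → ℝ) (ω : Ω) (j : Fin n) : ℝ :=
  ((n : ℝ) * h ^ q)⁻¹ * rawKernel L h x (X j ω) *
    ∑ a, (gram L X n h x ζ ω)⁻¹ 0 a * ζ a (X j ω)

theorem sum_localWeight_mul (n : ℕ) (h : ℝ) (x : Sph q) (ζ : Fin (d + 1) → Sph q → ℝ) (ω : Ω)
    (φ : Sph q → ℝ) :
    ∑ j, localWeight L X n h x ζ ω j * φ (X j ω) =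
      ∑ a, (gram L X n h x ζ ω)⁻¹ 0 a * kernelAvg L X n h x (fun y => ζ a y * φ y) ω := by
  simp_rw [localWeight, kernelAvg, Finset.mul_sum, Finset.sum_mul]
  rw [Finset.sum_comm]
  refine Finset.sum_congr rfl fun a _ => Finset.sum_congr rfl fun j _ => ?_
  ring

/-- Squaring the weights squares the kernel, and the factor `n h^q` restores the normalization: the
variance becomes a combination of kernel averages for `L²`. -/
theorem sum_localWeight_sq_mul (n : ℕ) (h : ℝ) (x : Sph q)
    (ζ : Fin (d + 1) → Sph q → ℝ) (ω : Ω) (s : Sph q → ℝ) :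
    (n : ℝ) * h ^ q * ∑ j, localWeight L X n h x ζ ω j ^ 2 * s (X j ω) =
      ∑ a, ∑ b, (gram L X n h x ζ ω)⁻¹ 0 a * (gram L X n h x ζ ω)⁻¹ 0 b *
        kernelAvg (fun r => L r ^ 2) X n h x (fun y => ζ a y * ζ b y * s y) ω := by
  have h1 : ∀ j : Fin n, (n : ℝ) * h ^ q * (localWeight L X n h x ζ ω j ^ 2 * s (X j ω)) =
      ∑ a, ∑ b, (gram L X n h x ζ ω)⁻¹ 0 a * (gram L X n h x ζ ω)⁻¹ 0 b *
        (((n : ℝ) * h ^ q)⁻¹ * (rawKernel (fun r => L r ^ 2) h x (X j ω) *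
          (ζ a (X j ω) * ζ b (X j ω) * s (X j ω)))) := by
    intro j
    have h2 : rawKernel (fun r => L r ^ 2) h x (X j ω) = rawKernel L h x (X j ω) ^ 2 := rfl
    have h3 : (n : ℝ) * h ^ q * (localWeight L X n h x ζ ω j ^ 2 * s (X j ω)) =
        ((∑ a, (gram L X n h x ζ ω)⁻¹ 0 a * ζ a (X j ω)) *
          ∑ b, (gram L X n h x ζ ω)⁻¹ 0 b * ζ b (X j ω)) *
          (((n : ℝ) * h ^ q)⁻¹ * rawKernel L h x (X j ω) ^ 2 * s (X j ω)) := by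
      rw [localWeight]
      field_simp
    rw [h2, h3, Finset.sum_mul_sum, Finset.sum_mul]
    refine Finset.sum_congr rfl fun a _ => ?_
    rw [Finset.sum_mul]
    refine Finset.sum_congr rfl fun b _ => ?_
    ring
  rw [Finset.mul_sum, Finset.sum_congr rfl fun j _ => h1 j, Finset.sum_comm]
  refine Finset.sum_congr rfl fun a _ => ?_
  rw [Finset.sum_comm]
  refine Finset.sum_congr rfl fun b _ => ?_
  rw [kernelAvg, Finset.mul_sum, Finset.mul_sum]

/-- The weights reproduce the regression functions at the base point. -/
theorem sum_localWeight_mul_self {n : ℕ} {h : ℝ} {x : Sph q} {ζ : Fin (d + 1) → Sph q → ℝ} {ω : Ω}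
    (hdet : (gram L X n h x ζ ω).det ≠ 0) (b : Fin (d + 1)) :
    ∑ j, localWeight L X n h x ζ ω j * ζ b (X j ω) = if b = 0 then 1 else 0 := by
  rw [sum_localWeight_mul]
  have h1 := congrFun (congrFun
    (Matrix.nonsing_inv_mul _ (isUnit_iff_ne_zero.2 hdet)) 0) b
  rw [Matrix.mul_apply, Matrix.one_apply] at h1
  simp_rw [eq_comm (a := b)]
  exact h1

end LocalWeights

/-! ### Limits of the regression weights for locally orthogonal designs. -/

section LocalDesign

variable {q d : ℕ} {Ω : Type*} [MeasurableSpace Ω] {μ : Measure Ω}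
  {f m σ : Sph q → ℝ} {X : ℕ → Ω → Sph q} {Y ε : ℕ → Ω → ℝ}
  {ι : Type*} {l : Filter ι} {h : ι → ℝ} {x : ι → Sph q}
  {β : ι → Fin q → Amb q} {x₀ : Sph q} {β₀ : Fin q → Amb q} {L : ℝ → ℝ}
  {ζ : ι → Fin (d + 1) → Sph q → ℝ} {Z : Fin (d + 1) → Tan q → ℝ} {D : Fin (d + 1) → ℝ}

/-- Regression functions with local limits that are orthogonal for the kernel, the first of them
the constant one. -/
structure LocalDesign (L : ℝ → ℝ) (l : Filter ι) (h : ι → ℝ) (x : ι → Sph q)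
    (β : ι → Fin q → Amb q) (ζ : ι → Fin (d + 1) → Sph q → ℝ) (Z : Fin (d + 1) → Tan q → ℝ)
    (D : Fin (d + 1) → ℝ) : Prop where
  limit_zero : ∀ v, Z 0 v = 1
  limit : ∀ a, LocalLimit l h x β (fun i => ζ i a) (Z a)
  orthogonal : ∀ a b, ∫ v : Tan q, L (‖v‖ ^ 2 / 2) * (Z a v * Z b v) = if a = b then D a else 0
  ne_zero : ∀ a, D a ≠ 0

namespace LocalDesign

theorem diag_zero (hD : LocalDesign L l h x β ζ Z D) (hq : 1 ≤ q) : D 0 = lambdaLim q L := by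
  have h1 := hD.orthogonal 0 0
  simp only [hD.limit_zero, mul_one, if_true] at h1
  rw [← h1, integral_kernel_norm hq]

variable [IsProbabilityMeasure μ] [l.IsCountablyGenerated]

/-- By orthogonality the Gram matrix tends to the diagonal matrix `f(x₀) D`, so only the entry `0`
of the first row of its inverse survives. Asymptotically both estimators thus weight like the local
constant one, which is why they share their variance. -/
theorem gram_inv (hD : LocalDesign L l h x β ζ Z D) (H : Localized l h x β x₀ β₀)
    (hs : IsRegressionSample μ f m σ X Y ε) (hf : Continuous f) (hf0 : ∀ y, 0 < f y)
    (hL : IsDirectionalKernel L) {N : ι → ℕ}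
    (hN : Tendsto (fun i => (N i : ℝ) * h i ^ q) l atTop) :
    (∀ᶠ z : ι × Ω in probFilter μ l,
      (gram L X (N z.1) (h z.1) (x z.1) (ζ z.1) z.2).det ≠ 0) ∧
    ∀ a, Tendsto (fun z : ι × Ω => (gram L X (N z.1) (h z.1) (x z.1) (ζ z.1) z.2)⁻¹ 0 a)
      (probFilter μ l) (𝓝 (if 0 = a then (f x₀ * D 0)⁻¹ else 0)) := by
  have h1 := tendsto_matrix_inv_of_diagonal (F := probFilter μ l)
    (A := fun z : ι × Ω => gram L X (N z.1) (h z.1) (x z.1) (ζ z.1) z.2)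
    (D := fun a => f x₀ * D a) (fun a => mul_ne_zero (hf0 x₀).ne' (hD.ne_zero a)) (fun a b => by
      have h2 := H.tendsto_kernelAvg hs hf (fun y => (hf0 y).le) hL hN
        ((hD.limit a).mul (hD.limit b))
      rw [hD.orthogonal, mul_ite, mul_zero] at h2
      exact h2)
  exact ⟨h1.1, fun a => h1.2 0 a⟩

theorem tendsto_sum_localWeight (hD : LocalDesign L l h x β ζ Z D) (H : Localized l h x β x₀ β₀)
    (hq : 1 ≤ q)
    (hs : IsRegressionSample μ f m σ X Y ε) (hf : Continuous f) (hf0 : ∀ y, 0 < f y)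
    (hL : IsDirectionalKernel L) {N : ι → ℕ}
    (hN : Tendsto (fun i => (N i : ℝ) * h i ^ q) l atTop)
    {φ : ι → Sph q → ℝ} {Φ : Tan q → ℝ} (hφ : LocalLimit l h x β φ Φ) :
    Tendsto (fun z : ι × Ω => ∑ j, localWeight L X (N z.1) (h z.1) (x z.1) (ζ z.1) z.2 j *
      φ z.1 (X j z.2)) (probFilter μ l)
      (𝓝 ((lambdaLim q L)⁻¹ * ∫ v : Tan q, L (‖v‖ ^ 2 / 2) * Φ v)) := by
  have h1 := (hD.gram_inv H hs hf hf0 hL hN).2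
  simp_rw [sum_localWeight_mul]
  have h2 := tendsto_finsetSum Finset.univ fun a _ => (h1 a).mul
    (H.tendsto_kernelAvg hs hf (fun y => (hf0 y).le) hL hN ((hD.limit a).mul hφ))
  refine h2.trans (le_of_eq ?_)
  congr 1
  simp only [ite_mul, zero_mul, Finset.sum_ite_eq, Finset.mem_univ, if_true, hD.limit_zero,
    one_mul, hD.diag_zero hq]
  have := (hf0 x₀).ne'
  rw [mul_inv]
  field_simp

theorem tendsto_sum_localWeight_sq (hD : LocalDesign L l h x β ζ Z D)
    (H : Localized l h x β x₀ β₀) (hq : 1 ≤ q)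
    (hs : IsRegressionSample μ f m σ X Y ε) (hf : Continuous f) (hf0 : ∀ y, 0 < f y)
    (hL : IsDirectionalKernel L) {N : ι → ℕ}
    (hN : Tendsto (fun i => (N i : ℝ) * h i ^ q) l atTop)
    {s : Sph q → ℝ} (hsc : Continuous s) :
    Tendsto (fun z : ι × Ω => (N z.1 : ℝ) * h z.1 ^ q *
      ∑ j, localWeight L X (N z.1) (h z.1) (x z.1) (ζ z.1) z.2 j ^ 2 * s (X j z.2))
      (probFilter μ l)
      (𝓝 (lambdaLim q (fun r => L r ^ 2) * (lambdaLim q L ^ 2)⁻¹ / f x₀ * s x₀)) := by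
  have h1 := (hD.gram_inv H hs hf hf0 hL hN).2
  have h2 := tendsto_finsetSum Finset.univ fun a _ => tendsto_finsetSum Finset.univ fun b _ =>
    ((h1 a).mul (h1 b)).mul (H.tendsto_kernelAvg hs hf (fun y => (hf0 y).le) hL.sq hN
      (((hD.limit a).mul (hD.limit b)).mul (H.localLimit_continuous hsc)))
  refine (h2.congr fun z => ?_).trans (le_of_eq ?_)
  · rw [sum_localWeight_sq_mul]
  · congr 1
    simp only [ite_mul, mul_ite, zero_mul, mul_zero, Finset.sum_ite_eq, Finset.mem_univ, if_true,
      hD.limit_zero, one_mul, hD.diag_zero hq]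
    rw [integral_mul_const, integral_kernel_norm hq fun r => L r ^ 2]
    have := (hf0 x₀).ne'
    have := (lambdaLim_pos hq hL).ne'
    field_simp

end LocalDesign

theorem integral_kernel_norm_sq_pos (hq : 1 ≤ q) (hL : IsDirectionalKernel L) :
    0 < ∫ v : Tan q, L (‖v‖ ^ 2 / 2) * ‖v‖ ^ 2 := by
  have hint : Integrable fun v : Tan q => L (‖v‖ ^ 2 / 2) * ‖v‖ ^ 2 :=
    integrable_kernel_norm_mul hL (by fun_prop) (C := 1) (k := 2) fun v => by
      rw [abs_of_nonneg (by positivity), one_mul]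
      exact pow_le_pow_left₀ (norm_nonneg _) (by simp) 2
  have hc : Continuous fun v : Tan q => L (‖v‖ ^ 2 / 2) * ‖v‖ ^ 2 :=
    (continuous_kernel_norm hL).mul (by fun_prop)
  rw [integral_pos_iff_support_of_nonneg
    (fun v => mul_nonneg (hL.nonneg _ (by positivity)) (by positivity)) hint]
  refine hc.isOpen_support.measure_pos _ ?_
  obtain ⟨r, hr, hLr⟩ := exists_kernel_pos hL
  refine ⟨EuclideanSpace.single ⟨0, hq⟩ (√(2 * r)), ?_⟩
  rw [Function.mem_support, PiLp.norm_single, Real.norm_of_nonneg (Real.sqrt_nonneg _),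
    Real.sq_sqrt (by positivity), mul_div_cancel_left₀ _ two_ne_zero]
  positivity

theorem Localized.localDesign_const (H : Localized l h x β x₀ β₀) (hq : 1 ≤ q)
    (hL : IsDirectionalKernel L) :
    LocalDesign (d := 0) L l h x β (fun _ _ _ => 1) (fun _ _ => 1) (fun _ => lambdaLim q L) where
  limit_zero _ := rfl
  limit _ := H.localLimit_continuous (a := fun _ => 1) continuous_const
  orthogonal a b := by
    rw [if_pos (Subsingleton.elim (α := Fin 1) a b), ← integral_kernel_norm hq]
    simp
  ne_zero _ := (lambdaLim_pos hq hL).ne'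

/-- The regression functions of the local linear estimator. -/
def linDesign (h : ℝ) (x : Sph q) (β : Fin q → Amb q) : Fin (q + 1) → Sph q → ℝ :=
  Fin.cons (fun _ => 1) fun k y => inner ℝ ((y : Amb q) - x) (β k) / h

/-- Orthogonality comes from the symmetry of the limiting kernel: first moments vanish under `v ↦
-v`, mixed second moments under a single sign change. -/
theorem Localized.localDesign_lin (H : Localized l h x β x₀ β₀) (hq : 1 ≤ q)
    (hL : IsDirectionalKernel L) :
    LocalDesign L l h x β (fun i => linDesign (h i) (x i) (β i))
      (Fin.cons (fun _ => 1) fun k v => v k)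
      (Fin.cons (lambdaLim q L) fun _ => (∫ v : Tan q, L (‖v‖ ^ 2 / 2) * ‖v‖ ^ 2) / q) where
  limit_zero _ := rfl
  limit a := by
    induction a using Fin.cases with
    | zero => exact H.localLimit_continuous (a := fun _ => 1) continuous_const
    | succ k => exact H.localLimit_coord k
  orthogonal a b := by
    have hodd : ∀ k : Fin q, ∫ v : Tan q, L (‖v‖ ^ 2 / 2) * v k = 0 := by
      intro k
      have h1 := integral_neg_eq_self (fun v : Tan q => L (‖v‖ ^ 2 / 2) * v k) volume
      simp only [norm_neg, PiLp.neg_apply, mul_neg, integral_neg] at h1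
      linarith
    induction a using Fin.cases with
    | zero =>
      induction b using Fin.cases with
      | zero => simp [integral_kernel_norm hq]
      | succ k => simpa [(Fin.succ_ne_zero k).symm] using hodd k
    | succ j =>
      induction b using Fin.cases with
      | zero => simpa using hodd j
      | succ k => simpa using integral_kernel_coord_mul hL j k
  ne_zero a := by
    induction a using Fin.cases with
    | zero => exact (lambdaLim_pos hq hL).ne'
    | succ k =>
      have := integral_kernel_norm_sq_pos hq hL
      have hq' : (0 : ℝ) < q := by exact_mod_cast hq
      simp only [Fin.cons_succ]
      positivity

end LocalDesign

/-! ### Bias of the local estimators -/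

/-- The linear part of the first order expansion of `g` at `x`. -/
def linearPart {q : ℕ} (g : Sph q → ℝ) (x y : Sph q) : ℝ :=
  fderiv ℝ (radialExt g) (x : Amb q) ((y : Amb q) - x)

/-- The integral of `L_h(x, ·) φ f` before normalization of the kernel. -/
def kernelMean {q : ℕ} (L : ℝ → ℝ) (f : Sph q → ℝ) (h : ℝ) (x : Sph q) (φ : Sph q → ℝ) : ℝ :=
  (h ^ q)⁻¹ * ∫ y, rawKernel L h x y * (φ y * f y) ∂surf q

section Frame

variable {q : ℕ} {x : Sph q} {β : Fin q → Amb q} {g : Sph q → ℝ} {L : ℝ → ℝ}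

theorem IsFrameAt.linearPart_gnomonic (h : IsFrameAt x β)
    (hg : ContDiffOn ℝ 2 (radialExt g) {0}ᶜ) (u : Tan q) :
    linearPart g x (gnomonic x β u) =
      (√(1 + ‖u‖ ^ 2))⁻¹ * fderiv ℝ (radialExt g) (x : Amb q) (frameMap β u) := by
  rw [linearPart, h.coe_gnomonic]
  simp only [map_sub, map_smul, map_add, smul_eq_mul,
    fderiv_radialExt_self hg (coe_sph_ne_zero x)]
  ring

theorem IsFrameAt.linearPart_eq_sum (h : IsFrameAt x β)
    (hg : ContDiffOn ℝ 2 (radialExt g) {0}ᶜ) (y : Sph q) :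
    linearPart g x y = ∑ k, fderiv ℝ (radialExt g) (x : Amb q) (β k) *
      inner ℝ ((y : Amb q) - x) (β k) := by
  rw [linearPart]
  conv_lhs => rw [← h.basis.sum_repr' ((y : Amb q) - x)]
  rw [map_sum, Fin.sum_univ_succ]
  simp only [map_smul, h.coe_basis, Fin.cons_zero, Fin.cons_succ, smul_eq_mul,
    fderiv_radialExt_self hg (coe_sph_ne_zero x), mul_zero, zero_add]
  exact Finset.sum_congr rfl fun k _ => by rw [mul_comm, real_inner_comm]

theorem abs_linearPart_le (g : Sph q → ℝ) (x y : Sph q) :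
    |linearPart g x y| ≤ 2 * ‖fderiv ℝ (radialExt g) (x : Amb q)‖ := by
  rw [linearPart, ← Real.norm_eq_abs]
  refine (ContinuousLinearMap.le_opNorm _ _).trans ?_
  have h2 : ‖(y : Amb q) - x‖ ≤ 2 := by
    refine (norm_sub_le _ _).trans ?_
    rw [norm_coe_sph, norm_coe_sph]
    norm_num
  rw [mul_comm]
  gcongr

theorem measurable_linearPart (g : Sph q → ℝ) (x : Sph q) : Measurable (linearPart g x) := by
  unfold linearPart
  fun_prop

theorem integral_kernel_frameMap (hq : 1 ≤ q) (hL : IsDirectionalKernel L)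
    (β : Fin q → Amb q) (A : Amb q →L[ℝ] Amb q →L[ℝ] ℝ) :
    ∫ v : Tan q, L (‖v‖ ^ 2 / 2) * A (frameMap β v) (frameMap β v) =
      2 * bConst q L * lambdaLim q L / q * ∑ k, A (β k) (β k) := by
  rw [← integral_kernel_bilin hq hL fun i j => A (β i) (β j)]
  congr 1
  ext v
  rw [frameMap_apply]
  simp only [map_sum, map_smul, _root_.sum_apply, _root_.smul_apply, smul_eq_mul]
  rw [Finset.sum_comm]
  congr 1
  refine Finset.sum_congr rfl fun i _ => ?_
  rw [Finset.mul_sum]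
  refine Finset.sum_congr rfl fun j _ => ?_
  ring

theorem integral_kernel_frameMap_mul (hq : 1 ≤ q) (hL : IsDirectionalKernel L)
    (β : Fin q → Amb q) (A B : Amb q →L[ℝ] ℝ) :
    ∫ v : Tan q, L (‖v‖ ^ 2 / 2) * (A (frameMap β v) * B (frameMap β v)) =
      2 * bConst q L * lambdaLim q L / q * ∑ k, A (β k) * B (β k) := by
  have := integral_kernel_frameMap hq hL β (A.smulRight B)
  simpa using this

end Frame

section LocalWeights

variable {q d : ℕ} {Ω : Type*} {m : Sph q → ℝ} {X : ℕ → Ω → Sph q} {L : ℝ → ℝ}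

/-- The weights sum to one, so `m x` can be brought under the sum. -/
theorem sum_localWeight_sub {n : ℕ} {h : ℝ} {x : Sph q}
    {ζ : Fin (d + 1) → Sph q → ℝ} {ω : Ω}
    (hdet : (gram L X n h x ζ ω).det ≠ 0) (hζ : ∀ y, ζ 0 y = 1) (m : Sph q → ℝ) :
    (∑ j, localWeight L X n h x ζ ω j * m (X j ω)) - m x =
      (∑ j, localWeight L X n h x ζ ω j * Localized.remainder m x (X j ω)) +
        ∑ j, localWeight L X n h x ζ ω j * linearPart m x (X j ω) := by
  have h1 := sum_localWeight_mul_self hdet 0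
  simp only [hζ, mul_one, if_true] at h1
  have h2 : m x = ∑ j, localWeight L X n h x ζ ω j * m x := by
    rw [← Finset.sum_mul, h1, one_mul]
  conv_lhs => rw [h2]
  rw [← Finset.sum_sub_distrib, ← Finset.sum_add_distrib]
  refine Finset.sum_congr rfl fun j _ => ?_
  rw [Localized.remainder, linearPart]
  ring

/-- The linear part is a combination of the non-constant columns of the design, which the normal
equations annihilate exactly. -/
theorem IsFrameAt.sum_localWeight_linearPart {n : ℕ} {h : ℝ} (hh : h ≠ 0) {x : Sph q}
    {β : Fin q → Amb q} (hβ : IsFrameAt x β) {ω : Ω}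
    (hdet : (gram L X n h x (linDesign h x β) ω).det ≠ 0)
    (hm : ContDiffOn ℝ 2 (radialExt m) {0}ᶜ) :
    ∑ j, localWeight L X n h x (linDesign h x β) ω j * linearPart m x (X j ω) = 0 := by
  have h1 : ∀ k : Fin q, ∑ j, localWeight L X n h x (linDesign h x β) ω j *
      inner ℝ ((X j ω : Amb q) - x) (β k) = 0 := by
    intro k
    have h2 := sum_localWeight_mul_self hdet k.succ
    simp only [linDesign, Fin.cons_succ, Fin.succ_ne_zero, if_false, ← mul_div_assoc] at h2
    rw [← Finset.sum_div, div_eq_zero_iff, or_iff_left hh] at h2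
    exact h2
  simp_rw [hβ.linearPart_eq_sum hm, Finset.mul_sum]
  rw [Finset.sum_comm]
  refine Finset.sum_eq_zero fun k _ => ?_
  rw [← mul_zero (fderiv ℝ (radialExt m) (x : Amb q) (β k)), ← h1 k, Finset.mul_sum]
  exact Finset.sum_congr rfl fun j _ => by ring

/-- The Gram matrix is `1 × 1`, which gives the Nadaraya–Watson ratio. -/
theorem sum_localWeight_const {n : ℕ} {h : ℝ} {x : Sph q} {ω : Ω}
    (hdet : (gram (d := 0) L X n h x (fun _ _ => 1) ω).det ≠ 0) (φ : Sph q → ℝ) :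
    ∑ j, localWeight (d := 0) L X n h x (fun _ _ => 1) ω j * φ (X j ω) =
      (kernelAvg L X n h x (fun _ => 1) ω)⁻¹ * kernelAvg L X n h x φ ω := by
  have h1 := sum_localWeight_mul_self hdet 0
  rw [if_pos rfl, sum_localWeight_mul n h x _ ω fun _ => 1] at h1
  rw [sum_localWeight_mul]
  simp only [Nat.reduceAdd, Finset.univ_unique, Finset.sum_singleton, Fin.default_eq_zero,
    one_mul] at h1 ⊢
  rw [eq_inv_of_mul_eq_one_left h1]

end LocalWeights

/-! ### Limits of the conditional bias. -/

section Localized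

variable {q d : ℕ} {Ω : Type*} [MeasurableSpace Ω] {μ : Measure Ω}
  {f g m σ : Sph q → ℝ} {X : ℕ → Ω → Sph q} {Y ε : ℕ → Ω → ℝ}
  {ι : Type*} {l : Filter ι} {h : ι → ℝ} {x : ι → Sph q}
  {β : ι → Fin q → Amb q} {x₀ : Sph q} {β₀ : Fin q → Amb q} {L : ℝ → ℝ}
  {ζ : ι → Fin (d + 1) → Sph q → ℝ} {Z : Fin (d + 1) → Tan q → ℝ} {D : Fin (d + 1) → ℝ}

theorem Localized.localLimit_linearPart (H : Localized l h x β x₀ β₀)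
    (hg : ContDiffOn ℝ 2 (radialExt g) {0}ᶜ) :
    LocalLimit l h x β (fun i y => linearPart g (x i) y / h i)
      (fun v => fderiv ℝ (radialExt g) (x₀ : Amb q) (frameMap β₀ v)) := by
  obtain ⟨C₁, hC₁0, hC₁⟩ := exists_bound_fderiv hg
  have hT : ∀ i v, linearPart g (x i) (gnomonic (x i) (β i) (h i • v)) / h i =
      (√(1 + ‖h i • v‖ ^ 2))⁻¹ * fderiv ℝ (radialExt g) (x i : Amb q) (frameMap (β i) v) := by
    intro i v
    have := (H.h_pos i).ne'
    rw [(H.frame i).linearPart_gnomonic hg, map_smul, map_smul, smul_eq_mul]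
    field_simp
  refine ⟨fun i => (measurable_linearPart g (x i)).div_const _, ?_, ?_, ?_⟩
  · refine ⟨2 * C₁, 1, by positivity, Eventually.of_forall fun i y => ?_⟩
    rw [abs_div, abs_of_pos (H.h_pos i), pow_one, div_eq_mul_inv]
    have := inv_pos.2 (H.h_pos i)
    gcongr
    exact (abs_linearPart_le g _ _).trans (by linarith [hC₁ (x i)])
  · refine ⟨C₁, 1, hC₁0, Eventually.of_forall fun i v _ => ?_⟩
    have hs : (√(1 + ‖h i • v‖ ^ 2))⁻¹ ≤ 1 := by
      refine inv_le_one_of_one_le₀ ?_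
      rw [Real.one_le_sqrt]
      nlinarith [sq_nonneg ‖h i • v‖]
    rw [hT, abs_mul, abs_of_pos (by positivity), pow_one]
    refine (mul_le_of_le_one_left (abs_nonneg _) hs).trans ?_
    rw [← Real.norm_eq_abs]
    refine (ContinuousLinearMap.le_opNorm _ _).trans ?_
    rw [(H.frame i).norm_frameMap]
    gcongr
    · exact hC₁ _
    · simp
  · intro v
    simp_rw [hT]
    simpa using ((H.tendsto_sqrt v).inv₀ one_ne_zero).mul (H.tendsto_fderiv hg v)

theorem Localized.tendsto_trace_sphHessian (H : Localized l h x β x₀ β₀)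
    (hg : ContDiffOn ℝ 2 (radialExt g) {0}ᶜ) :
    Tendsto (fun i => (sphHessian g (x i)).trace) l (𝓝 (sphHessian g x₀).trace) := by
  rw [trace_sphHessian hg H.frame₀]
  simp_rw [fun i => trace_sphHessian hg (H.frame i)]
  have h2 : Tendsto (fun i => fderiv ℝ (fderiv ℝ (radialExt g)) (x i : Amb q)) l
      (𝓝 (fderiv ℝ (fderiv ℝ (radialExt g)) (x₀ : Amb q))) :=
    (continuousAt_fderiv_fderiv_radialExt hg (coe_sph_ne_zero x₀)).tendsto.comp H.tendsto_coe
  exact tendsto_finsetSum _ fun j _ =>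
    tendsto_clm_apply (tendsto_clm_apply h2 (H.tendsto_β j)) (H.tendsto_β j)

/-- Localized expansions have their limit at `x₀`, whereas the claim has the bias at the moving
point; continuity bridges the two. -/
theorem Localized.tendsto_biasTerm (H : Localized l h x β x₀ β₀)
    (hf : ContDiffOn ℝ 2 (radialExt f) {0}ᶜ) (hm : ContDiffOn ℝ 2 (radialExt m) {0}ᶜ)
    (hf0 : ∀ y, 0 < f y) (p : Fin 2) :
    Tendsto (fun i => biasTerm f m p (x i)) l (𝓝 (biasTerm f m p x₀)) := by
  have hd : ∀ {g : Sph q → ℝ}, ContDiffOn ℝ 2 (radialExt g) {0}ᶜ → ∀ j,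
      Tendsto (fun i => fderiv ℝ (radialExt g) (x i : Amb q) (β i j)) l
        (𝓝 (fderiv ℝ (radialExt g) (x₀ : Amb q) (β₀ j))) := by
    intro g hg j
    exact tendsto_clm_apply ((continuousAt_fderiv_radialExt hg
      (coe_sph_ne_zero x₀)).tendsto.comp H.tendsto_coe) (H.tendsto_β j)
  have hfc := ((continuous_of_contDiffOn (n := 2) hf).tendsto x₀).comp H.tendsto_x
  fin_cases p
  · simp only [biasTerm]
    rw [inner_sphGrad_sphGrad hf H.frame₀]
    simp_rw [fun i => inner_sphGrad_sphGrad (m := m) hf (H.frame i)]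
    exact (((tendsto_finsetSum _ fun j _ => (hd hf j).mul (hd hm j)).const_mul 2).div hfc
      (hf0 x₀).ne').add (H.tendsto_trace_sphHessian hm)
  · exact H.tendsto_trace_sphHessian hm

/-- Write `f(y) = f(x) + (f(y) - f(x))`. Against the constant, the linear part is odd in the chart
and negligible even after division by `h²`. Against the increment, two slopes multiply, and the
second moments of the kernel turn them into `∇fᵀ∇m`. -/
theorem Localized.tendsto_kernelMean_linearPart [l.IsCountablyGenerated]
    (H : Localized l h x β x₀ β₀) (hq : 1 ≤ q) (hL : IsDirectionalKernel L)
    (hf : ContDiffOn ℝ 2 (radialExt f) {0}ᶜ) (hm : ContDiffOn ℝ 2 (radialExt m) {0}ᶜ) :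
    Tendsto (fun i => kernelMean L f (h i) (x i) (linearPart m (x i)) / h i ^ 2) l
      (𝓝 (2 * bConst q L * lambdaLim q L / q * inner ℝ (sphGrad f x₀) (sphGrad m x₀))) := by
  have hfc := continuous_of_contDiffOn (n := 2) hf
  obtain ⟨C₁, hC₁0, hC₁⟩ := exists_bound_fderiv hm
  have hl := H.localLimit_linearPart hm
  have hlf := hl.mul (H.localLimit_slope hf)
  have h1 := hlf.tendsto_integral hL H.h_pos H.h_zero H.frame
  have hodd_m : ∀ i, Measurable fun y => linearPart m (x i) y / h i ^ 2 := fun i =>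
    (measurable_linearPart m (x i)).div_const _
  have hodd_far : ∃ C : ℝ, ∃ k : ℕ, 0 ≤ C ∧ ∀ᶠ i in l, ∀ y,
      |linearPart m (x i) y / h i ^ 2| ≤ C * (h i)⁻¹ ^ k := by
    refine ⟨2 * C₁, 2, by positivity, Eventually.of_forall fun i y => ?_⟩
    have := inv_pos.2 (pow_pos (H.h_pos i) 2)
    rw [abs_div, abs_of_pos (pow_pos (H.h_pos i) 2), div_eq_mul_inv, inv_pow]
    gcongr
    exact (abs_linearPart_le m _ _).trans (by linarith [hC₁ (x i)])
  have h2 := tendsto_integral_of_odd hL H.h_pos H.h_zero H.frame hodd_m hodd_far fun i u => by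
    rw [(H.frame i).linearPart_gnomonic hm, (H.frame i).linearPart_gnomonic hm, norm_neg,
      map_neg, map_neg]
    ring
  have h3 := h1.add ((((hfc.tendsto x₀).comp H.tendsto_x)).mul h2)
  rw [mul_zero, add_zero, integral_kernel_frameMap_mul hq hL] at h3
  simp_rw [inner_sphGrad_sphGrad hf H.frame₀]
  simp_rw [mul_comm (fderiv ℝ (radialExt m) _ _)] at h3
  refine h3.congr' ?_
  filter_upwards [eventually_integrable_rawKernel_mul (x := x) hL hlf.measurable hlf.far,
    eventually_integrable_rawKernel_mul (x := x) hL hodd_m hodd_far] with i hi hi'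
  have hh := (H.h_pos i).ne'
  rw [kernelMean, mul_div_assoc, Function.comp_apply, mul_left_comm, ← mul_add,
    ← integral_const_mul, ← integral_add hi (hi'.const_mul _), ← integral_div]
  congr 2
  ext y
  field_simp
  ring

theorem LocalDesign.tendsto_sum_remainder [IsProbabilityMeasure μ] [l.IsCountablyGenerated]
    (hD : LocalDesign L l h x β ζ Z D) (H : Localized l h x β x₀ β₀)
    (hq : 1 ≤ q) (hs : IsRegressionSample μ f m σ X Y ε) (hf : Continuous f) (hf0 : ∀ y, 0 < f y)
    (hm : ContDiffOn ℝ 2 (radialExt m) {0}ᶜ)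
    (hL : IsDirectionalKernel L) {N : ι → ℕ}
    (hN : Tendsto (fun i => (N i : ℝ) * h i ^ q) l atTop) :
    Tendsto (fun z : ι × Ω => (∑ j, localWeight L X (N z.1) (h z.1) (x z.1) (ζ z.1) z.2 j *
      Localized.remainder m (x z.1) (X j z.2)) / h z.1 ^ 2) (probFilter μ l)
      (𝓝 (bConst q L / q * (sphHessian m x₀).trace)) := by
  have h1 := hD.tendsto_sum_localWeight H hq hs hf hf0 hL hN (H.localLimit_remainder hm)
  simp_rw [mul_left_comm (L _) (1 / 2 : ℝ)] at h1
  rw [integral_const_mul, integral_kernel_frameMap hq hL, ← trace_sphHessian hm H.frame₀] at h1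
  refine (h1.congr fun z => ?_).trans (le_of_eq ?_)
  · rw [Finset.sum_div]
    exact Finset.sum_congr rfl fun j _ => (mul_div_assoc _ _ _).symm
  · have := (lambdaLim_pos hq hL).ne'
    congr 1
    field_simp

theorem Localized.tendsto_bias_lin [IsProbabilityMeasure μ] [l.IsCountablyGenerated]
    (H : Localized l h x β x₀ β₀)
    (hq : 1 ≤ q) (hs : IsRegressionSample μ f m σ X Y ε) (hf : Continuous f) (hf0 : ∀ y, 0 < f y)
    (hm : ContDiffOn ℝ 2 (radialExt m) {0}ᶜ)
    (hL : IsDirectionalKernel L) {N : ι → ℕ}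
    (hN : Tendsto (fun i => (N i : ℝ) * h i ^ q) l atTop) :
    Tendsto (fun z : ι × Ω => ((∑ j, localWeight L X (N z.1) (h z.1) (x z.1)
      (linDesign (h z.1) (x z.1) (β z.1)) z.2 j * m (X j z.2)) - m (x z.1)) / h z.1 ^ 2)
      (probFilter μ l) (𝓝 (bConst q L / q * biasTerm f m 1 x₀)) := by
  have hD := H.localDesign_lin hq hL
  refine (hD.tendsto_sum_remainder H hq hs hf hf0 hm hL hN).congr' ?_
  filter_upwards [(hD.gram_inv H hs hf hf0 hL hN).1] with z hz
  rw [sum_localWeight_sub hz (fun _ => rfl),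
    (H.frame z.1).sum_localWeight_linearPart (H.h_pos _).ne' hz hm, add_zero]

/-- The ratio for the linear part is split into its expectation, which gives the gradient term, and
a fluctuation. The latter is subtracted here because nothing forces `h/√(n h^q)` to be small
compared with `h²`. -/
theorem Localized.tendsto_bias_const [IsProbabilityMeasure μ] [l.IsCountablyGenerated]
    (H : Localized l h x β x₀ β₀)
    (hq : 1 ≤ q) (hs : IsRegressionSample μ f m σ X Y ε)
    (hf : ContDiffOn ℝ 2 (radialExt f) {0}ᶜ) (hf0 : ∀ y, 0 < f y)
    (hm : ContDiffOn ℝ 2 (radialExt m) {0}ᶜ)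
    (hL : IsDirectionalKernel L) {N : ι → ℕ}
    (hN : Tendsto (fun i => (N i : ℝ) * h i ^ q) l atTop) :
    Tendsto (fun z : ι × Ω => ((∑ j, localWeight (d := 0) L X (N z.1) (h z.1) (x z.1)
      (fun _ _ => 1) z.2 j * m (X j z.2)) - m (x z.1) -
      (kernelAvg L X (N z.1) (h z.1) (x z.1) (fun _ => 1) z.2)⁻¹ *
        (kernelAvg L X (N z.1) (h z.1) (x z.1) (linearPart m (x z.1)) z.2 -
          kernelMean L f (h z.1) (x z.1) (linearPart m (x z.1)))) / h z.1 ^ 2)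
      (probFilter μ l) (𝓝 (bConst q L / q * biasTerm f m 0 x₀)) := by
  have hfc := continuous_of_contDiffOn (n := 2) hf
  have hD := H.localDesign_const hq hL
  have h1 := hD.tendsto_sum_remainder H hq hs hfc hf0 hm hL hN
  have h2 := H.tendsto_kernelAvg hs hfc (fun y => (hf0 y).le) hL hN
    (H.localLimit_continuous (a := fun _ => 1) continuous_const)
  simp only [mul_one, integral_kernel_norm hq] at h2
  have hl := (lambdaLim_pos hq hL).ne'
  have hfx := (hf0 x₀).ne'
  have h3 := (h2.inv₀ (mul_ne_zero hfx hl)).mul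
    ((H.tendsto_kernelMean_linearPart hq hL hf hm).comp (tendsto_fst_probFilter (μ := μ)))
  refine ((h1.add h3).congr' ?_).trans (le_of_eq ?_)
  · filter_upwards [(hD.gram_inv H hs hfc hf0 hL hN).1] with z hz
    rw [sum_localWeight_sub hz (fun _ => rfl), sum_localWeight_const hz (linearPart m (x z.1)),
      Function.comp_apply]
    ring
  · congr 1
    simp only [biasTerm]
    field_simp
    ring

end Localized

/-! ### The stochastic part of the bias of the local constant estimator -/

section LinearPart

variable {q : ℕ} {Ω : Type*} [MeasurableSpace Ω] {μ : Measure Ω} [IsProbabilityMeasure μ]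
  {f m σ : Sph q → ℝ} {X : ℕ → Ω → Sph q} {Y ε : ℕ → Ω → ℝ}
  {ι : Type*} {l : Filter ι} {h : ι → ℝ} {x : ι → Sph q}
  {β : ι → Fin q → Amb q} {x₀ : Sph q} {β₀ : Fin q → Amb q} {L : ℝ → ℝ}

/-- The centred average of the linear part of `m`, relative to the average of the kernel. -/
def linearNoise (L : ℝ → ℝ) (X : ℕ → Ω → Sph q) (f m : Sph q → ℝ) (n : ℕ) (h : ℝ) (x : Sph q)
    (ω : Ω) : ℝ :=
  (kernelAvg L X n h x (fun _ => 1) ω)⁻¹ *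
    (kernelAvg L X n h x (linearPart m x) ω - kernelMean L f h x (linearPart m x))

theorem exists_bound_rawKernel_mul_linearPart (hL : IsDirectionalKernel L) (m : Sph q → ℝ) (h : ℝ)
    (x : Sph q) : ∃ C : ℝ, ∀ y, |rawKernel L h x y * linearPart m x y| ≤ C := by
  obtain ⟨C, hC0, hC⟩ := exists_bound_rawKernel hL h x
  refine ⟨C * (2 * ‖fderiv ℝ (radialExt m) (x : Amb q)‖), fun y => ?_⟩
  rw [abs_mul]
  exact mul_le_mul (hC y) (abs_linearPart_le m x y) (abs_nonneg _) hC0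

/-- Chebyshev. The linear part vanishes at `x`, so it is `h` times a function with a local limit,
and the standard deviation gains a factor `h`. -/
theorem IsRegressionSample.measure_kernelAvg_linearPart_le
    (hs : IsRegressionSample μ f m σ X Y ε) (hf : Measurable f) (hf0 : ∀ y, 0 ≤ f y)
    (hL : IsDirectionalKernel L) {n : ℕ} {h : ℝ} (hh : 0 < h) (hn : 0 < (n : ℝ) * h ^ q)
    (x : Sph q) {a : ℝ} (ha : 0 < a) :
    μ {ω | a * (h / √((n : ℝ) * h ^ q)) ≤
      |kernelAvg L X n h x (linearPart m x) ω - kernelMean L f h x (linearPart m x)|} ≤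
    ENNReal.ofReal (((h ^ q)⁻¹ * ∫ y, rawKernel (fun r => L r ^ 2) h x y *
      (linearPart m x y / h * (linearPart m x y / h) * f y) ∂surf q) / a ^ 2) := by
  obtain ⟨C, hC⟩ := exists_bound_rawKernel_mul_linearPart hL m h x
  have hψ : Measurable fun y => rawKernel L h x y * linearPart m x y :=
    (continuous_rawKernel hL _ _).measurable.mul (measurable_linearPart m x)
  have hn0 : (n : ℝ) ≠ 0 := fun h0 => by simp [h0] at hn
  have hmean : ∫ ω, kernelAvg L X n h x (linearPart m x) ω ∂μ =
      kernelMean L f h x (linearPart m x) := by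
    have h4 := hs.integral_sum hf hf0 n ((n : ℝ) * h ^ q)⁻¹ hψ hC
    unfold kernelAvg
    rw [h4, kernelMean]
    simp_rw [mul_assoc (rawKernel L h x _)]
    congr 1
    field_simp
  have hvar := hs.variance_sum_le hf hf0 n ((n : ℝ) * h ^ q)⁻¹ hψ hC
  have hr : 0 < a * (h / √((n : ℝ) * h ^ q)) := by positivity
  have hch := meas_ge_le_variance_div_sq (hs.memLp_sum n ((n : ℝ) * h ^ q)⁻¹ hψ hC) hr
  rw [← hmean]
  refine hch.trans (ENNReal.ofReal_le_ofReal ?_)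
  have h5 : ∀ y, (rawKernel L h x y * linearPart m x y) ^ 2 * f y = h ^ 2 *
      (rawKernel (fun r => L r ^ 2) h x y *
        (linearPart m x y / h * (linearPart m x y / h) * f y)) := by
    intro y
    simp only [rawKernel]
    field_simp
  simp_rw [h5] at hvar
  rw [integral_const_mul] at hvar
  rw [mul_pow, div_pow, Real.sq_sqrt hn.le, div_le_div_iff₀ (by positivity) (by positivity)]
  calc _ ≤ _ := mul_le_mul_of_nonneg_right hvar (by positivity)
    _ = _ := by
      generalize ∫ y, rawKernel (fun r => L r ^ 2) h x y *
        (linearPart m x y / h * (linearPart m x y / h) * f y) ∂surf q = I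
      field_simp

/-- The constant of an `O_P` is chosen before localizing, so the bound must not depend on `x₀`;
hence the global bounds `F` and `C`. The summand `1` leaves room for convergence. -/
theorem Localized.eventually_linearPart_sq_le [l.IsCountablyGenerated]
    (H : Localized l h x β x₀ β₀) (hL : IsDirectionalKernel L)
    (hf : Continuous f) (hf0 : ∀ y, 0 ≤ f y) (hm : ContDiffOn ℝ 2 (radialExt m) {0}ᶜ)
    {F C : ℝ} (hF : ∀ y, f y ≤ F) (hC : ∀ x : Sph q, ‖fderiv ℝ (radialExt m) (x : Amb q)‖ ≤ C) :
    ∀ᶠ i in l, (h i ^ q)⁻¹ * ∫ y, rawKernel (fun r => L r ^ 2) (h i) (x i) y *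
      (linearPart m (x i) y / h i * (linearPart m (x i) y / h i) * f y) ∂surf q ≤
      F * C ^ 2 * (∫ v : Tan q, L (‖v‖ ^ 2 / 2) ^ 2 * ‖v‖ ^ 2) + 1 := by
  have hl := H.localLimit_linearPart hm
  have h1 := ((hl.mul hl).mul (H.localLimit_continuous hf)).tendsto_integral hL.sq H.h_pos
    H.h_zero H.frame
  refine h1.eventually_le_const (lt_add_of_le_of_pos ?_ one_pos)
  have hv : ∀ v : Tan q, |fderiv ℝ (radialExt m) (x₀ : Amb q) (frameMap β₀ v)| ≤ C * ‖v‖ := by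
    intro v
    rw [← Real.norm_eq_abs]
    refine (ContinuousLinearMap.le_opNorm _ _).trans ?_
    rw [H.frame₀.norm_frameMap]
    gcongr
    exact hC _
  have hF0 : 0 ≤ F := (hf0 x₀).trans (hF x₀)
  have hb : ∀ v : Tan q, fderiv ℝ (radialExt m) (x₀ : Amb q) (frameMap β₀ v) *
      fderiv ℝ (radialExt m) (x₀ : Amb q) (frameMap β₀ v) * f x₀ ≤ F * C ^ 2 * ‖v‖ ^ 2 := by
    intro v
    have h2 : fderiv ℝ (radialExt m) (x₀ : Amb q) (frameMap β₀ v) ^ 2 ≤ (C * ‖v‖) ^ 2 := by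
      rw [← sq_abs]
      exact pow_le_pow_left₀ (abs_nonneg _) (hv v) 2
    rw [← sq]
    calc _ ≤ (C * ‖v‖) ^ 2 * F := mul_le_mul h2 (hF x₀) (hf0 x₀) (sq_nonneg _)
      _ = _ := by ring
  have hsq : ∀ v : Tan q, ‖v‖ ^ 2 ≤ (1 + ‖v‖) ^ 2 := fun v =>
    pow_le_pow_left₀ (norm_nonneg _) (by simp) 2
  rw [← integral_const_mul]
  refine integral_mono (integrable_kernel_norm_mul hL.sq (by fun_prop) (C := F * C ^ 2) (k := 2)
    fun v => ?_) ((integrable_kernel_norm_mul hL.sq (by fun_prop) (C := 1) (k := 2)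
    fun v => ?_).const_mul _) fun v => ?_
  · rw [abs_of_nonneg (mul_nonneg (mul_self_nonneg _) (hf0 x₀))]
    exact (hb v).trans (mul_le_mul_of_nonneg_left (hsq v) (by positivity))
  · rw [abs_of_nonneg (by positivity), one_mul]
    exact hsq v
  · exact (mul_le_mul_of_nonneg_left (hb v) (sq_nonneg _)).trans (le_of_eq (by ring))

/-- The kernel average tends to `f(x₀) λ_q(L) ≥ c λ_q(L)`, so it falls to half of `c λ_q(L)` or
below with probability at most `δ/2`. Otherwise the noise is at most the fluctuation divided by that
half, and Chebyshev costs the other `δ/2`. -/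
theorem Localized.eventually_measure_linearNoise_le [l.IsCountablyGenerated]
    (H : Localized l h x β x₀ β₀) (hq : 1 ≤ q) (hs : IsRegressionSample μ f m σ X Y ε)
    (hL : IsDirectionalKernel L) (hf : Continuous f) (hm : ContDiffOn ℝ 2 (radialExt m) {0}ᶜ)
    {N : ι → ℕ} (hN : Tendsto (fun i => (N i : ℝ) * h i ^ q) l atTop)
    {c F C : ℝ} (hc : 0 < c) (hcf : ∀ y, c ≤ f y) (hF : ∀ y, f y ≤ F)
    (hC : ∀ x : Sph q, ‖fderiv ℝ (radialExt m) (x : Amb q)‖ ≤ C) {δ A : ℝ} (hδ : 0 < δ)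
    (hA : 0 < A)
    (hδA : (F * C ^ 2 * (∫ v : Tan q, L (‖v‖ ^ 2 / 2) ^ 2 * ‖v‖ ^ 2) + 1) /
      (c * lambdaLim q L / 2 * A) ^ 2 ≤ δ / 2) :
    ∀ᶠ i in l, μ {ω | A * (h i / √((N i : ℝ) * h i ^ q)) <
      |linearNoise L X f m (N i) (h i) (x i) ω|} ≤ ENNReal.ofReal δ := by
  have hl := lambdaLim_pos hq hL
  have hf0 : ∀ y, 0 ≤ f y := fun y => hc.le.trans (hcf y)
  set s := c * lambdaLim q L / 2 with hs_def
  have hs0 : 0 < s := by positivity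
  have h1 := H.tendsto_kernelAvg hs hf hf0 hL hN
    (H.localLimit_continuous (a := fun _ => 1) continuous_const)
  simp only [mul_one, integral_kernel_norm hq] at h1
  have hlt : s < f x₀ * lambdaLim q L := by
    have := mul_le_mul_of_nonneg_right (hcf x₀) hl.le
    have := mul_pos hc hl
    linarith
  have h2 := (eventually_probFilter (P := fun i ω =>
    s < kernelAvg L X (N i) (h i) (x i) (fun _ => 1) ω)).1 (h1.eventually_const_lt hlt)
  have h3 := h2.eventually_le_const (u := ENNReal.ofReal (δ / 2))
    (ENNReal.ofReal_pos.2 (half_pos hδ))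
  filter_upwards [h3, hN.eventually_gt_atTop 0, H.eventually_linearPart_sq_le hL hf hf0 hm hF hC]
    with i hi1 hi2 hi3
  have h4 := hs.measure_kernelAvg_linearPart_le hf.measurable hf0 hL (H.h_pos i) hi2 (x i)
    (mul_pos hs0 hA)
  have h5 := h4.trans (ENNReal.ofReal_le_ofReal
    ((div_le_div_of_nonneg_right hi3 (sq_nonneg _)).trans hδA))
  have h6 := (measure_union_le _ _).trans (add_le_add hi1 h5)
  rw [← ENNReal.ofReal_add (by positivity) (by positivity), add_halves] at h6
  refine le_trans (measure_mono fun ω hω => ?_) h6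
  by_cases hS : s < kernelAvg L X (N i) (h i) (x i) (fun _ => 1) ω
  · right
    have hω' : A * (h i / √((N i : ℝ) * h i ^ q)) <
      |linearNoise L X f m (N i) (h i) (x i) ω| := hω
    have hS0 := hs0.trans hS
    rw [linearNoise, abs_mul, abs_inv, abs_of_pos hS0, inv_mul_eq_div, lt_div_iff₀ hS0] at hω'
    have hr : 0 ≤ A * (h i / √((N i : ℝ) * h i ^ q)) := by
      have := H.h_pos i
      positivity
    refine le_trans ?_ hω'.le
    rw [mul_assoc, mul_comm]
    exact mul_le_mul_of_nonneg_left hS.le hr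
  · exact Or.inl hS

end LinearPart

/-! ### Uniform stochastic orders from localized limits -/

section Uniform

variable {Ω S K : Type*} [MeasurableSpace Ω] {μ : Measure Ω} [TopologicalSpace K] [CompactSpace K]

theorem unifLittleOP_of_localized {R : ℕ → S → Ω → ℝ} {r : ℕ → ℝ} (hr : ∀ᶠ n in atTop, 0 < r n)
    (g : ℕ × S → K)
    (h : ∀ p, Tendsto (fun z : (ℕ × S) × Ω => R z.1.1 z.1.2 z.2 / r z.1.1)
      (probFilter μ ((atTop ×ˢ ⊤) ⊓ comap g (𝓝 p))) (𝓝 0)) : UnifLittleOP μ R r := by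
  intro δ hδ
  refine tendsto_iSup_of_tendsto_prod_top (tendsto_of_forall_tendsto_inf_comap g fun p => ?_)
  have h1 : ∀ᶠ z in probFilter μ ((atTop ×ˢ ⊤) ⊓ comap g (𝓝 p)),
      ¬ δ * r z.1.1 < |R z.1.1 z.1.2 z.2| := by
    have h2 : ∀ᶠ i : ℕ × S in (atTop ×ˢ ⊤) ⊓ comap g (𝓝 p), 0 < r i.1 :=
      (tendsto_fst.mono_left inf_le_left).eventually hr
    have h3 := (h p).abs.eventually_lt_const (u := δ) (by simpa using hδ)
    filter_upwards [h3, (tendsto_fst_probFilter (μ := μ)).eventually h2] with z hz hz'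
    rw [abs_div, abs_of_pos hz', div_lt_iff₀ hz'] at hz
    exact not_lt.2 hz.le
  have h4 := (eventually_probFilter
    (P := fun (i : ℕ × S) ω => ¬ δ * r i.1 < |R i.1 i.2 ω|)).1 h1
  simpa only [not_not] using h4

theorem eventually_iSup_le_of_localized {G : ℕ → S → ENNReal} {a : ENNReal} (g : ℕ × S → K)
    (h : ∀ p, ∀ᶠ i in (atTop ×ˢ ⊤) ⊓ comap g (𝓝 p), G i.1 i.2 ≤ a) :
    ∀ᶠ n in atTop, ⨆ x, G n x ≤ a := by
  have h1 : ∀ᶠ i : ℕ × S in atTop ×ˢ ⊤, G i.1 i.2 ≤ a :=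
    mem_of_forall_mem_inf_comap g h
  obtain ⟨pa, hpa, pb, hpb, hab⟩ := eventually_prod_iff.1 h1
  rw [eventually_top] at hpb
  filter_upwards [hpa] with n hn
  exact iSup_le fun x => hab hn (hpb x)

end Uniform

/-! ### The projected local estimators -/

section Weights

variable {q n : ℕ}

/-- The weight of the `j`-th response in the projected local estimator. -/
def projWeight (L : ℝ → ℝ) (b : Sph q → Fin q → Amb q) (h : ℝ) (p : Fin 2) (x : Sph q)
    (xs : Fin n → Sph q) (j : Fin n) : ℝ :=
  match p with
  | 0 => wlsWeight (designZero n) (fun i => kernelH L h x (xs i)) j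
  | 1 => wlsWeight (designOne b x xs) (fun i => kernelH L h x (xs i)) j

theorem projLocalEst_eq_sum (L : ℝ → ℝ) (b : Sph q → Fin q → Amb q) (h : ℝ) (p : Fin 2) (x : Sph q)
    (xs : Fin n → Sph q) (ys : Fin n → ℝ) :
    projLocalEst L b h p x xs ys = ∑ j, projWeight L b h p x xs j * ys j := by
  fin_cases p
  · exact wlsIntercept_eq_sum _ _ _
  · exact wlsIntercept_eq_sum _ _ _

theorem measurable_projWeight {L : ℝ → ℝ} (hL : IsDirectionalKernel L) (b : Sph q → Fin q → Amb q)
    (h : ℝ) (p : Fin 2) (x : Sph q) :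
    Measurable fun xs : Fin n → Sph q => projWeight L b h p x xs := by
  have hw : ∀ i : Fin n, Measurable fun xs : Fin n → Sph q => kernelH L h x (xs i) := fun i =>
    ((continuous_rawKernel hL h x).measurable.const_mul (lambdaH q h L * h ^ q)⁻¹).comp
      (measurable_pi_apply i)
  refine measurable_pi_lambda _ fun j => ?_
  fin_cases p
  · exact measurable_wlsWeight (D := fun _ : Fin n → Sph q => designZero n)
      (fun _ _ => measurable_const) hw j
  · refine measurable_wlsWeight (D := fun xs : Fin n → Sph q => designOne b x xs)
      (fun i a => ?_) hw j
    induction a using Fin.cases with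
    | zero => exact measurable_const
    | succ k =>
      change Measurable fun xs : Fin n → Sph q => inner ℝ ((xs i : Amb q) - x) (b x k)
      fun_prop

variable {Ω : Type*} {X : ℕ → Ω → Sph q} {L : ℝ → ℝ}

theorem projWeight_zero {h : ℝ} (hl : lambdaH q h L * h ^ q ≠ 0) (hn : (n : ℝ) * h ^ q ≠ 0)
    (b : Sph q → Fin q → Amb q) {x : Sph q} {ω : Ω}
    (hdet : (gram (d := 0) L X n h x (fun _ _ => 1) ω).det ≠ 0) (j : Fin n) :
    projWeight L b h 0 x (fun i : Fin n => X i ω) j =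
      localWeight (d := 0) L X n h x (fun _ _ => 1) ω j :=
  wlsWeight_eq (D := designZero n) (Z := Matrix.of fun _ _ => 1) (S := fun _ => 1)
    (K := fun j => rawKernel L h x (X j ω)) (fun _ => one_ne_zero) rfl
    (fun _ _ => (mul_one _).symm) (inv_ne_zero hl) (inv_ne_zero hn) (fun _ => rfl)
    (fun _ _ => rfl) hdet j

/-- Dividing the tangential columns by `h` changes the slopes but not the intercept, and the
normalization of the kernel cancels. -/
theorem projWeight_one {h : ℝ} (hh : h ≠ 0) (hl : lambdaH q h L * h ^ q ≠ 0)
    (hn : (n : ℝ) * h ^ q ≠ 0) (b : Sph q → Fin q → Amb q) {x : Sph q} {ω : Ω}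
    (hdet : (gram L X n h x (linDesign h x (b x)) ω).det ≠ 0) (j : Fin n) :
    projWeight L b h 1 x (fun i : Fin n => X i ω) j =
      localWeight L X n h x (linDesign h x (b x)) ω j := by
  refine wlsWeight_eq (D := designOne b x fun i : Fin n => X i ω)
    (Z := Matrix.of fun j a => linDesign h x (b x) a (X j ω)) (S := Fin.cons 1 fun _ => h)
    (K := fun j => rawKernel L h x (X j ω)) (fun a => ?_) rfl
    (fun j a => ?_) (inv_ne_zero hl) (inv_ne_zero hn) (fun _ => rfl)
    (fun _ _ => rfl) hdet j
  · induction a using Fin.cases with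
    | zero => exact one_ne_zero
    | succ k => exact hh
  · induction a using Fin.cases with
    | zero => exact (mul_one _).symm
    | succ k => exact (div_mul_cancel₀ _ hh).symm

end Weights

/-- The points of the sphere with a frame of the orthogonal complement. -/
abbrev FrameSpace (q : ℕ) : Type :=
  {p : Sph q × (Fin q → Sph q) // IsFrameAt p.1 fun j => (p.2 j : Amb q)}

/-- A closed condition (identity Gram matrix) in a product of spheres. The frames are part of the
space because `x ↦ b x` is not assumed continuous, and cannot be on even-dimensional spheres;
localization supplies a limiting frame instead. -/
theorem compactSpace_frameSpace (q : ℕ) : CompactSpace (FrameSpace q) := by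
  refine isCompact_iff_compactSpace.1 (IsClosed.isCompact (s := {p : Sph q × (Fin q → Sph q) |
    IsFrameAt p.1 fun j => (p.2 j : Amb q)}) ?_)
  have hc : ∀ a : Fin (q + 1), Continuous fun p : Sph q × (Fin q → Sph q) =>
      (Fin.cons (p.1 : Amb q) fun j => (p.2 j : Amb q) : Fin (q + 1) → Amb q) a := by
    intro a
    induction a using Fin.cases with
    | zero => exact continuous_subtype_val.comp continuous_fst
    | succ k => exact continuous_subtype_val.comp ((continuous_apply k).comp continuous_snd)
  have h1 : {p : Sph q × (Fin q → Sph q) | IsFrameAt p.1 fun j => (p.2 j : Amb q)} =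
      ⋂ a, ⋂ b, {p | inner ℝ
        ((Fin.cons (p.1 : Amb q) fun j => (p.2 j : Amb q) : Fin (q + 1) → Amb q) a)
        ((Fin.cons (p.1 : Amb q) fun j => (p.2 j : Amb q) : Fin (q + 1) → Amb q) b) =
          if a = b then (1 : ℝ) else 0} := by
    ext p
    simp only [mem_iInter, mem_ofPred_eq]
    exact orthonormal_iff_ite
  have h2 := isClosed_iInter fun a => isClosed_iInter fun b =>
    isClosed_eq ((hc a).inner (𝕜 := ℝ) (hc b))
      (continuous_const (y := if a = b then (1 : ℝ) else 0))
  rw [← h1] at h2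
  exact h2

/-- The frame at `x` given by `b`. -/
def IsTangentFrame.frameSpace {q : ℕ} {b : Sph q → Fin q → Amb q} (hb : IsTangentFrame b)
    (x : Sph q) : FrameSpace q :=
  ⟨(x, fun j => ⟨b x j, by simpa using (hb x).1 j.succ⟩), hb x⟩

/-- The bandwidths, points and frames localized at a point of the frame space. -/
theorem IsTangentFrame.localized {q : ℕ} {b : Sph q → Fin q → Amb q} (hb : IsTangentFrame b)
    {h : ℕ → ℝ} (h_pos : ∀ n, 0 < h n) (h_zero : Tendsto h atTop (𝓝 0)) (p : FrameSpace q) :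
    Localized ((atTop ×ˢ ⊤) ⊓ comap (fun i : ℕ × Sph q => hb.frameSpace i.2) (𝓝 p))
      (fun i => h i.1) (fun i => i.2) (fun i => b i.2) p.1.1 (fun j => (p.1.2 j : Amb q)) := by
  have h1 : Tendsto (fun i : ℕ × Sph q => (hb.frameSpace i.2).1)
      ((atTop ×ˢ ⊤) ⊓ comap (fun i : ℕ × Sph q => hb.frameSpace i.2) (𝓝 p)) (𝓝 p.1) :=
    (continuous_subtype_val.tendsto p).comp (tendsto_comap.mono_left inf_le_right)
  have h2 : ∀ j, Continuous fun p : Sph q × (Fin q → Sph q) => (p.2 j : Amb q) := fun j =>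
    continuous_subtype_val.comp ((continuous_apply j).comp continuous_snd)
  exact
    { h_pos := fun i => h_pos i.1
      h_zero := h_zero.comp (tendsto_fst.mono_left inf_le_left)
      frame := fun i => hb i.2
      frame₀ := p.2
      tendsto_x := (continuous_fst.tendsto p.1).comp h1
      tendsto_β := fun j => ((h2 j).tendsto p.1).comp h1 }

section Expansion

variable {q : ℕ} {Ω : Type*} [MeasurableSpace Ω] {μ : Measure Ω} [IsProbabilityMeasure μ]
  {f m σ : Sph q → ℝ} {X : ℕ → Ω → Sph q} {Y ε : ℕ → Ω → ℝ} {L : ℝ → ℝ}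
  {l : Filter (ℕ × Sph q)} [l.IsCountablyGenerated] {h : ℕ → ℝ}
  {b : Sph q → Fin q → Amb q} {x₀ : Sph q} {β₀ : Fin q → Amb q}

/-- With probability tending to one, the weights of the estimators are local regression weights. -/
theorem Localized.eventually_projWeight
    (H : Localized l (fun i => h i.1) (fun i => i.2) (fun i => b i.2) x₀ β₀)
    (hq : 1 ≤ q) (hs : IsRegressionSample μ f m σ X Y ε) (hf : Continuous f) (hf0 : ∀ y, 0 < f y)
    (hL : IsDirectionalKernel L)
    (hN : Tendsto (fun i : ℕ × Sph q => (i.1 : ℝ) * h i.1 ^ q) l atTop) :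
    ∀ᶠ z : (ℕ × Sph q) × Ω in probFilter μ l,
      (∀ j, projWeight L b (h z.1.1) 0 z.1.2 (fun i : Fin z.1.1 => X i z.2) j =
        localWeight (d := 0) L X z.1.1 (h z.1.1) z.1.2 (fun _ _ => 1) z.2 j) ∧
      ∀ j, projWeight L b (h z.1.1) 1 z.1.2 (fun i : Fin z.1.1 => X i z.2) j =
        localWeight L X z.1.1 (h z.1.1) z.1.2 (linDesign (h z.1.1) z.1.2 (b z.1.2)) z.2 j := by
  obtain ⟨η, hη, hlam⟩ := exists_lambdaH_pos (q := q) hL hq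
  have h1 : ∀ᶠ i : ℕ × Sph q in l, h i.1 < η ∧ (i.1 : ℝ) * h i.1 ^ q ≠ 0 :=
    (H.h_zero.eventually_lt_const hη).and (hN.eventually_ne_atTop 0)
  filter_upwards [(tendsto_fst_probFilter (μ := μ)).eventually h1,
    ((H.localDesign_const hq hL).gram_inv H hs hf hf0 hL hN).1,
    ((H.localDesign_lin hq hL).gram_inv H hs hf hf0 hL hN).1] with z hz hz0 hz1
  have hh := H.h_pos z.1
  have hl : lambdaH q (h z.1.1) L * h z.1.1 ^ q ≠ 0 :=
    mul_ne_zero (hlam _ hh hz.1).ne' (pow_ne_zero _ hh.ne')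
  exact ⟨projWeight_zero hl hz.2 b hz0, projWeight_one hh.ne' hl hz.2 b hz1⟩

theorem Localized.tendsto_projWeight_sq
    (H : Localized l (fun i => h i.1) (fun i => i.2) (fun i => b i.2) x₀ β₀)
    (hq : 1 ≤ q) (hs : IsRegressionSample μ f m σ X Y ε) (hf : Continuous f) (hf0 : ∀ y, 0 < f y)
    (hσ : Continuous fun y => σ y ^ 2) (hL : IsDirectionalKernel L)
    (hN : Tendsto (fun i : ℕ × Sph q => (i.1 : ℝ) * h i.1 ^ q) l atTop) (p : Fin 2) :
    Tendsto (fun z : (ℕ × Sph q) × Ω => (z.1.1 : ℝ) * h z.1.1 ^ q *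
      ∑ j, projWeight L b (h z.1.1) p z.1.2 (fun i : Fin z.1.1 => X i z.2) j ^ 2 *
        σ (X j z.2) ^ 2) (probFilter μ l)
      (𝓝 (lambdaLim q (fun r => L r ^ 2) * (lambdaLim q L ^ 2)⁻¹ / f x₀ * σ x₀ ^ 2)) := by
  have hw := H.eventually_projWeight hq hs hf hf0 hL hN
  fin_cases p
  · refine ((H.localDesign_const hq hL).tendsto_sum_localWeight_sq H hq hs hf hf0 hL hN
      hσ).congr' ?_
    filter_upwards [hw] with z hz
    exact congrArg _ (Finset.sum_congr rfl fun j _ => by rw [← hz.1 j]; rfl)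
  · refine ((H.localDesign_lin hq hL).tendsto_sum_localWeight_sq H hq hs hf hf0 hL hN
      hσ).congr' ?_
    filter_upwards [hw] with z hz
    exact congrArg _ (Finset.sum_congr rfl fun j _ => by rw [← hz.2 j]; rfl)

theorem Localized.tendsto_projWeight_bias
    (H : Localized l (fun i => h i.1) (fun i => i.2) (fun i => b i.2) x₀ β₀)
    (hq : 1 ≤ q) (hs : IsRegressionSample μ f m σ X Y ε)
    (hf : ContDiffOn ℝ 2 (radialExt f) {0}ᶜ) (hf0 : ∀ y, 0 < f y)
    (hm : ContDiffOn ℝ 2 (radialExt m) {0}ᶜ) (hL : IsDirectionalKernel L)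
    (hN : Tendsto (fun i : ℕ × Sph q => (i.1 : ℝ) * h i.1 ^ q) l atTop) (p : Fin 2) :
    Tendsto (fun z : (ℕ × Sph q) × Ω =>
      ((∑ j, projWeight L b (h z.1.1) p z.1.2 (fun i : Fin z.1.1 => X i z.2) j * m (X j z.2)) -
        m z.1.2 - if p = 0 then linearNoise L X f m z.1.1 (h z.1.1) z.1.2 z.2 else 0) /
          h z.1.1 ^ 2) (probFilter μ l)
      (𝓝 (bConst q L / q * biasTerm f m p x₀)) := by
  have hfc := continuous_of_contDiffOn (n := 2) hf
  have hw := H.eventually_projWeight hq hs hfc hf0 hL hN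
  fin_cases p
  · refine (H.tendsto_bias_const hq hs hf hf0 hm hL hN).congr' ?_
    filter_upwards [hw] with z hz
    simp only [← hz.1]
    rfl
  · refine (H.tendsto_bias_lin hq hs hfc hf0 hm hL hN).congr' ?_
    filter_upwards [hw] with z hz
    simp only [← hz.2]
    simp

end Expansion

end ProjLocal

end
-- The expansions of bias and variance.
theorem theorem1 {q : ℕ} (hq : 1 ≤ q) {Ω : Type*} [MeasurableSpace Ω]
    (μ : Measure Ω) [IsProbabilityMeasure μ]
    (f m σ : Sph q → ℝ) (X : ℕ → Ω → Sph q) (Y ε : ℕ → Ω → ℝ)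
    (hsample : IsRegressionSample μ f m σ X Y ε)
    (hm : ContDiffOn ℝ 3 (radialExt m) {0}ᶜ)
    (hf : ContDiffOn ℝ 2 (radialExt f) {0}ᶜ)
    (hf_pos : ∃ c : ℝ, 0 < c ∧ ∀ x, c ≤ f x)
    (hσ : UniformContinuous fun x => σ x ^ 2)
    (hσ_pos : ∃ c : ℝ, 0 < c ∧ ∀ x, c ≤ σ x ^ 2)
    (L : ℝ → ℝ) (hL : IsDirectionalKernel L)
    (h : ℕ → ℝ) (h_pos : ∀ n, 0 < h n) (h_zero : Tendsto h atTop (𝓝 0))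
    (h_inf : Tendsto (fun n : ℕ => (n : ℝ) * h n ^ q) atTop atTop)
    (b : Sph q → Fin q → EuclideanSpace ℝ (Fin (q + 1))) (hb : IsTangentFrame b)
    (p : Fin 2) :
    (∃ R T : ℕ → Sph q → Ω → ℝ,
      UnifLittleOP μ R (fun n => h n ^ 2) ∧
      UnifBigOP μ T (fun n => h n / √((n : ℝ) * h n ^ q)) ∧
      ∀ n x ω,
        condMean μ
            (fun ω' => projLocalEst L b (h n) p x (fun i : Fin n => X i ω') (fun i => Y i ω') - m x)
            (fun ω' (i : Fin n) => X i ω') ω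
          = bConst q L / q * biasTerm f m p x * h n ^ 2 + R n x ω
            + (if p = 0 then T n x ω else 0)) ∧
    UnifLittleOP μ
      (fun n x ω =>
        condVariance μ
            (fun ω' => projLocalEst L b (h n) p x (fun i : Fin n => X i ω') (fun i => Y i ω'))
            (fun ω' (i : Fin n) => X i ω') ω
          - lambdaLim q (fun r => L r ^ 2) * (lambdaLim q L ^ 2)⁻¹ / ((n : ℝ) * h n ^ q * f x)
            * σ x ^ 2)
      (fun n => ((n : ℝ) * h n ^ q)⁻¹) := by
  obtain ⟨c, hc, hcf⟩ := hf_pos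
  obtain ⟨c', hc', hσ'⟩ := hσ_pos
  have hf0 : ∀ y, 0 < f y := fun y => hc.trans_le (hcf y)
  have hσ0 : ∀ y, σ y ≠ 0 := fun y h0 => by
    have := hσ' y
    rw [h0] at this
    linarith [sq (0 : ℝ)]
  have hm2 : ContDiffOn ℝ 2 (radialExt m) {0}ᶜ := hm.of_le (by norm_num)
  have hfc := continuous_of_contDiffOn (n := 2) hf
  have hmc := continuous_of_contDiffOn (n := 2) hm2
  have := compactSpace_frameSpace q
  let g : ℕ × Sph q → FrameSpace q := fun i => hb.frameSpace i.2
  have H := fun p => hb.localized h_pos h_zero p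
  have hN : ∀ p, Tendsto (fun i : ℕ × Sph q => (i.1 : ℝ) * h i.1 ^ q)
      ((atTop ×ˢ ⊤) ⊓ comap g (𝓝 p)) atTop := fun p =>
    h_inf.comp (tendsto_fst.mono_left inf_le_left)
  -- The null set may depend on `(n, x)`: the supremum over `x` is taken outside the probability.
  have hae := fun i : ℕ × Sph q => hsample.ae_condMean_condVariance hmc.measurable hσ0
    (measurable_projWeight (n := i.1) hL b (h i.1) p i.2) (m i.2)
  -- `R` is defined as what is left, so the decomposition is an identity and only the orders have to
  -- be proved.
  refine ⟨⟨fun n x ω => condMean μ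
      (fun ω' => projLocalEst L b (h n) p x (fun i : Fin n => X i ω') (fun i => Y i ω') - m x)
        (fun ω' (i : Fin n) => X i ω') ω - bConst q L / q * biasTerm f m p x * h n ^ 2 -
        (if p = 0 then linearNoise L X f m n (h n) x ω else 0),
    fun n x ω => linearNoise L X f m n (h n) x ω, ?_, ?_, fun n x ω => by ring⟩, ?_⟩
  · refine unifLittleOP_of_localized (Eventually.of_forall fun n => pow_pos (h_pos n) 2) g
      fun k => ?_
    -- The normalized bias and its claimed value at the moving point have the same limit at the
    -- localization point.
    have h1 := ((H k).tendsto_projWeight_bias hq hsample hf hf0 hm2 hL (hN k) p).sub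
      ((((H k).tendsto_biasTerm hf hm2 hf0 p).const_mul (bConst q L / q)).comp
        (tendsto_fst_probFilter (μ := μ)))
    rw [sub_self] at h1
    refine h1.congr' ?_
    filter_upwards [eventually_probFilter_of_ae hae] with z hz
    simp_rw [projLocalEst_eq_sum]
    rw [hz.1]
    have := (h_pos z.1.1).ne'
    simp only [Function.comp_apply]
    field_simp
    ring
  · obtain ⟨F, hF⟩ := (isCompact_range hfc).bddAbove
    obtain ⟨C, hC0, hC⟩ := exists_bound_fderiv hm2
    intro δ hδ
    have hl := lambdaLim_pos hq hL
    have h1 : Tendsto (fun A : ℝ =>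
        (F * C ^ 2 * (∫ v : Tan q, L (‖v‖ ^ 2 / 2) ^ 2 * ‖v‖ ^ 2) + 1) /
          (c * lambdaLim q L / 2 * A) ^ 2) atTop (𝓝 0) :=
      tendsto_const_nhds.div_atTop ((tendsto_pow_atTop two_ne_zero).comp
        (tendsto_id.const_mul_atTop (by positivity)))
    -- `A` makes the Chebyshev bound at most `δ/2`; it depends on global bounds only, hence serves
    -- all localizations.
    obtain ⟨A, hA, hA0⟩ := ((h1.eventually_le_const (half_pos hδ)).and
      (eventually_gt_atTop 0)).exists
    exact ⟨A, eventually_iSup_le_of_localized g fun k =>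
      (H k).eventually_measure_linearNoise_le hq hsample hL hfc hm2 (hN k) hc hcf
        (fun y => hF (mem_range_self y)) hC hδ hA0 hA⟩
  · refine unifLittleOP_of_localized ?_ g fun k => ?_
    · filter_upwards [h_inf.eventually_gt_atTop 0] with n hn
      exact inv_pos.2 hn
    -- As for the bias: `n h^q` times the variance and the claimed constant at the moving point have
    -- a common limit.
    have h1 := ((H k).tendsto_projWeight_sq hq hsample hfc hf0 hσ.continuous hL (hN k) p).sub
      ((((tendsto_const_nhds (x := lambdaLim q (fun r => L r ^ 2) * (lambdaLim q L ^ 2)⁻¹)).div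
        ((hfc.tendsto _).comp (H k).tendsto_x) (hf0 _).ne').mul
        ((hσ.continuous.tendsto _).comp (H k).tendsto_x)).comp
        (tendsto_fst_probFilter (μ := μ)))
    rw [sub_self] at h1
    refine h1.congr' ?_
    filter_upwards [eventually_probFilter_of_ae hae, (tendsto_fst_probFilter (μ := μ)).eventually
      ((hN k).eventually_gt_atTop 0)] with z hz hz'
    simp_rw [projLocalEst_eq_sum]
    rw [hz.2]
    have := (hf0 z.1.2).ne'
    have := (lambdaLim_pos hq hL).ne'
    simp only [Function.comp_apply, Pi.div_apply]
    generalize (z.1.1 : ℝ) * h z.1.1 ^ q = u at hz' ⊢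
    have := hz'.ne'
    field_simp
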